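/- For a graph $G$ let $\alpha(G)$ be its independence number, and let $\mathrm{iocp}(G)$ be the maximum integer $m\ge 0$ such that $G$ contains an induced subgraph that is the disjoint union of $m$ odd cycles (triangles included, with no edges of $G$ between different cycles). There is a randomized algorithm that takes as input integers $k\ge 0$ and $p\ge 1$ and an $n$-vertex graph $G$ ($n\ge 1$) with $\mathrm{iocp}(G)\le k$, always returns an independent set of $G$, and with probability at least $1/2$ returns one of size at least $(1-k/p)\,\alpha(G)$. For fixed $k$ and $p$ its running time is $n^{O(k+p\log n)}$, where the constant in the exponent does not depend on $k$ and $p$: there are an absolute constant $C$ and a function $K$ of $k$ and $p$ only such that, on every input and for every outcome of its random choices, the algorithm stops after at most $K(k,p)\cdot n^{C(k+p\log n)}$ steps. Here an algorithm is a fixed program in a first-order functional language with recursion over natural numbers and pairs, where each evaluation step, addition, truncated subtraction, test for zero and fair coin flip costs one unit of time; graphs are given by adjacency matrices. -/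

import Mathlib

/-- The disjoint union of `m` cycles, the `i`-th one having length `ℓ i`
(with no edges between different cycles). -/
def cycleUnion {m : ℕ} (ℓ : Fin m → ℕ) : SimpleGraph (Σ i : Fin m, Fin (ℓ i)) where
  Adj x y := ∃ (i : Fin m) (a b : Fin (ℓ i)),
    x = ⟨i, a⟩ ∧ y = ⟨i, b⟩ ∧ (SimpleGraph.cycleGraph (ℓ i)).Adj a b
  symm := ⟨by
    rintro x y ⟨i, a, b, rfl, rfl, h⟩
    exact ⟨i, b, a, rfl, rfl, h.symm⟩⟩
  loopless := ⟨by
    rintro x ⟨i, a, b, rfl, h, hab⟩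
    obtain rfl : a = b := by simpa using h
    exact hab.ne rfl⟩

/-- `G` contains an induced subgraph consisting of `m` pairwise vertex-disjoint odd cycles
(`↪g` is an embedding onto an induced subgraph). -/
def HasInducedOddCyclePacking {V : Type*} (G : SimpleGraph V) (m : ℕ) : Prop :=
  ∃ ℓ : Fin m → ℕ, (∀ i, Odd (ℓ i) ∧ 3 ≤ ℓ i) ∧ Nonempty (cycleUnion ℓ ↪g G)

/-- The induced odd cycle packing number. -/
noncomputable def iocp {V : Type*} (G : SimpleGraph V) : ℕ :=
  sSup {m | HasInducedOddCyclePacking G m}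

/-- On a finite graph the supremum that defines `iocp` is a maximum. -/
theorem iocp_isGreatest {V : Type*} [Finite V] (G : SimpleGraph V) :
    IsGreatest {m | HasInducedOddCyclePacking G m} (iocp G) := by
  have hb : BddAbove {m | HasInducedOddCyclePacking G m} := by
    refine ⟨Nat.card V, ?_⟩
    rintro m ⟨ℓ, hℓ, ⟨e⟩⟩
    have hinj : Function.Injective
        (fun i : Fin m => e ⟨i, ⟨0, lt_of_lt_of_le (by norm_num) (hℓ i).2⟩⟩) := by
      intro i j hij
      exact congrArg Sigma.fst (e.injective hij)
    simpa using Nat.card_le_card_of_injective _ hinj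
  have hne : {m | HasInducedOddCyclePacking G m}.Nonempty :=
    ⟨0, Fin.elim0, fun i => i.elim0,
      ⟨⟨⟨fun x => x.1.elim0, fun x => x.1.elim0⟩, fun {x} => x.1.elim0⟩⟩⟩
  exact ⟨Nat.sSup_mem hne hb, fun m hm => le_csSup hb hm⟩

/-! ### Randomized algorithms

The machine model is a first-order functional language with recursion, working on natural numbers
and pairs. Each evaluation step, each arithmetic operation (addition, truncated subtraction; there
is no multiplication) and each flip of a fair coin costs one time unit. -/

namespace RandProg

/-- The data that programs work on: natural numbers and pairs. -/
inductive Val : Type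
  | nat (m : ℕ)
  | pair (a b : Val)

/-- The number stored in a value (`0` if it is a pair). -/
def Val.toNat : Val → ℕ
  | .nat m => m
  | .pair _ _ => 0

/-- The first component of a pair (`0` if the value is a number). -/
def Val.fst : Val → Val
  | .nat _ => .nat 0
  | .pair a _ => a

/-- The second component of a pair (`0` if the value is a number). -/
def Val.snd : Val → Val
  | .nat _ => .nat 0
  | .pair _ b => b

/-- Lists as values: `0` is the empty list. -/
def Val.ofList : List Val → Val
  | [] => .nat 0
  | a :: l => .pair a (Val.ofList l)

/-- Expressions. Variables are de Bruijn indices. -/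
inductive Expr : Type
  /-- the value of a variable -/
  | var (i : ℕ)
  /-- a constant -/
  | lit (m : ℕ)
  /-- addition -/
  | add (a b : Expr)
  /-- truncated subtraction -/
  | sub (a b : Expr)
  /-- formation of a pair -/
  | pair (a b : Expr)
  /-- first component -/
  | fst (a : Expr)
  /-- second component -/
  | snd (a : Expr)
  /-- evaluate `c`; if it is the number `0` continue with `a`, otherwise with `b` -/
  | ifZero (c a b : Expr)
  /-- evaluate `c`; if it is a pair continue with `a`, otherwise with `b` -/
  | ifPair (c a b : Expr)
  /-- evaluate `a`, bind its value to variable `0`, and continue with `b` -/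
  | letIn (a b : Expr)
  /-- evaluate `a` and call the `f`-th function of the program on its value -/
  | call (f : ℕ) (a : Expr)
  /-- a fair coin flip, with value `0` or `1` -/
  | flip

/-- A program is a finite list of (mutually recursive) function bodies. The body of a function is
evaluated with variable `0` bound to the argument. The function number `0` is the main one. -/
abbrev Program : Type := List Expr

/-- A randomized computation: the distribution of a result together with the number of time units
spent, where `none` stands for a computation that did not finish. -/
abbrev Comp (α : Type) : Type := PMF (Option (α × ℕ))

/-- Return `a` at a cost of `t` time units. -/
noncomputable def Comp.ret {α : Type} (a : α) (t : ℕ) : Comp α := PMF.pure (some (a, t))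

/-- Sequential composition: the costs add up. -/
noncomputable def Comp.andThen {α β : Type} (x : Comp α) (f : α → Comp β) : Comp β :=
  PMF.bind x fun o =>
    match o with
    | none => PMF.pure none
    | some (a, s) => PMF.map (Option.map fun r => (r.1, s + r.2)) (f a)

/-- Spend one time unit, then continue as `x`. -/
noncomputable def Comp.tick {α : Type} (x : Comp α) : Comp α :=
  PMF.map (Option.map fun r => (r.1, r.2 + 1)) x

/-- Call-by-value evaluation of an expression in an environment. The first number bounds the depth
of the evaluation tree; a computation that exceeds this bound is cut off with `none`. Each node of
the evaluation tree costs one time unit. -/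
noncomputable def eval (P : Program) : ℕ → List Val → Expr → Comp Val
  | 0, _, _ => PMF.pure none
  | _ + 1, env, .var i => Comp.ret (env.getD i (.nat 0)) 1
  | _ + 1, _, .lit m => Comp.ret (.nat m) 1
  | d + 1, env, .add a b => Comp.tick <|
      (eval P d env a).andThen fun x => (eval P d env b).andThen fun y =>
        Comp.ret (.nat (x.toNat + y.toNat)) 0
  | d + 1, env, .sub a b => Comp.tick <|
      (eval P d env a).andThen fun x => (eval P d env b).andThen fun y =>
        Comp.ret (.nat (x.toNat - y.toNat)) 0
  | d + 1, env, .pair a b => Comp.tick <|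
      (eval P d env a).andThen fun x => (eval P d env b).andThen fun y =>
        Comp.ret (.pair x y) 0
  | d + 1, env, .fst a => Comp.tick <|
      (eval P d env a).andThen fun x => Comp.ret x.fst 0
  | d + 1, env, .snd a => Comp.tick <|
      (eval P d env a).andThen fun x => Comp.ret x.snd 0
  | d + 1, env, .ifZero c a b => Comp.tick <|
      (eval P d env c).andThen fun x =>
        match x with
        | .nat 0 => eval P d env a
        | _ => eval P d env b
  | d + 1, env, .ifPair c a b => Comp.tick <|
      (eval P d env c).andThen fun x =>
        match x with
        | .pair _ _ => eval P d env a
        | .nat _ => eval P d env b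
  | d + 1, env, .letIn a b => Comp.tick <|
      (eval P d env a).andThen fun x => eval P d (x :: env) b
  | d + 1, env, .call f a => Comp.tick <|
      (eval P d env a).andThen fun x => eval P d [x] (P.getD f (.lit 0))
  | _ + 1, _, .flip =>
      PMF.map (fun c : Bool => some (.nat c.toNat, 1)) (PMF.uniformOfFintype Bool)

/-- On input `x`, the program `P` halts within at most `T` time units whatever the outcomes of its
coin flips are, and the distribution of its output is `D`. -/
def Program.HaltsWithin (P : Program) (x : Val) (T : ℝ) (D : PMF Val) : Prop :=
  ∃ (d : ℕ) (R : PMF (Val × ℕ)),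
    eval P d [x] (P.getD 0 (.lit 0)) = R.map some ∧
    (∀ r ∈ R.support, (r.2 : ℝ) ≤ T) ∧
    D = R.map Prod.fst

open Classical in
/-- A graph on the vertices `0, …, n - 1` as a value: `n` and the rows of its adjacency matrix. -/
noncomputable def encodeGraph {n : ℕ} (G : SimpleGraph (Fin n)) : Val :=
  .pair (.nat n) (Val.ofList (List.ofFn fun i =>
    Val.ofList (List.ofFn fun j => .nat (if G.Adj i j then 1 else 0))))

/-- The input `(k, p, G)`. -/
noncomputable def encodeInput (k p : ℕ) {n : ℕ} (G : SimpleGraph (Fin n)) : Val :=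
  .pair (.nat k) (.pair (.nat p) (encodeGraph G))

/-- A set of vertices as a value: the list of the values of its indicator function. -/
def encodeSet {n : ℕ} (S : Finset (Fin n)) : Val :=
  Val.ofList (List.ofFn fun i => .nat (if i ∈ S then 1 else 0))

end RandProg

/-!
The theorem holds even with a deterministic algorithm: the program below does not flip coins, so
that the distribution of its output is concentrated on one independent set.

*Structure of the graph.* Let `I` be a maximum independent set, and let `iocp G ≤ k`. A sequence of
`O(p log n) + f(k, p)` deletions, each of which is described by six numbers at most `n + 1`, leads
to a set `W` of vertices such that `G[W]` is bipartite and `W` contains all but at most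
`(k / p) |I|` elements of `I` (`exists_reach_bip`). A deletion removes a ball, an annulus, or the
vertices of large degree. The deletions are found as follows.

* The neighbourhoods of a sample of `O(p log n)` elements of `I` are deleted. They do not meet `I`,
  and afterwards every vertex is adjacent to a small part of `I` only (`exists_hitting`). Therefore
  the neighbourhood of a triangle can be deleted at a low cost, and this lowers the packing number.
* Once there are no triangles, the neighbourhood of a shortest odd cycle is the union of six
  independent sets, so that the number of vertices is at most `(6 k + 2) |I|`
  (`card_le_of_not_oddPack`). Now a sample of constant size makes the number of edges at `I` so
  small that few elements of `I` have a large degree (`exists_reach_small_degree`).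
* As long as the graph is not bipartite, take a shortest odd cycle `C`. If it is short, its
  neighbourhood is small and is deleted (`ShortestOdd.delete_cycle`). If it is long, a light ball
  around one vertex of `C` and a light sphere around the antipodal vertex are deleted
  (`ShortestOdd.delete_sphere_ball`): the inside of the sphere is bipartite, and the outside is not
  adjacent to `C`. In both cases the packing number decreases, so that there are at most `k` rounds.

*The algorithm.* All sequences of deletions of the given length are tried. For the set `W` that
remains, an auction computes an upper bound for `2 α(G[W])`, which is attained if `G[W]` is
bipartite. The auction takes place on the bipartite double cover of `G[W]`: every vertex bids for a
neighbour of its own, prices rise by one unit at each sale, and the bidders in a set `A` give up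
because all their neighbours have a price above `n + 1`. The other bidders own a neighbour, which
yields the upper bound `|W| + |A|` (`Auction.two_mul_card_le`). Conversely, some price between `1`
and `n + 1` does not occur, and the cut at this price gives an independent set of size `|W| + |A|`
in the double cover, which consists of two copies of `G[W]` if `G[W]` is bipartite
(`Auction.exists_indep`). With these values an independent set is chosen greedily (`runs_solve`).
The largest of the sets found is the output (`runs_search`).

*The running time.* With `a` deletions the search visits about `(n + 2) ^ (6 a)` leaves and spends
polynomial time on each of them. Since `a ≤ 6 p log n + B(k, p)`, this is at most
`K(k, p) * n ^ (38 (k + p log n))`; a mixed term like `6 B log n` of the exponent is at most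
`9 B ^ 2 + (log n) ^ 2` (`totalCost_le_rpow`).
-/

/-! ### Walks inside a set of vertices and bipartite sets -/

section Graph

variable {V : Type*} {G : SimpleGraph V} {W W' : Finset V}

/-- There is a walk of length `q` from `u` to `v` all of whose vertices lie in `W`. -/
def WalkIn (G : SimpleGraph V) (W : Finset V) (q : ℕ) (u v : V) : Prop :=
  ∃ p : G.Walk u v, p.length = q ∧ ∀ x ∈ p.support, x ∈ W

theorem WalkIn.refl {u : V} (h : u ∈ W) : WalkIn G W 0 u u :=
  ⟨.nil, rfl, by simpa using h⟩

theorem WalkIn.cons {q : ℕ} {u v w : V} (hu : u ∈ W) (h : G.Adj u v) (hw : WalkIn G W q v w) :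
    WalkIn G W (q + 1) u w := by
  obtain ⟨p, rfl, hp⟩ := hw
  refine ⟨.cons h p, rfl, fun x hx => ?_⟩
  rw [SimpleGraph.Walk.support_cons, List.mem_cons] at hx
  rcases hx with rfl | hx
  exacts [hu, hp x hx]

theorem WalkIn.trans {q r : ℕ} {u v w : V} (h : WalkIn G W q u v) (h' : WalkIn G W r v w) :
    WalkIn G W (q + r) u w := by
  obtain ⟨p, rfl, hp⟩ := h
  obtain ⟨p', rfl, hp'⟩ := h'
  refine ⟨p.append p', by simp, fun x hx => ?_⟩
  rw [SimpleGraph.Walk.mem_support_append_iff] at hx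
  exact hx.elim (hp x) (hp' x)

theorem WalkIn.symm {q : ℕ} {u v : V} (h : WalkIn G W q u v) : WalkIn G W q v u := by
  obtain ⟨p, rfl, hp⟩ := h
  exact ⟨p.reverse, by simp, by simpa using hp⟩

theorem WalkIn.mono {q : ℕ} {u v : V} (h : WalkIn G W q u v) (hW : W ⊆ W') :
    WalkIn G W' q u v := by
  obtain ⟨p, hq, hp⟩ := h
  exact ⟨p, hq, fun x hx => hW (hp x hx)⟩

theorem WalkIn.left_mem {q : ℕ} {u v : V} (h : WalkIn G W q u v) : u ∈ W := by
  obtain ⟨p, hq, hp⟩ := h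
  exact hp u p.start_mem_support

theorem WalkIn.eq_of_zero {u v : V} (h : WalkIn G W 0 u v) : u = v := by
  obtain ⟨p, hq, -⟩ := h
  exact SimpleGraph.Walk.eq_of_length_eq_zero hq

theorem WalkIn.exists_adj {q : ℕ} {u v : V} (h : WalkIn G W (q + 1) u v) :
    ∃ w, G.Adj u w ∧ WalkIn G W q w v := by
  obtain ⟨p, hq, hp⟩ := h
  cases p with
  | nil => simp at hq
  | @cons _ w _ huw p =>
    refine ⟨w, huw, p, by simpa using hq, fun x hx => hp x ?_⟩
    rw [SimpleGraph.Walk.support_cons]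
    exact List.mem_cons_of_mem _ hx

/-- `W` induces a bipartite subgraph. -/
def Bip (G : SimpleGraph V) (W : Finset V) : Prop :=
  ∃ col : V → Bool, ∀ u ∈ W, ∀ v ∈ W, G.Adj u v → col u ≠ col v

theorem Bip.mono (h : Bip G W') (hW : W ⊆ W') : Bip G W := by
  obtain ⟨col, hc⟩ := h
  exact ⟨col, fun u hu v hv => hc u (hW hu) v (hW hv)⟩

theorem walkIn_of_induce {u v : (W : Set V)} (w : (G.induce (W : Set V)).Walk u v) :
    WalkIn G W w.length u.1 v.1 := by
  induction w with
  | nil => exact .refl (by simp)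
  | @cons u v w huv p ih => exact .cons (by simp) (by simpa using huv) ih

/-- A set without odd closed walks is bipartite, by the corresponding fact for induced
subgraphs. -/
theorem bip_of_no_odd_walkIn (h : ∀ q u, Odd q → ¬ WalkIn G W q u u) : Bip G W := by
  classical
  have h2 : (G.induce (W : Set V)).Colorable 2 := by
    rw [SimpleGraph.two_colorable_iff_forall_loop_even]
    intro u w
    by_contra hw
    exact h w.length u.1 (Nat.not_even_iff_odd.mp hw) (walkIn_of_induce w)
  obtain ⟨c⟩ := h2
  refine ⟨fun v => if hv : v ∈ W then decide (c ⟨v, hv⟩ = 0) else false, ?_⟩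
  intro u hu v hv huv
  have hc : c ⟨u, hu⟩ ≠ c ⟨v, hv⟩ := c.valid (by simpa using huv)
  simp only [hu, hv, dif_pos]
  revert hc
  generalize c ⟨u, hu⟩ = a
  generalize c ⟨v, hv⟩ = b
  revert a b
  decide

/-- Two bipartite sets without edges between them have a bipartite union. -/
theorem Bip.union [DecidableEq V] {A B : Finset V} (hA : Bip G A) (hB : Bip G B)
    (h : ∀ u ∈ A, ∀ v ∈ B, ¬ G.Adj u v) : Bip G (A ∪ B) := by
  obtain ⟨a, ha⟩ := hA
  obtain ⟨b, hb⟩ := hB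
  refine ⟨fun v => if v ∈ A then a v else b v, fun u hu v hv huv => ?_⟩
  rw [Finset.mem_union] at hu hv
  by_cases hu' : u ∈ A <;> by_cases hv' : v ∈ A
  · simpa [hu', hv'] using ha u hu' v hv' huv
  · exact absurd huv (h u hu' v (hv.resolve_left hv'))
  · exact absurd huv.symm (h v hv' u (hu.resolve_left hu'))
  · simpa [hu', hv'] using hb u (hu.resolve_left hu') v (hv.resolve_left hv') huv

/-! ### Shortest odd closed walks -/

/-- `c` runs periodically through an odd closed walk in `W` of length `ℓ`, and `W` contains no
shorter odd closed walk. -/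
structure ShortestOdd (G : SimpleGraph V) (W : Finset V) (ℓ : ℕ) (c : ℕ → V) : Prop where
  odd : ℓ % 2 = 1
  per : ∀ i, c (i + ℓ) = c i
  mem : ∀ i, c i ∈ W
  adj : ∀ i, G.Adj (c i) (c (i + 1))
  le : ∀ q u, q % 2 = 1 → WalkIn G W q u u → ℓ ≤ q

theorem exists_shortestOdd_of_walkIn (h1 : ∃ q, q % 2 = 1 ∧ ∃ u, WalkIn G W q u u) :
    ∃ ℓ c, ShortestOdd G W ℓ c := by
  classical
  obtain ⟨hodd, u, p, hp, hW⟩ := Nat.find_spec h1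
  set ℓ := Nat.find h1 with hℓ
  have hpos : 0 < ℓ := by omega
  refine ⟨ℓ, fun i => p.getVert (i % ℓ), hodd, fun i => by simp, fun i => ?_, fun i => ?_,
    fun q u hq hw => Nat.find_min' h1 ⟨hq, u, hw⟩⟩
  · exact hW _ (p.getVert_mem_support _)
  · have hlt : i % ℓ < ℓ := Nat.mod_lt _ hpos
    have hadj := p.adj_getVert_succ (i := i % ℓ) (by omega)
    by_cases h1 : i % ℓ + 1 = ℓ
    · have h2 : (i + 1) % ℓ = 0 := by rw [← Nat.mod_add_mod, h1, Nat.mod_self]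
      have h3 : p.getVert (i % ℓ + 1) = p.getVert 0 := by
        rw [h1, ← hp]; simp
      rw [h3] at hadj
      simpa [h2] using hadj
    · have h2 : (i + 1) % ℓ = i % ℓ + 1 := by
        have := Nat.mod_add_div i ℓ
        rw [← this, Nat.add_right_comm, Nat.add_mul_mod_self_left, Nat.mod_eq_of_lt (by omega)]
        simp [Nat.mod_eq_of_lt hlt]
      simpa [h2] using hadj

theorem exists_shortestOdd (h : ¬ Bip G W) : ∃ ℓ c, ShortestOdd G W ℓ c := by
  refine exists_shortestOdd_of_walkIn ?_
  by_contra! hcon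
  exact h (bip_of_no_odd_walkIn fun q u hq => hcon q (Nat.odd_iff.mp hq) u)

namespace ShortestOdd

theorem walkIn {ℓ : ℕ} {c : ℕ → V} (h : ShortestOdd G W ℓ c) (i a : ℕ) :
    WalkIn G W a (c i) (c (i + a)) := by
  induction a generalizing i with
  | zero => exact .refl (h.mem i)
  | succ a ih => exact .cons (h.mem i) (h.adj i) (by
      have := ih (i + 1)
      rwa [Nat.add_assoc, Nat.add_comm 1 a] at this)

/-- A walk between two vertices of a shortest odd closed walk, together with the arc of the
appropriate parity, is an odd closed walk, so it is at least as long as the other arc. -/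
theorem le_of_walkIn {ℓ : ℕ} {c : ℕ → V} (h : ShortestOdd G W ℓ c) {i a q : ℕ} (ha : a ≤ ℓ)
    (hw : WalkIn G W q (c i) (c (i + a))) :
    (ℓ ≤ q + a ∧ (q + a) % 2 = 1) ∨ (a ≤ q ∧ (q + a) % 2 = 0) := by
  have hodd := h.odd
  by_cases hpar : (q + a) % 2 = 1
  · exact .inl ⟨h.le _ _ hpar (hw.trans (h.walkIn i a).symm), hpar⟩
  · have h1 : WalkIn G W (ℓ - a) (c (i + a)) (c i) := by
      have := h.walkIn (i + a) (ℓ - a)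
      rwa [Nat.add_assoc, Nat.add_sub_cancel' ha, h.per] at this
    have h2 := h.le _ _ (by omega) (hw.trans h1)
    exact .inr ⟨by omega, by omega⟩

theorem three_le {ℓ : ℕ} {c : ℕ → V} (h : ShortestOdd G W ℓ c) : 3 ≤ ℓ := by
  have h1 := h.odd
  by_contra hlt
  have h2 : ℓ = 1 := by omega
  have h3 := h.adj 0
  rw [← h2, h.per] at h3
  exact h3.ne rfl

/-- The induced cycle property: vertices of a period are distinct, and adjacent only if
consecutive. -/
theorem adj_iff {ℓ : ℕ} {c : ℕ → V} (h : ShortestOdd G W ℓ c) {i a : ℕ} (ha : a ≤ ℓ) :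
    G.Adj (c i) (c (i + a)) ↔ a = 1 ∨ a + 1 = ℓ := by
  have h3 := h.three_le
  have hodd := h.odd
  constructor
  · intro hadj
    have := h.le_of_walkIn ha (.cons (h.mem i) hadj (.refl (h.mem _)))
    rcases this with ⟨h1, h2⟩ | ⟨h1, h2⟩ <;> omega
  · rintro (rfl | h1)
    · exact h.adj i
    · have := h.adj (i + a)
      rw [Nat.add_assoc, h1, h.per] at this
      exact this.symm

theorem ne {ℓ : ℕ} {c : ℕ → V} (h : ShortestOdd G W ℓ c) {i a : ℕ} (ha : a < ℓ) (ha0 : 0 < a) :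
    c i ≠ c (i + a) := by
  intro heq
  have hw : WalkIn G W 0 (c i) (c (i + a)) := by rw [← heq]; exact .refl (h.mem i)
  rcases h.le_of_walkIn ha.le hw with ⟨h1, h2⟩ | ⟨h1, h2⟩ <;> omega

theorem shift {ℓ : ℕ} {c : ℕ → V} (h : ShortestOdd G W ℓ c) (j : ℕ) :
    ShortestOdd G W ℓ (fun i => c (j + i)) :=
  ⟨h.odd, fun i => by rw [← Nat.add_assoc, h.per], fun i => h.mem _, fun i => h.adj _, h.le⟩

theorem exists_lt {ℓ : ℕ} {c : ℕ → V} (h : ShortestOdd G W ℓ c) (i : ℕ) :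
    ∃ j < ℓ, c j = c i := by
  refine ⟨i % ℓ, Nat.mod_lt _ (by have := h.three_le; omega), ?_⟩
  have : ∀ a b, c (a + ℓ * b) = c a := by
    intro a b
    induction b with
    | zero => rfl
    | succ b ih => rw [Nat.mul_succ, ← Nat.add_assoc, h.per, ih]
  conv_rhs => rw [← Nat.mod_add_div i ℓ]
  exact (this _ _).symm

/-- A set with an odd closed walk is not bipartite. -/
theorem not_bip {ℓ : ℕ} {c : ℕ → V} (h : ShortestOdd G W ℓ c) {S : Finset V}
    (hS : ∀ i, c i ∈ S) : ¬ Bip G S := by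
  rintro ⟨col, hcol⟩
  have h1 : ∀ i, col (c i) = (if i % 2 = 0 then col (c 0) else !col (c 0)) := by
    intro i
    induction i with
    | zero => simp
    | succ i ih =>
      have h2 := hcol _ (hS i) _ (hS (i + 1)) (h.adj i)
      rw [ih] at h2
      rcases Nat.mod_two_eq_zero_or_one i with h3 | h3
      · have h4 : (i + 1) % 2 = 1 := by omega
        simp only [h3, h4, if_true] at h2 ⊢
        revert h2; cases col (c (i+1)) <;> cases col (c 0) <;> simp
      · have h4 : (i + 1) % 2 = 0 := by omega
        simp only [h3, h4, if_true] at h2 ⊢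
        revert h2; cases col (c (i+1)) <;> cases col (c 0) <;> simp
  have h2 := h1 ℓ
  have h3 : c ℓ = c 0 := by simpa using h.per 0
  rw [h3, h.odd] at h2
  simp at h2

end ShortestOdd

/-! ### Induced packings of odd cycles -/

/-- `W` contains `m` pairwise disjoint non-bipartite sets with no edges between them. Since a
non-bipartite set contains an induced odd cycle, this is the existence of an induced packing of
`m` odd cycles. -/
def OddPack (G : SimpleGraph V) (W : Finset V) (m : ℕ) : Prop :=
  ∃ S : Fin m → Finset V, (∀ i, S i ⊆ W ∧ ¬ Bip G (S i)) ∧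
    ∀ i j, i ≠ j → ∀ u ∈ S i, ∀ v ∈ S j, u ≠ v ∧ ¬ G.Adj u v

theorem OddPack.mono {m : ℕ} (h : OddPack G W m) (hW : W ⊆ W') : OddPack G W' m := by
  obtain ⟨S, h1, h2⟩ := h
  exact ⟨S, fun i => ⟨(h1 i).1.trans hW, (h1 i).2⟩, h2⟩

theorem oddPack_one_of_not_bip (h : ¬ Bip G W) : OddPack G W 1 :=
  ⟨fun _ => W, fun _ => ⟨le_rfl, h⟩, fun i j hij => absurd (Subsingleton.elim i j) hij⟩

theorem cycleGraph_adj_iff_add {ℓ : ℕ} (a b : Fin ℓ) (hab : (a : ℕ) ≤ b) (h3 : 3 ≤ ℓ) :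
    (SimpleGraph.cycleGraph ℓ).Adj a b ↔ (b : ℕ) - a = 1 ∨ (b : ℕ) - a + 1 = ℓ := by
  rw [SimpleGraph.cycleGraph_adj', Fin.val_sub, Fin.val_sub]
  have ha := a.2
  have hb := b.2
  have e1 : (ℓ - (a : ℕ) + b) % ℓ = b - a := by
    rw [show ℓ - (a : ℕ) + b = (b - a) + ℓ by omega, Nat.add_mod_right, Nat.mod_eq_of_lt (by omega)]
  rw [e1]
  rcases hab.eq_or_lt with h | h
  · have e2 : (ℓ - (b : ℕ) + a) % ℓ = 0 := by
      rw [show ℓ - (b : ℕ) + a = ℓ by omega, Nat.mod_self]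
    omega
  · rw [Nat.mod_eq_of_lt (a := ℓ - (b : ℕ) + a) (by omega)]
    omega

/-- The vertices of a shortest odd closed walk induce a cycle. -/
theorem ShortestOdd.adj_iff_cycleGraph {ℓ : ℕ} {c : ℕ → V} (h : ShortestOdd G W ℓ c)
    (a b : Fin ℓ) : G.Adj (c a) (c b) ↔ (SimpleGraph.cycleGraph ℓ).Adj a b := by
  have key : ∀ a b : Fin ℓ, (a : ℕ) ≤ b →
      (G.Adj (c a) (c b) ↔ (SimpleGraph.cycleGraph ℓ).Adj a b) := by
    intro a b hab
    rw [cycleGraph_adj_iff_add a b hab h.three_le, ← h.adj_iff (i := a) (by omega),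
      Nat.add_sub_cancel' hab]
  rcases Nat.le_total a b with hab | hab
  · exact key a b hab
  · rw [G.adj_comm, (SimpleGraph.cycleGraph ℓ).adj_comm]
    exact key b a hab

theorem ShortestOdd.injOn {ℓ : ℕ} {c : ℕ → V} (h : ShortestOdd G W ℓ c)
    {a b : Fin ℓ} (hab : c a = c b) : a = b := by
  have key : ∀ a b : Fin ℓ, (a : ℕ) < b → c a ≠ c b := by
    intro a b hab
    have := h.ne (i := a) (a := b - a) (by omega) (by omega)
    rwa [Nat.add_sub_cancel' hab.le] at this
  rcases lt_trichotomy (a : ℕ) b with hlt | heq | hlt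
  · exact absurd hab (key a b hlt)
  · exact Fin.ext heq
  · exact absurd hab.symm (key b a hlt)

/-- In each of the sets choose a shortest odd closed walk; its vertices induce a cycle. -/
theorem OddPack.hasInducedOddCyclePacking {m : ℕ} (h : OddPack G W m) :
    HasInducedOddCyclePacking G m := by
  obtain ⟨S, h1, h2⟩ := h
  choose ℓ c hc using fun i => exists_shortestOdd (h1 i).2
  refine ⟨ℓ, fun i => ⟨Nat.odd_iff.mpr (hc i).odd, (hc i).three_le⟩,
    ⟨⟨⟨fun x => c x.1 x.2, ?_⟩, ?_⟩⟩⟩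
  · rintro ⟨i, a⟩ ⟨j, b⟩ hab
    by_cases hij : i = j
    · subst hij
      obtain rfl := (hc i).injOn hab
      rfl
    · exact absurd hab (h2 i j hij _ ((hc i).mem _) _ ((hc j).mem _)).1
  · rintro ⟨i, a⟩ ⟨j, b⟩
    change G.Adj (c i a) (c j b) ↔ _
    by_cases hij : i = j
    · subst hij
      rw [(hc i).adj_iff_cycleGraph]
      constructor
      · exact fun hadj => ⟨i, a, b, rfl, rfl, hadj⟩
      · rintro ⟨i', a', b', ha, hb, hadj⟩
        cases ha
        cases hb
        exact hadj
    · refine iff_of_false (h2 i j hij _ ((hc i).mem _) _ ((hc j).mem _)).2 ?_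
      rintro ⟨i', a', b', ha, hb, hadj⟩
      cases ha
      cases hb
      exact hij rfl

/-- The step that lowers the packing number: if `W'` splits into a bipartite set `A` and a set
that avoids the closed neighbourhood of an odd cycle `C` of `W`, without edges between the two,
then a packing in `W'` extends by `C`. -/
theorem ShortestOdd.oddPack_succ [DecidableEq V] {ℓ m : ℕ} {c : ℕ → V}
    (h : ShortestOdd G W ℓ c) {A B : Finset V}
    (hA : Bip G A) (hB : B ⊆ W) (hAB : ∀ u ∈ A, ∀ v ∈ B, ¬ G.Adj u v)
    (hBc : ∀ v ∈ B, ∀ i, c i ≠ v ∧ ¬ G.Adj (c i) v) (hp : OddPack G (A ∪ B) m) :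
    OddPack G W (m + 1) := by
  obtain ⟨S, h1, h2⟩ := hp
  refine ⟨Fin.cons ((Finset.range ℓ).image c) fun i => S i ∩ B, ?_, ?_⟩
  · intro i
    refine Fin.cases ⟨?_, ?_⟩ (fun i => ⟨?_, ?_⟩) i
    · intro v hv
      simp only [Fin.cons_zero, Finset.mem_image] at hv
      obtain ⟨j, -, rfl⟩ := hv
      exact h.mem j
    · refine h.not_bip fun i => ?_
      obtain ⟨j, hj, hji⟩ := h.exists_lt i
      simp only [Fin.cons_zero, Finset.mem_image, Finset.mem_range]
      exact ⟨j, hj, hji⟩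
    · simp only [Fin.cons_succ]
      exact Finset.inter_subset_right.trans hB
    · simp only [Fin.cons_succ]
      intro hbip
      refine (h1 i).2
        (Bip.mono ((hA.mono (Finset.inter_subset_right (s₁ := S i))).union hbip ?_) ?_)
      · intro u hu v hv
        exact hAB u (Finset.mem_inter.mp hu).2 v (Finset.mem_inter.mp hv).2
      · intro v hv
        have := (h1 i).1 hv
        simp only [Finset.mem_union, Finset.mem_inter] at this ⊢
        tauto
  · have key : ∀ (j : Fin m), ∀ u ∈ (Finset.range ℓ).image c, ∀ v ∈ S j ∩ B,
        u ≠ v ∧ ¬ G.Adj u v := by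
      intro j u hu v hv
      obtain ⟨i, -, rfl⟩ := Finset.mem_image.mp hu
      exact hBc v (Finset.mem_inter.mp hv).2 i
    intro i j
    refine Fin.cases ?_ (fun i => ?_) i <;> refine Fin.cases ?_ (fun j => ?_) j
    · intro h; exact absurd rfl h
    · intro _ u hu v hv
      simp only [Fin.cons_zero, Fin.cons_succ] at hu hv
      exact key j u hu v hv
    · intro _ u hu v hv
      simp only [Fin.cons_zero, Fin.cons_succ] at hu hv
      obtain ⟨h3, h4⟩ := key i v hv u hu
      exact ⟨h3.symm, fun h => h4 h.symm⟩
    · intro hij u hu v hv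
      simp only [Fin.cons_succ] at hu hv
      exact h2 i j (fun h => hij (by rw [h])) u (Finset.mem_inter.mp hu).1 v
        (Finset.mem_inter.mp hv).1

end Graph

/-! ### Balls and deletion steps -/

section Steps

variable {V : Type*} [DecidableEq V] {G : SimpleGraph V} [DecidableRel G.Adj]
  {W W' X Z J : Finset V}

/-- The open ball of radius `i` around the set `X` in the subgraph induced by `W ∪ X`: the
vertices from which `X` can be reached by a walk of length less than `i`. -/
def ballIn (G : SimpleGraph V) [DecidableRel G.Adj] (W X : Finset V) : ℕ → Finset V
  | 0 => ∅
  | i + 1 => (W ∪ X).filter fun v => v ∈ X ∨ ∃ u ∈ ballIn G W X i, G.Adj v u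

theorem mem_ballIn_succ {i : ℕ} {v : V} : v ∈ ballIn G W X (i + 1) ↔
    v ∈ W ∪ X ∧ (v ∈ X ∨ ∃ u ∈ ballIn G W X i, G.Adj v u) := by
  rw [ballIn, Finset.mem_filter]

theorem mem_ballIn {x : V} (hx : x ∈ W) {i : ℕ} {v : V} :
    v ∈ ballIn G W {x} i ↔ ∃ q < i, WalkIn G W q v x := by
  have hW : W ∪ {x} = W := by simpa using hx
  induction i generalizing v with
  | zero => simp [ballIn]
  | succ i ih =>
    simp only [ballIn, hW, Finset.mem_filter, Finset.mem_singleton, ih]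
    constructor
    · rintro ⟨hv, rfl | ⟨u, ⟨q, hq, hw⟩, huv⟩⟩
      · exact ⟨0, by omega, .refl hv⟩
      · exact ⟨q + 1, by omega, .cons hv huv hw⟩
    · rintro ⟨q, hq, hw⟩
      refine ⟨hw.left_mem, ?_⟩
      cases q with
      | zero => exact .inl hw.eq_of_zero
      | succ q =>
        obtain ⟨u, huv, hu⟩ := hw.exists_adj
        exact .inr ⟨u, ⟨q, by omega, hu⟩, huv⟩

/-- Among `t` disjoint sets one contains at most the fraction `1 / t` of `J`. -/
theorem exists_light_of_disjoint {t : ℕ} (ht : 0 < t) (B : ℕ → Finset V) (J : Finset V)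
    (hB : ∀ i < t, ∀ j < t, i < j → Disjoint (B i) (B j)) :
    ∃ i < t, t * (J ∩ B i).card ≤ J.card := by
  by_contra! hcon
  have h1 : ∑ i ∈ Finset.range t, (J ∩ B i).card ≤ J.card := by
    rw [← Finset.card_biUnion]
    · refine Finset.card_le_card (Finset.biUnion_subset.mpr fun i _ => Finset.inter_subset_left)
    · intro i hi j hj hij
      have : Disjoint (B i) (B j) := by
        rcases lt_or_gt_of_ne hij with h | h
        · exact hB i (by simpa using hi) j (by simpa using hj) h
        · exact (hB j (by simpa using hj) i (by simpa using hi) h).symm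
      exact this.mono Finset.inter_subset_right Finset.inter_subset_right
  have h2 : ∑ _i ∈ Finset.range t, J.card < ∑ i ∈ Finset.range t, t * (J ∩ B i).card :=
    Finset.sum_lt_sum_of_nonempty ⟨0, by simpa using ht⟩ fun i hi => hcon i (by simpa using hi)
  rw [← Finset.mul_sum, Finset.sum_const, Finset.card_range, smul_eq_mul] at h2
  exact absurd (Nat.mul_le_mul_left t h1) (by omega)

/-- A ball whose radius is at most half the length of a shortest odd cycle is bipartite: colour it
by the parity of the length of a walk to the centre. -/
theorem ShortestOdd.bip_ballIn {ℓ m r : ℕ} {c : ℕ → V} (h : ShortestOdd G W ℓ c)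
    (hm : ℓ = 2 * m + 1) (hr : r ≤ m) {x : V} (hx : x ∈ W) : Bip G (ballIn G W {x} r) := by
  classical
  have hmem : ∀ v : V, v ∈ ballIn G W {x} r → ∃ q, q < r ∧ WalkIn G W q v x :=
    fun v hv => (mem_ballIn hx).mp hv
  choose! d hd using hmem
  refine ⟨fun v => decide (d v % 2 = 0), fun u hu v hv huv heq => ?_⟩
  have hu' := hd u hu
  have hv' := hd v hv
  rw [decide_eq_decide] at heq
  have := h.le _ _ (by omega) (hu'.2.symm.trans (.cons hu'.2.left_mem huv hv'.2))
  omega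

/-- The vertices of `W` that remain after the deletion of an annulus around `X`, a ball around
`Z`, and the vertices of degree at least `h`, all of them taken in `W`. -/
def delStep (G : SimpleGraph V) [DecidableRel G.Adj] (W X : Finset V) (i j : ℕ) (Z : Finset V)
    (l h : ℕ) : Finset V :=
  ((W \ (ballIn G W X j \ ballIn G W X i)) \ ballIn G W Z l) \
    W.filter fun v => h ≤ (W.filter (G.Adj v)).card

variable [Fintype V]

/-- `W'` arises from `W` by one deletion with parameters in the range that the algorithm
searches. -/
def Step (G : SimpleGraph V) [DecidableRel G.Adj] (W W' : Finset V) : Prop :=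
  ∃ (X Z : Finset V) (i j l h : ℕ), X.card ≤ 1 ∧ Z.card ≤ 1 ∧ i ≤ Fintype.card V + 1 ∧
    j ≤ Fintype.card V + 1 ∧ l ≤ Fintype.card V + 1 ∧ h ≤ Fintype.card V + 1 ∧
    W' = delStep G W X i j Z l h

/-- `W'` arises from `W` by `a` deletions. -/
def Reach (G : SimpleGraph V) [DecidableRel G.Adj] : ℕ → Finset V → Finset V → Prop
  | 0, W, W' => W' = W
  | a + 1, W, W' => ∃ W₁, Step G W W₁ ∧ Reach G a W₁ W'

theorem Step.reach (h : Step G W W') : Reach G 1 W W' := ⟨W', h, rfl⟩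

theorem Reach.trans {a b : ℕ} {W₁ W₂ W₃ : Finset V} (h : Reach G a W₁ W₂)
    (h' : Reach G b W₂ W₃) : Reach G (a + b) W₁ W₃ := by
  induction a generalizing W₁ with
  | zero => cases h; simpa using h'
  | succ a ih =>
    obtain ⟨W', h1, h2⟩ := h
    rw [Nat.add_right_comm]
    exact ⟨W', h1, ih h2⟩

theorem filter_degree_large {V : Type*} [Fintype V] {G : SimpleGraph V} [DecidableRel G.Adj]
    (W : Finset V) :
    (W.filter fun v => Fintype.card V + 1 ≤ (W.filter (G.Adj v)).card) = ∅ := by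
  refine Finset.filter_eq_empty_iff.mpr fun v _ h => ?_
  have := Finset.card_le_univ (W.filter (G.Adj v))
  omega

theorem Step.refl (W : Finset V) : Step G W W :=
  ⟨∅, ∅, 0, 0, 0, _, by simp, by simp, by simp, by simp, by simp, le_rfl, by
    rw [delStep, filter_degree_large]; simp [ballIn]⟩

theorem Reach.of_le {a b : ℕ} (h : Reach G a W W') (hab : a ≤ b) : Reach G b W W' := by
  induction b, hab using Nat.le_induction with
  | base => exact h
  | succ b _ ih => exact ih.trans (Step.refl _).reach

theorem Step.delete_neighbors [Nonempty V] (W : Finset V) (x : V) :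
    Step G W (W.filter fun v => ¬ G.Adj x v) := by
  have hpos : 0 < Fintype.card V := Fintype.card_pos
  refine ⟨{x}, ∅, 1, 2, 0, _, by simp, by simp, by omega, by omega, by omega, le_rfl, ?_⟩
  rw [delStep, filter_degree_large]
  ext v
  have hx : ¬ G.Adj x x := G.irrefl
  simp only [ballIn, Finset.mem_filter, Finset.mem_sdiff, Finset.mem_union, Finset.mem_singleton,
    Finset.notMem_empty, false_and, exists_false, or_false, not_false_eq_true, and_true]
  constructor
  · rintro ⟨hv, hvx⟩
    refine ⟨hv, ?_⟩
    rintro ⟨⟨-, rfl | ⟨u, ⟨-, rfl⟩, huv⟩⟩, h⟩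
    · exact h ⟨.inr rfl, rfl⟩
    · exact hvx huv.symm
  · rintro ⟨hv, hvx⟩
    refine ⟨hv, fun hadj => hvx ⟨⟨.inl hv, .inr ⟨x, ⟨.inr rfl, rfl⟩, hadj.symm⟩⟩, ?_⟩⟩
    rintro ⟨-, rfl⟩
    exact hx hadj

theorem reach_delete_neighbors [Nonempty V] (W X : Finset V) :
    Reach G X.card W (W.filter fun v => ∀ x ∈ X, ¬ G.Adj x v) := by
  induction X using Finset.induction_on generalizing W with
  | empty => simp [Reach]
  | insert a s ha ih =>
    rw [Finset.card_insert_of_notMem ha]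
    refine ⟨_, Step.delete_neighbors W a, ?_⟩
    have := ih (W.filter fun v => ¬ G.Adj a v)
    rw [Finset.filter_filter] at this
    simpa only [Finset.mem_insert, forall_eq_or_imp] using this

theorem Step.delete_high_degree (W : Finset V) {h : ℕ} (hh : h ≤ Fintype.card V + 1) :
    Step G W (W.filter fun v => (W.filter (G.Adj v)).card < h) := by
  refine ⟨∅, ∅, 0, 0, 0, h, by simp, by simp, by omega, by omega, by omega, hh, ?_⟩
  ext v
  simp only [delStep, ballIn, Finset.mem_filter, Finset.mem_sdiff, Finset.notMem_empty,
    not_false_eq_true, and_true, not_and, not_le]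
  tauto

/-! ### Deleting an odd cycle -/

/-- The deletion of the neighbourhood of a shortest odd cycle lowers the packing number. -/
theorem ShortestOdd.delete_cycle [Nonempty V] {ℓ D : ℕ} {c : ℕ → V} (h : ShortestOdd G W ℓ c)
    (hD : ∀ v ∈ W, ((J ∩ W).filter (G.Adj v)).card ≤ D) :
    ∃ W' ⊆ W, Reach G ℓ W W' ∧ (∀ m, OddPack G W' m → OddPack G W (m + 1)) ∧
      (J ∩ W).card ≤ (J ∩ W').card + ℓ * D := by
  set C := (Finset.range ℓ).image c with hC
  have hcC : ∀ i, c i ∈ C := fun i => by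
    obtain ⟨j, hj, hji⟩ := h.exists_lt i
    exact Finset.mem_image.mpr ⟨j, Finset.mem_range.mpr hj, hji⟩
  have hcard : C.card ≤ ℓ := Finset.card_image_le.trans (by simp)
  have hCW : ∀ x ∈ C, x ∈ W := by
    intro x hx
    obtain ⟨j, -, rfl⟩ := Finset.mem_image.mp hx
    exact h.mem j
  refine ⟨W.filter fun v => ∀ x ∈ C, ¬ G.Adj x v, Finset.filter_subset _ _,
    (reach_delete_neighbors W C).of_le hcard, fun m hm => ?_, ?_⟩
  · refine h.oddPack_succ (A := ∅) (B := W.filter fun v => ∀ x ∈ C, ¬ G.Adj x v)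
      ⟨fun _ => true, by simp⟩ (Finset.filter_subset _ _) (by simp) ?_ (by simpa using hm)
    intro v hv i
    rw [Finset.mem_filter] at hv
    refine ⟨?_, hv.2 _ (hcC i)⟩
    rintro rfl
    exact hv.2 _ (hcC (i + 1)) (h.adj i).symm
  · have hsub : J ∩ W ⊆ (J ∩ W.filter fun v => ∀ x ∈ C, ¬ G.Adj x v) ∪
        C.biUnion fun x => (J ∩ W).filter (G.Adj x) := by
      intro v hv
      simp only [Finset.mem_union, Finset.mem_inter, Finset.mem_filter, Finset.mem_biUnion] at hv ⊢
      by_cases hx : ∃ x ∈ C, G.Adj x v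
      · obtain ⟨x, hx, hxv⟩ := hx
        exact .inr ⟨x, hx, hv, hxv⟩
      · push Not at hx
        exact .inl ⟨hv.1, hv.2, hx⟩
    refine (Finset.card_le_card hsub).trans ((Finset.card_union_le _ _).trans ?_)
    gcongr
    refine Finset.card_biUnion_le.trans ?_
    calc ∑ x ∈ C, ((J ∩ W).filter (G.Adj x)).card ≤ ∑ _x ∈ C, D :=
          Finset.sum_le_sum fun x hx => hD x (hCW x hx)
      _ = C.card * D := by simp
      _ ≤ ℓ * D := by gcongr

/-- For a long shortest odd cycle `C` it is not necessary to delete the neighbourhood of `C`. Let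
`x` and `z` be antipodal on `C`. The deletion of a small ball around `z` and of a sphere around
`x` whose radius is slightly less than half the length of `C` leaves the inside of the sphere,
which is bipartite, and a set that avoids the neighbourhood of `C`. There are many spheres and
many disjoint balls to choose from, so that little of `J` is lost. -/
theorem ShortestOdd.delete_sphere_ball {ℓ t : ℕ} {c : ℕ → V} (h : ShortestOdd G W ℓ c)
    (ht : 0 < t) (hℓ : t * (2 * t + 3) ≤ ℓ) (J : Finset V) :
    ∃ W' ⊆ W, Step G W W' ∧ (∀ m, OddPack G W' m → OddPack G W (m + 1)) ∧
      t * (J ∩ W).card ≤ t * (J ∩ W').card + 2 * J.card := by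
  obtain ⟨m, hm⟩ : ∃ m, ℓ = 2 * m + 1 := ⟨ℓ / 2, by have := h.odd; omega⟩
  have htm : t + 1 ≤ m := by
    have : t * 5 ≤ t * (2 * t + 3) := Nat.mul_le_mul_left t (by omega)
    omega
  have hcard : ℓ ≤ Fintype.card V := by
    have hinj : Function.Injective fun i : Fin ℓ => c i := fun a b hab => h.injOn hab
    simpa using Fintype.card_le_of_injective _ hinj
  -- The balls of radius `t + 2` around vertices of `C` at distance at least `2 t + 3` are disjoint.
  obtain ⟨i, hi, hball⟩ := exists_light_of_disjoint ht
    (fun i => ballIn G W {c (i * (2 * t + 3))} (t + 2)) J (by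
      intro i hi j hj hij
      rw [Finset.disjoint_left]
      intro v hvi hvj
      obtain ⟨q, hq, hw⟩ := (mem_ballIn (h.mem _)).mp hvi
      obtain ⟨q', hq', hw'⟩ := (mem_ballIn (h.mem _)).mp hvj
      obtain ⟨a, rfl⟩ : ∃ a, j = i + (a + 1) := ⟨j - i - 1, by omega⟩
      have e : (i + (a + 1)) * (2 * t + 3) = i * (2 * t + 3) + (a + 1) * (2 * t + 3) := by ring
      have h2 : (a + 1) * (2 * t + 3) + (2 * t + 3) ≤ ℓ := by nlinarith
      have h4 : 2 * t + 3 ≤ (a + 1) * (2 * t + 3) := by nlinarith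
      rw [e] at hw'
      rcases h.le_of_walkIn (by omega) (hw.symm.trans hw') with h3 | h3 <;> omega)
  set z := c (i * (2 * t + 3)) with hz
  set c' : ℕ → V := fun a => c (i * (2 * t + 3) + a) with hc'
  have h' : ShortestOdd G W ℓ c' := h.shift _
  have hz' : z = c' 0 := rfl
  clear_value z c'
  subst hz'
  set x := c' m with hx
  have hxW : x ∈ W := h'.mem m
  obtain ⟨s, hs, hsphere⟩ := exists_light_of_disjoint ht
    (fun s => ballIn G W {x} (m - s + 1) \ ballIn G W {x} (m - s)) J (by
      intro a ha b hb hab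
      rw [Finset.disjoint_left]
      intro v hva hvb
      simp only [Finset.mem_sdiff, mem_ballIn hxW] at hva hvb
      obtain ⟨⟨q, hq, hw⟩, -⟩ := hvb
      exact hva.2 ⟨q, by omega, hw⟩)
  set r := m - s with hr
  set W' := delStep G W {x} r (r + 1) {c' 0} (t + 2) (Fintype.card V + 1) with hW'
  have hmem : ∀ v, v ∈ W' ↔ (v ∈ W ∧ (v ∈ ballIn G W {x} (r + 1) → v ∈ ballIn G W {x} r)) ∧
      v ∉ ballIn G W {c' 0} (t + 2) := by
    intro v
    rw [hW', delStep, filter_degree_large]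
    simp only [Finset.mem_sdiff, Finset.notMem_empty, not_and, not_not, not_false_eq_true, and_true]
  have hWW : W' ⊆ W := fun v hv => ((hmem v).mp hv).1.1
  refine ⟨W', hWW, ⟨{x}, {c' 0}, r, r + 1, t + 2, _, by simp, by simp, by omega, by omega,
    by omega, le_rfl, rfl⟩, fun k hk => ?_, ?_⟩
  · refine h'.oddPack_succ (A := W' ∩ ballIn G W {x} r) (B := W' \ ballIn G W {x} r)
      ((h'.bip_ballIn hm (by omega) hxW).mono Finset.inter_subset_right)
      (Finset.sdiff_subset.trans hWW) ?_ ?_ (by rwa [Finset.union_comm, Finset.sdiff_union_inter])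
    · intro u hu v hv huv
      rw [Finset.mem_inter] at hu
      rw [Finset.mem_sdiff] at hv
      obtain ⟨q, hq, hw⟩ := (mem_ballIn hxW).mp hu.2
      have hvW := hWW hv.1
      exact hv.2 (((hmem v).mp hv.1).1.2 ((mem_ballIn hxW).mpr
        ⟨q + 1, by omega, .cons hvW huv.symm hw⟩))
    · -- A vertex `v` outside the sphere within distance `1` of `c' j`: then `c' j` is far from
      -- `x` along `C`, hence close to `z = c' 0`.
      have key : ∀ v ∈ W' \ ballIn G W {x} r, ∀ j < ℓ, ∀ q ≤ 1, ¬ WalkIn G W q v (c' j) := by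
        intro v hv j hj q hq hw
        rw [Finset.mem_sdiff] at hv
        have hv1 := (hmem v).mp hv.1
        have hfar : ∀ q', WalkIn G W q' v x → r < q' := by
          intro q' hw'
          by_contra hle
          exact hv.2 (hv1.1.2 ((mem_ballIn hxW).mpr ⟨q', by omega, hw'⟩))
        have hnear : ∀ q', WalkIn G W q' v (c' 0) → t + 1 < q' := by
          intro q' hw'
          by_contra hle
          exact hv1.2 ((mem_ballIn (h'.mem 0)).mpr ⟨q', by omega, hw'⟩)
        rcases Nat.le_total j m with hjm | hjm
        · have w1 := h'.walkIn j (m - j)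
          rw [Nat.add_sub_cancel' hjm] at w1
          have w2 := h'.walkIn 0 j
          rw [Nat.zero_add] at w2
          have := hfar _ (hw.trans w1)
          have := hnear _ (hw.trans w2.symm)
          omega
        · have w1 := h'.walkIn m (j - m)
          rw [Nat.add_sub_cancel' hjm] at w1
          have w2 := h'.walkIn j (ℓ - j)
          rw [Nat.add_sub_cancel' hj.le, show c' ℓ = c' 0 by simpa using h'.per 0] at w2
          have := hfar _ (hw.trans w1.symm)
          have := hnear _ (hw.trans w2)
          omega
      intro v hv j
      obtain ⟨j', hj', hjj⟩ := h'.exists_lt j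
      have hvW : v ∈ W := hWW (Finset.mem_sdiff.mp hv).1
      rw [← hjj]
      refine ⟨?_, fun hadj => ?_⟩
      · rintro rfl
        exact key _ hv j' hj' 0 (by omega) (.refl hvW)
      · exact key _ hv j' hj' 1 le_rfl (.cons hvW hadj.symm (.refl (h'.mem _)))
  · have hsub : J ∩ W ⊆ ((J ∩ W') ∪ (J ∩ ballIn G W {c' 0} (t + 2))) ∪
        (J ∩ (ballIn G W {x} (r + 1) \ ballIn G W {x} r)) := by
      intro v hv
      simp only [Finset.mem_union, Finset.mem_inter, Finset.mem_sdiff, hmem] at hv ⊢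
      tauto
    have h1 := (Finset.card_le_card hsub).trans ((Finset.card_union_le _ _).trans
      (Nat.add_le_add_right (Finset.card_union_le _ _) _))
    have h2 := Nat.mul_le_mul_left t h1
    rw [Nat.mul_add, Nat.mul_add] at h2
    omega

/-- Repeated deletion of odd cycles, until the property `Q` holds. Each round lowers the packing
number and loses at most `w / p` elements of `J`; the rounds that were not needed are credited
with `k' * w`. -/
theorem exists_reach_of_step {Q : Finset V → Prop} (hQ : ∀ W, Bip G W → Q W) {a p w : ℕ}
    {W₀ : Finset V}
    (hstep : ∀ W ⊆ W₀, ¬ Q W → ∃ W' ⊆ W, Reach G a W W' ∧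
      (∀ m, OddPack G W' m → OddPack G W (m + 1)) ∧
      p * (J ∩ W).card ≤ p * (J ∩ W').card + w)
    (k : ℕ) (W : Finset V) (hW : W ⊆ W₀) (hk : ¬ OddPack G W (k + 1)) :
    ∃ k' ≤ k, ∃ W' ⊆ W, Reach G (a * k) W W' ∧ Q W' ∧ ¬ OddPack G W' (k' + 1) ∧
      p * (J ∩ W).card + k' * w ≤ p * (J ∩ W').card + k * w := by
  induction k generalizing W with
  | zero =>
    refine ⟨0, le_rfl, W, le_rfl, by simp [Reach], ?_, hk, le_rfl⟩
    by_contra hq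
    exact hk (oddPack_one_of_not_bip fun hb => hq (hQ _ hb))
  | succ k ih =>
    by_cases hq : Q W
    · exact ⟨k + 1, le_rfl, W, le_rfl, Reach.of_le (a := 0) (by simp [Reach]) (by omega), hq, hk,
        le_rfl⟩
    · obtain ⟨W₁, h1, h2, h3, h4⟩ := hstep W hW hq
      obtain ⟨k', hk', W', h5, h6, h7, h8, h9⟩ := ih W₁ (h1.trans hW) (fun h => hk (h3 _ h))
      refine ⟨k', by omega, W', h5.trans h1, ?_, h7, h8, ?_⟩
      · rw [Nat.mul_succ, Nat.add_comm]
        exact h2.trans h6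
      · rw [Nat.succ_mul]
        omega

end Steps

/-! ### Small samples that hit all large neighbourhoods -/

section Sample

variable {V : Type*} [DecidableEq V] {G : SimpleGraph V} [DecidableRel G.Adj]

/-- If every vertex of `Z` is adjacent to more than the fraction `1 / M` of `J`, then at most `M`
vertices of `J` suffice to hit the neighbourhoods of half of the vertices of `Z`. -/
theorem exists_hitting_half {M : ℕ} {J Z : Finset V}
    (hZ : ∀ v ∈ Z, J.card < M * (J.filter (G.Adj v)).card) :
    ∃ X ⊆ J, X.card ≤ M ∧ 2 * (Z.filter fun v => ∀ x ∈ X, ¬ G.Adj x v).card ≤ Z.card := by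
  -- While more than half of `Z` is missed, some vertex of `J` hits at least the fraction `1 / M`
  -- of what is missed, hence at least `|Z| / (2 M)` vertices.
  have key : ∀ s, ∃ X ⊆ J, X.card ≤ s ∧
      (2 * (Z.filter fun v => ∀ x ∈ X, ¬ G.Adj x v).card ≤ Z.card ∨
        2 * M * (Z.filter fun v => ∀ x ∈ X, ¬ G.Adj x v).card + s * Z.card ≤ 2 * M * Z.card) := by
    intro s
    induction s with
    | zero => exact ⟨∅, by simp, by simp, .inr (by simp)⟩
    | succ s ih =>
      obtain ⟨X, hXJ, hXs, hX⟩ := ih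
      by_cases hhalf : 2 * (Z.filter fun v => ∀ x ∈ X, ¬ G.Adj x v).card ≤ Z.card
      · exact ⟨X, hXJ, by omega, .inl hhalf⟩
      have hX := hX.resolve_left hhalf
      set Y := Z.filter fun v => ∀ x ∈ X, ¬ G.Adj x v with hY
      obtain ⟨x, hxJ, hx⟩ : ∃ x ∈ J, Y.card ≤ M * (Y.filter (G.Adj x)).card := by
        by_contra! hcon
        have hYne : Y.Nonempty := by
          rw [Finset.nonempty_iff_ne_empty]
          intro h
          simp [h] at hhalf
        obtain ⟨v, hv⟩ := hYne
        have hJne : J.Nonempty := by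
          rw [Finset.nonempty_iff_ne_empty]
          intro h
          have := hZ v (Finset.mem_filter.mp hv).1
          simp [h] at this
        have h1 : ∑ x ∈ J, M * (Y.filter (G.Adj x)).card < ∑ _x ∈ J, Y.card :=
          Finset.sum_lt_sum_of_nonempty hJne hcon
        have h2 : ∑ v ∈ Y, J.card ≤ ∑ v ∈ Y, M * (J.filter (G.Adj v)).card :=
          Finset.sum_le_sum fun v hv => (hZ v (Finset.mem_filter.mp hv).1).le
        have h3 : ∑ x ∈ J, (Y.filter (G.Adj x)).card = ∑ v ∈ Y, (J.filter (G.Adj v)).card := by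
          have := Finset.sum_card_bipartiteAbove_eq_sum_card_bipartiteBelow (s := J) (t := Y)
            (fun x v => G.Adj x v)
          simpa only [Finset.bipartiteAbove, Finset.bipartiteBelow, G.adj_comm] using this
        rw [← Finset.mul_sum] at h1 h2
        rw [h3] at h1
        simp only [Finset.sum_const, smul_eq_mul] at h1 h2
        rw [Nat.mul_comm] at h2
        omega
      refine ⟨insert x X, Finset.insert_subset hxJ hXJ,
        (Finset.card_insert_le _ _).trans (by omega), .inr ?_⟩
      have hsplit : (Z.filter fun v => ∀ y ∈ insert x X, ¬ G.Adj y v) =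
          Y.filter fun v => ¬ G.Adj x v := by
        rw [hY, Finset.filter_filter]
        refine Finset.filter_congr fun v _ => ?_
        simp only [Finset.mem_insert, forall_eq_or_imp]
        tauto
      rw [hsplit]
      have hc := Finset.card_filter_add_card_filter_not (s := Y) (G.Adj x)
      have e : 2 * M * Y.card = 2 * (M * (Y.filter (G.Adj x)).card) +
          2 * M * (Y.filter fun v => ¬ G.Adj x v).card := by
        rw [← hc]; ring
      have e' : (s + 1) * Z.card = s * Z.card + Z.card := Nat.succ_mul _ _
      omega
  obtain ⟨X, h1, h2, h3⟩ := key M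
  refine ⟨X, h1, h2, ?_⟩
  rcases h3 with h3 | h3
  · exact h3
  · rcases Nat.eq_zero_or_pos M with rfl | hM
    · have : Z = ∅ := Finset.eq_empty_of_forall_notMem fun v hv => by simpa using hZ v hv
      simp [this]
    · have : M * (2 * (Z.filter fun v => ∀ x ∈ X, ¬ G.Adj x v).card) ≤ M * Z.card := by
        have e : M * (2 * (Z.filter fun v => ∀ x ∈ X, ¬ G.Adj x v).card) =
          2 * M * (Z.filter fun v => ∀ x ∈ X, ¬ G.Adj x v).card := by ring
        have e' : 2 * M * Z.card = M * Z.card + M * Z.card := by ring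
        omega
      exact Nat.le_of_mul_le_mul_left this hM

/-- A sample of `M * t` vertices of `J` hits the neighbourhoods of all vertices that are adjacent
to more than the fraction `1 / M` of `J`, with the exception of the fraction `1 / 2 ^ t`. -/
theorem exists_hitting (M t : ℕ) (J W : Finset V) :
    ∃ X ⊆ J, ∃ Z : Finset V, X.card ≤ M * t ∧ 2 ^ t * Z.card ≤ W.card ∧
      ∀ v ∈ W, J.card < M * (J.filter (G.Adj v)).card → (∀ x ∈ X, ¬ G.Adj x v) → v ∈ Z := by
  suffices h : ∃ X ⊆ J, ∃ Z : Finset V, X.card ≤ M * t ∧ 2 ^ t * Z.card ≤ W.card ∧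
      (∀ v ∈ Z, J.card < M * (J.filter (G.Adj v)).card) ∧
      ∀ v ∈ W, J.card < M * (J.filter (G.Adj v)).card → (∀ x ∈ X, ¬ G.Adj x v) → v ∈ Z by
    obtain ⟨X, h1, Z, h2, h3, -, h4⟩ := h
    exact ⟨X, h1, Z, h2, h3, h4⟩
  induction t with
  | zero =>
    exact ⟨∅, by simp, W.filter fun v => J.card < M * (J.filter (G.Adj v)).card, by simp,
      by simpa using Finset.card_filter_le _ _, fun v hv => (Finset.mem_filter.mp hv).2,
      fun v hv h _ => Finset.mem_filter.mpr ⟨hv, h⟩⟩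
  | succ t ih =>
    obtain ⟨X, h1, Z, h2, h3, h4, h5⟩ := ih
    obtain ⟨X', h1', h2', h3'⟩ := exists_hitting_half h4
    refine ⟨X ∪ X', Finset.union_subset h1 h1', Z.filter fun v => ∀ x ∈ X', ¬ G.Adj x v,
      (Finset.card_union_le _ _).trans (by rw [Nat.mul_succ]; omega), ?_,
      fun v hv => h4 v (Finset.mem_filter.mp hv).1, fun v hv hheavy hX => ?_⟩
    · rw [pow_succ, Nat.mul_assoc]
      exact (Nat.mul_le_mul_left _ h3').trans h3
    · refine Finset.mem_filter.mpr ⟨h5 v hv hheavy fun x hx => ?_, fun x hx => ?_⟩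
      · exact hX x (Finset.mem_union_left _ hx)
      · exact hX x (Finset.mem_union_right _ hx)

end Sample

/-! ### Triangle-free graphs with a small packing number have large independent sets -/

section Chromatic

variable {V : Type*} {G : SimpleGraph V}

theorem Bip.not_walkIn {W : Finset V} (h : Bip G W) {q : ℕ} {u : V} (hq : q % 2 = 1) :
    ¬ WalkIn G W q u u := by
  intro hw
  obtain ⟨ℓ, c, hc⟩ := exists_shortestOdd_of_walkIn ⟨q, hq, u, hw⟩
  exact hc.not_bip hc.mem h

/-- The neighbourhood of a shortest odd cycle of length at least `5` is the union of six
independent sets: sort its vertices by the parity of the position `j` of a neighbour on the cycle,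
and by the third of the cycle that contains `j`. -/
theorem ShortestOdd.card_neighbors_le [DecidableEq V] {W : Finset V} {ℓ β : ℕ} {c : ℕ → V}
    (h : ShortestOdd G W ℓ c) (h5 : 5 ≤ ℓ)
    (hβ : ∀ S ⊆ W, G.IsIndepSet (S : Set V) → S.card ≤ β) (N : Finset V) (hNW : N ⊆ W)
    (hN : ∀ v ∈ N, ∃ i, G.Adj (c i) v) : N.card ≤ 6 * β := by
  classical
  have hN' : ∀ v : V, v ∈ N → ∃ j, j < ℓ ∧ G.Adj (c j) v := by
    intro v hv
    obtain ⟨i, hi⟩ := hN v hv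
    obtain ⟨j, hj, hji⟩ := h.exists_lt i
    exact ⟨j, hj, by rwa [hji]⟩
  choose! ind hind using hN'
  set T : Finset (ℕ × ℕ) := Finset.range 2 ×ˢ Finset.range 3
  have hmaps : ∀ v ∈ N, (ind v % 2, 3 * ind v / ℓ) ∈ T := by
    intro v hv
    have := (hind v hv).1
    simp only [T, Finset.mem_product, Finset.mem_range]
    exact ⟨Nat.mod_lt _ (by omega), Nat.div_lt_of_lt_mul (by omega)⟩
  have hfib : ∀ a ∈ T, (N.filter fun v => (ind v % 2, 3 * ind v / ℓ) = a).card ≤ β := by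
    intro a _
    refine hβ _ ((Finset.filter_subset _ _).trans hNW) ?_
    have key : ∀ u ∈ N, ∀ v ∈ N, ind u % 2 = ind v % 2 → 3 * ind u / ℓ = 3 * ind v / ℓ →
        ind u ≤ ind v → ¬ G.Adj u v := by
      intro u hu v hv hpar hthird hle hadj
      have hu' := hind u hu
      have hv' := hind v hv
      have hlt : 3 * ind v < 3 * ind u + ℓ := by
        have e1 := Nat.div_add_mod (3 * ind v) ℓ
        have e2 := Nat.div_add_mod (3 * ind u) ℓ
        have e3 := Nat.mod_lt (3 * ind v) (show 0 < ℓ by omega)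
        rw [hthird] at e2
        omega
      have hw : WalkIn G W 3 (c (ind u)) (c (ind u + (ind v - ind u))) := by
        rw [Nat.add_sub_cancel' hle]
        exact .cons (h.mem _) hu'.2 (.cons (hNW hu) hadj (.cons (hNW hv) hv'.2.symm
          (.refl (h.mem _))))
      rcases h.le_of_walkIn (by omega) hw with h1 | h1 <;> omega
    intro u hu v hv _ hadj
    simp only [Finset.coe_filter, Set.mem_ofPred_eq] at hu hv
    have e := hu.2.trans hv.2.symm
    simp only [Prod.mk.injEq] at e
    rcases Nat.le_total (ind u) (ind v) with hle | hle
    · exact key u hu.1 v hv.1 e.1 e.2 hle hadj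
    · exact key v hv.1 u hu.1 e.1.symm e.2.symm hle hadj.symm
  have := Finset.card_le_mul_card_image_of_maps_to hmaps β hfib
  simpa [T, Nat.mul_comm] using this

/-- A set without triangles and without an induced packing of `k + 1` odd cycles contains an
independent set that is at least the fraction `1 / (6 k + 2)` of it. -/
theorem card_le_of_not_oddPack [DecidableEq V] {β : ℕ} (k : ℕ) (W : Finset V)
    (hβ : ∀ S ⊆ W, G.IsIndepSet (S : Set V) → S.card ≤ β)
    (htri : ∀ q u, q % 2 = 1 → WalkIn G W q u u → 5 ≤ q) (hk : ¬ OddPack G W (k + 1)) :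
    W.card ≤ (6 * k + 2) * β := by
  classical
  induction k generalizing W with
  | zero =>
    have hb : Bip G W := by
      by_contra h
      exact hk (oddPack_one_of_not_bip h)
    obtain ⟨col, hcol⟩ := hb
    have key : ∀ b : Bool, (W.filter fun v => col v = b).card ≤ β := by
      intro b
      refine hβ _ (Finset.filter_subset _ _) ?_
      intro u hu v hv _ hadj
      simp only [Finset.coe_filter, Set.mem_ofPred_eq] at hu hv
      exact hcol u hu.1 v hv.1 hadj (hu.2.trans hv.2.symm)
    have h1 := Finset.card_filter_add_card_filter_not (s := W) (fun v => col v = true)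
    have h2 := key true
    have h3 := key false
    simp only [Bool.not_eq_true] at h1
    omega
  | succ k ih =>
    by_cases hb : Bip G W
    · refine (ih W hβ htri fun h => ?_).trans (Nat.mul_le_mul_right _ (by omega))
      obtain ⟨S, hS, -⟩ := h
      exact (hS 0).2 (hb.mono (hS 0).1)
    obtain ⟨ℓ, c, hc⟩ := exists_shortestOdd hb
    have h5 : 5 ≤ ℓ := htri ℓ (c 0) hc.odd (by
      have := hc.walkIn 0 ℓ
      rwa [hc.per 0] at this)
    set N := W.filter fun v => ∃ i, G.Adj (c i) v with hN
    have hsub : W \ N ⊆ W := Finset.sdiff_subset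
    have h1 := ih (W \ N) (fun S hS => hβ S (hS.trans hsub))
      (fun q u hq hw => htri q u hq (hw.mono hsub)) (fun hp => hk (by
        refine hc.oddPack_succ (A := ∅) (B := W \ N) ⟨fun _ => true, by simp⟩ hsub (by simp) ?_
          (by simpa using hp)
        intro v hv i
        simp only [hN, Finset.mem_sdiff, Finset.mem_filter, not_and, not_exists] at hv
        refine ⟨?_, hv.2 hv.1 i⟩
        rintro rfl
        exact hv.2 hv.1 (i + 1) (hc.adj i).symm))
    have h2 := hc.card_neighbors_le h5 hβ N (Finset.filter_subset _ _)
      (fun v hv => (Finset.mem_filter.mp hv).2)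
    have h3 : (W \ N).card + N.card = W.card :=
      Finset.card_sdiff_add_card_eq_card (show N ⊆ W from Finset.filter_subset _ W)
    have e : (6 * (k + 1) + 2) * β = (6 * k + 2) * β + 6 * β := by ring
    omega

end Chromatic

/-! ### A bipartite set that keeps most of an independent set -/

section Main

variable {V : Type*} [DecidableEq V] [Fintype V] [Nonempty V] {G : SimpleGraph V}
  [DecidableRel G.Adj]

/-- The deletion of the triangles. A sample of the independent set `I` takes care of the vertices
with many neighbours in `I`, so that the deletion of the neighbourhood of a triangle costs at most
`|I| / p`. -/
theorem exists_reach_triangleFree {k p lg : ℕ} (hp : 1 ≤ p) (hlg : Fintype.card V ≤ 2 ^ lg)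
    (hG : ¬ OddPack G Finset.univ (k + 1)) {I : Finset V} (hI : G.IsIndepSet (I : Set V)) :
    ∃ k' ≤ k, ∃ W, Reach G (3 * p * (lg + 1) + 3 * k) Finset.univ W ∧
      (∀ q u, q % 2 = 1 → WalkIn G W q u u → 5 ≤ q) ∧ ¬ OddPack G W (k' + 1) ∧
      p * I.card + k' * I.card ≤ p * (I ∩ W).card + k * I.card := by
  -- With `lg + 1` rounds the exceptional set of the sample has less than one element. The deletion
  -- of the neighbours of the sample does not affect `I`.
  obtain ⟨X, hXI, Z, hXc, hZ, hX⟩ := exists_hitting (G := G) (3 * p) (lg + 1) I Finset.univ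
  set W₁ := Finset.univ.filter fun v => ∀ x ∈ X, ¬ G.Adj x v with hW₁
  have hlight : ∀ v ∈ W₁, 3 * p * (I.filter (G.Adj v)).card ≤ I.card := by
    intro v hv
    by_contra! hheavy
    have h1 : 0 < Z.card :=
      Finset.card_pos.mpr ⟨v, hX v (Finset.mem_univ _) hheavy (Finset.mem_filter.mp hv).2⟩
    have h2 := Nat.le_mul_of_pos_right (2 ^ (lg + 1)) h1
    rw [Finset.card_univ] at hZ
    rw [pow_succ] at h2 hZ
    have : 0 < 2 ^ lg := by positivity
    omega
  have hIW : I ∩ W₁ = I := by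
    refine Finset.inter_eq_left.mpr fun v hv => ?_
    rw [hW₁, Finset.mem_filter]
    exact ⟨Finset.mem_univ _, fun x hx hadj => hI (hXI hx) hv hadj.ne hadj⟩
  have hr : Reach G (3 * p * (lg + 1)) Finset.univ W₁ :=
    (reach_delete_neighbors Finset.univ X).of_le hXc
  obtain ⟨k', hk', W, hWW, h1, h2, h3, h4⟩ := exists_reach_of_step (G := G) (J := I) (W₀ := W₁)
    (Q := fun W => ∀ q u, q % 2 = 1 → WalkIn G W q u u → 5 ≤ q)
    (fun W hW q u hq hw => absurd hw (hW.not_walkIn hq)) (a := 3) (p := p) (w := I.card)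
    (by
      intro W hW hQ
      push Not at hQ
      obtain ⟨q, u, hq, hw, hq5⟩ := hQ
      obtain ⟨ℓ, c, hc⟩ := exists_shortestOdd_of_walkIn ⟨q, hq, u, hw⟩
      have hℓ : ℓ = 3 := by
        have := hc.le q u hq hw
        have := hc.three_le
        have := hc.odd
        omega
      subst hℓ
      obtain ⟨W', h1, h2, h3, h4⟩ := hc.delete_cycle (J := I) (D := I.card / (3 * p)) (by
        intro v hv
        rw [Nat.le_div_iff_mul_le (by omega), Nat.mul_comm]
        refine le_trans (Nat.mul_le_mul_left _ (Finset.card_le_card ?_)) (hlight v (hW hv))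
        exact Finset.filter_subset_filter _ Finset.inter_subset_left)
      refine ⟨W', h1, h2, h3, ?_⟩
      have h5 : 3 * p * (I.card / (3 * p)) ≤ I.card := Nat.mul_div_le _ _
      have h6 := Nat.mul_le_mul_left p h4
      have e : p * ((I ∩ W').card + 3 * (I.card / (3 * p))) =
        p * (I ∩ W').card + 3 * p * (I.card / (3 * p)) := by ring
      omega)
    k W₁ le_rfl (fun h => hG (h.mono (Finset.subset_univ _)))
  rw [hIW] at h4
  exact ⟨k', hk', W, hr.trans h1, h2, h3, h4⟩

/-- If the independent set `J ⊆ W` and the whole set `W` are of comparable size, then a constant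
number of deletions makes the maximum degree small compared to `J`: after the deletion of the
neighbours of a sample of `J` there are few edges between `J` and the rest, so that few vertices of
`J` have a large degree. -/
theorem exists_reach_small_degree {M c α h : ℕ} {W J : Finset V} (hJW : J ⊆ W)
    (hJ : G.IsIndepSet (J : Set V)) (hW : W.card ≤ c * α) (hJα : J.card ≤ α)
    (hh : h ≤ Fintype.card V + 1) :
    ∃ W' ⊆ W, Reach G (M * M + 1) W W' ∧
      (∀ v ∈ W', (W'.filter (G.Adj v)).card < h) ∧
      M * h * J.card ≤ M * h * (J ∩ W').card + 2 * c * α * α := by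
  obtain ⟨X, hXJ, Z, hXc, hZ, hX⟩ := exists_hitting (G := G) M M J W
  set W₁ := W.filter fun v => ∀ x ∈ X, ¬ G.Adj x v with hW₁
  set W' := W₁.filter fun v => (W₁.filter (G.Adj v)).card < h with hW'
  have hJW₁ : J ⊆ W₁ := by
    intro v hv
    rw [hW₁, Finset.mem_filter]
    exact ⟨hJW hv, fun x hx hadj => hJ (hXJ hx) hv hadj.ne hadj⟩
  have hZc : M * Z.card ≤ W.card :=
    (Nat.mul_le_mul_right _ Nat.lt_two_pow_self.le).trans hZ
  refine ⟨W', (Finset.filter_subset _ _).trans (Finset.filter_subset _ _),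
    ((reach_delete_neighbors W X).of_le hXc).trans (Step.delete_high_degree _ hh).reach, ?_, ?_⟩
  · intro v hv
    rw [hW', Finset.mem_filter] at hv
    exact (Finset.card_le_card (Finset.filter_subset_filter _ (Finset.filter_subset _ _))).trans_lt
      hv.2
  -- Count the edges between `J` and `W₁`.
  have hedge : M * ∑ u ∈ W₁, (J.filter (G.Adj u)).card ≤ 2 * (W.card * J.card) := by
    have h1 : ∀ u ∈ W₁, M * (J.filter (G.Adj u)).card ≤
        J.card + if u ∈ Z then M * J.card else 0 := by
      intro u hu
      split_ifs with huZ
      · have := Nat.mul_le_mul_left M (Finset.card_filter_le J (G.Adj u))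
        omega
      · rw [hW₁, Finset.mem_filter] at hu
        have : ¬ J.card < M * (J.filter (G.Adj u)).card := fun h => huZ (hX u hu.1 h hu.2)
        omega
    rw [Finset.mul_sum]
    refine (Finset.sum_le_sum h1).trans ?_
    rw [Finset.sum_add_distrib, ← Finset.sum_filter]
    simp only [Finset.sum_const, smul_eq_mul]
    have h2 : (W₁.filter (· ∈ Z)).card ≤ Z.card :=
      Finset.card_le_card fun v hv => (Finset.mem_filter.mp hv).2
    have h3 : W₁.card ≤ W.card := Finset.card_filter_le _ _
    calc W₁.card * J.card + (W₁.filter (· ∈ Z)).card * (M * J.card)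
        ≤ W.card * J.card + Z.card * (M * J.card) := by gcongr
      _ = W.card * J.card + M * Z.card * J.card := by ring
      _ ≤ W.card * J.card + W.card * J.card := by gcongr
      _ = 2 * (W.card * J.card) := by ring
  have hlost : (J \ W').card * h ≤ ∑ u ∈ W₁, (J.filter (G.Adj u)).card := by
    have h1 : ∑ v ∈ J, (W₁.filter (G.Adj v)).card = ∑ u ∈ W₁, (J.filter (G.Adj u)).card := by
      have := Finset.sum_card_bipartiteAbove_eq_sum_card_bipartiteBelow (s := J) (t := W₁)
        (fun x v => G.Adj x v)
      simpa only [Finset.bipartiteAbove, Finset.bipartiteBelow, G.adj_comm] using this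
    rw [← h1, ← smul_eq_mul, ← Finset.sum_const]
    refine le_trans (Finset.sum_le_sum fun v hv => ?_)
      (Finset.sum_le_sum_of_subset (Finset.sdiff_subset (s := J) (t := W')))
    rw [Finset.mem_sdiff, hW', Finset.mem_filter, not_and, not_lt] at hv
    exact hv.2 (hJW₁ hv.1)
  have hsplit : (J ∩ W').card + (J \ W').card = J.card := Finset.card_inter_add_card_sdiff J W'
  calc M * h * J.card = M * h * (J ∩ W').card + M * ((J \ W').card * h) := by
        rw [← hsplit]; ring
    _ ≤ M * h * (J ∩ W').card + 2 * (W.card * J.card) :=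
        Nat.add_le_add_left ((Nat.mul_le_mul_left M hlost).trans hedge) _
    _ ≤ M * h * (J ∩ W').card + 2 * (c * α * α) := by gcongr
    _ = _ := by ring

/-- The lengths up to which an odd cycle counts as short. -/
def shortLength (p : ℕ) : ℕ := 44 * p ^ 2

/-- The precision of the sample that makes the maximum degree small. -/
def samplePrecision (k p : ℕ) : ℕ := 8 * (6 * k + 2) * p ^ 2 * shortLength p

/-- A number of deletions, depending on `k` and `p` only, that suffices after the deletion of the
triangles. -/
def numSteps (k p : ℕ) : ℕ := samplePrecision k p * samplePrecision k p + 1 + shortLength p * k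

/-- The structural result behind the algorithm: a short sequence of deletions turns a graph with
a small packing number into a bipartite graph and keeps most of a maximum independent set. -/
theorem exists_reach_bip {k p lg : ℕ} (hp : 1 ≤ p) (hlg : Fintype.card V ≤ 2 ^ lg)
    (hG : ¬ OddPack G Finset.univ (k + 1)) {I : Finset V} (hI : G.IsIndepSet (I : Set V))
    (hmax : ∀ S : Finset V, G.IsIndepSet (S : Set V) → S.card ≤ I.card) :
    ∃ W, Reach G (3 * p * (lg + 1) + 3 * k + numSteps k p) Finset.univ W ∧ Bip G W ∧
      p * I.card ≤ p * (I ∩ W).card + k * I.card := by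
  obtain ⟨k₂, hk₂, W₂, hr₂, htri, hpack, hloss₂⟩ :=
    exists_reach_triangleFree hp hlg hG hI
  rcases Nat.eq_zero_or_pos k₂ with rfl | hpos
  · refine ⟨W₂, hr₂.of_le (by omega), ?_, by omega⟩
    by_contra hb
    exact hpack (oddPack_one_of_not_bip hb)
  have hIpos : 0 < I.card := by
    obtain ⟨v⟩ := ‹Nonempty V›
    simpa using hmax {v} (by simp)
  have hW₂ : W₂.card ≤ (6 * k + 2) * I.card :=
    (card_le_of_not_oddPack k₂ W₂ (fun S _ hS => hmax S hS) htri hpack).trans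
      (Nat.mul_le_mul_right _ (by omega))
  have hLpos : 0 < shortLength p := by
    have : 0 < p ^ 2 := by positivity
    unfold shortLength; omega
  set L := shortLength p with hL
  set M := samplePrecision k p with hM
  -- With maximum degree `D`, the neighbourhood of a cycle of length at most `L` has at most
  -- `|I| / (2 p)` vertices in `I`.
  set D := I.card / (2 * p * L) with hD
  have hDlow : 2 * p * L * D ≤ I.card := Nat.mul_div_le _ _
  have hDup : I.card < 2 * p * L * (D + 1) := by
    rw [Nat.mul_comm]
    exact Nat.lt_mul_of_div_lt (Nat.lt_succ_self _) (by positivity)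
  have hDn : D + 1 ≤ Fintype.card V + 1 := by
    have h1 : D ≤ I.card := Nat.div_le_self _ _
    have h2 := Finset.card_le_univ I
    omega
  obtain ⟨W₄, hW₄, hr₄, hdeg, hloss₄⟩ := exists_reach_small_degree (G := G) (M := M)
    (c := 6 * k + 2) (α := I.card) (h := D + 1) (W := W₂) (J := I ∩ W₂) Finset.inter_subset_right
    (hI.mono (by simp)) hW₂ (Finset.card_le_card Finset.inter_subset_left) hDn
  have hIW₄ : I ∩ W₂ ∩ W₄ = I ∩ W₄ := by
    rw [Finset.inter_assoc, Finset.inter_eq_right.mpr hW₄]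
  rw [hIW₄] at hloss₄
  -- The reduction of the degree and the deletion of a cycle each lose at most `|I| / (2 p)`. Since
  -- `k₂` is positive, at most `k₂ + 1 ≤ 2 * k₂` such losses follow the deletion of the triangles.
  have hloss₄' : 2 * p * (I ∩ W₂).card ≤ 2 * p * (I ∩ W₄).card + I.card := by
    have hle : (I ∩ W₄).card ≤ (I ∩ W₂).card :=
      Finset.card_le_card (Finset.inter_subset_inter_left hW₄)
    obtain ⟨d, hd⟩ := Nat.exists_eq_add_of_le hle
    rw [hd] at hloss₄ ⊢
    have h1 : M * (D + 1) * d ≤ 2 * (6 * k + 2) * I.card * I.card := by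
      rw [Nat.mul_add] at hloss₄
      omega
    have h2 : M = 8 * (6 * k + 2) * p ^ 2 * L := rfl
    have h3 : 4 * (6 * k + 2) * p * I.card * d ≤ 2 * (6 * k + 2) * I.card * I.card :=
      calc 4 * (6 * k + 2) * p * I.card * d
          ≤ 4 * (6 * k + 2) * p * (2 * p * L * (D + 1)) * d := by gcongr
        _ = M * (D + 1) * d := by rw [h2]; ring
        _ ≤ _ := h1
    have h4 : 2 * (6 * k + 2) * I.card * (2 * p * d) ≤ 2 * (6 * k + 2) * I.card * I.card := by
      refine le_trans (le_of_eq ?_) h3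
      ring
    have h5 := Nat.le_of_mul_le_mul_left h4 (by positivity)
    rw [Nat.mul_add]
    omega
  obtain ⟨k', -, W₅, hW₅, hr₅, hb, -, hloss₅⟩ := exists_reach_of_step (G := G) (J := I) (W₀ := W₄)
    (Q := Bip G) (fun W hW => hW) (a := L) (p := 2 * p) (w := I.card)
    (by
      intro W hW hb
      obtain ⟨ℓ, c, hc⟩ := exists_shortestOdd hb
      by_cases hℓ : ℓ ≤ L
      · obtain ⟨W', h1, h2, h3, h4⟩ := hc.delete_cycle (J := I) (D := D) (by
          intro v hv
          have := (Finset.card_le_card (Finset.filter_subset_filter (G.Adj v)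
            (Finset.inter_subset_right.trans hW : I ∩ W ⊆ W₄))).trans_lt (hdeg v (hW hv))
          omega)
        refine ⟨W', h1, h2.of_le hℓ, h3, ?_⟩
        calc 2 * p * (I ∩ W).card ≤ 2 * p * ((I ∩ W').card + L * D) :=
              Nat.mul_le_mul_left _ (h4.trans (by gcongr))
          _ = 2 * p * (I ∩ W').card + 2 * p * L * D := by ring
          _ ≤ _ := by omega
      · obtain ⟨W', h1, h2, h3, h4⟩ := hc.delete_sphere_ball (t := 4 * p) (by omega) (by
          have : 4 * p * (2 * (4 * p) + 3) ≤ L := by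
            rw [hL, shortLength]
            nlinarith
          omega) I
        refine ⟨W', h1, h2.reach.of_le hLpos, h3, ?_⟩
        have e1 : 4 * p * (I ∩ W).card = 2 * (2 * p * (I ∩ W).card) := by ring
        have e2 : 4 * p * (I ∩ W').card = 2 * (2 * p * (I ∩ W').card) := by ring
        omega)
    k₂ W₄ le_rfl (fun h => hpack (h.mono hW₄))
  refine ⟨W₅, ?_, hb, ?_⟩
  · refine ((hr₂.trans hr₄).trans hr₅).of_le ?_
    have : L * k₂ ≤ L * k := Nat.mul_le_mul_left _ hk₂
    have e : numSteps k p = M * M + 1 + L * k := rfl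
    omega
  · have e1 : 2 * p * (I ∩ W₂).card = 2 * (p * (I ∩ W₂).card) := by ring
    have e2 : 2 * p * (I ∩ W₅).card = 2 * (p * (I ∩ W₅).card) := by ring
    have e3 : I.card ≤ k₂ * I.card := Nat.le_mul_of_pos_left _ hpos
    have : 0 ≤ k' * I.card := Nat.zero_le _
    omega

end Main

/-! ### Deterministic evaluation -/

namespace RandProg

/-- For every sufficient bound on the depth, the evaluation of `e` has the fixed value `v`, and it
takes a fixed time of at most `T` units. -/
def Runs (P : Program) (env : List Val) (e : Expr) (v : Val) (T : ℕ) : Prop :=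
  ∃ t ≤ T, ∃ d₀, ∀ d ≥ d₀, eval P d env e = Comp.ret v t

theorem Comp.tick_ret {α : Type} (a : α) (t : ℕ) :
    (Comp.ret a t).tick = Comp.ret a (t + 1) := by
  simp [Comp.tick, Comp.ret, PMF.pure_map]

theorem Comp.ret_andThen {α β : Type} (a : α) (s : ℕ) (f : α → Comp β) :
    (Comp.ret a s).andThen f = PMF.map (Option.map fun r => (r.1, s + r.2)) (f a) := by
  simp only [Comp.andThen, Comp.ret, PMF.pure_bind]

theorem Comp.map_ret {β : Type} (b : β) (s t : ℕ) :
    PMF.map (Option.map fun r : β × ℕ => (r.1, s + r.2)) (Comp.ret b t) =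
      Comp.ret b (s + t) := by
  simp [Comp.ret, PMF.pure_map]

namespace Runs

variable {P : Program} {env : List Val} {a b c e : Expr} {v v' x y : Val} {T T' T₁ T₂ : ℕ}

theorem cast (h : Runs P env e v T) (hv : v = v') (hT : T ≤ T') : Runs P env e v' T' := by
  obtain ⟨t, ht, h⟩ := h
  exact ⟨t, ht.trans hT, hv ▸ h⟩

theorem mono (h : Runs P env e v T) (hT : T ≤ T') : Runs P env e v T' := h.cast rfl hT

theorem intro {t : ℕ} (ht : t ≤ T) (d₀ : ℕ)
    (h : ∀ d ≥ d₀, eval P (d + 1) env e = Comp.ret v t) : Runs P env e v T := by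
  refine ⟨t, ht, d₀ + 1, fun d hd => ?_⟩
  obtain ⟨d, rfl⟩ : ∃ d', d = d' + 1 := ⟨d - 1, by omega⟩
  exact h d (by omega)

theorem var (i : ℕ) : Runs P env (.var i) (env.getD i (.nat 0)) 1 :=
  intro le_rfl 0 fun d _ => by rw [eval]

theorem lit (m : ℕ) : Runs P env (.lit m) (.nat m) 1 :=
  intro le_rfl 0 fun d _ => by rw [eval]

theorem binary {f : Expr → Expr → Expr} {g : Val → Val → Val}
    (hf : ∀ d, eval P (d + 1) env (f a b) = Comp.tick ((eval P d env a).andThen fun x =>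
      (eval P d env b).andThen fun y => Comp.ret (g x y) 0))
    (ha : Runs P env a x T₁) (hb : Runs P env b y T₂) :
    Runs P env (f a b) (g x y) (T₁ + T₂ + 1) := by
  obtain ⟨t₁, ht₁, d₁, h₁⟩ := ha
  obtain ⟨t₂, ht₂, d₂, h₂⟩ := hb
  refine intro (t := t₁ + (t₂ + 0) + 1) (by omega) (max d₁ d₂) fun d hd => ?_
  rw [hf, h₁ d (le_trans (le_max_left _ _) hd), h₂ d (le_trans (le_max_right _ _) hd),
    Comp.ret_andThen, Comp.ret_andThen, Comp.map_ret, Comp.map_ret, Comp.tick_ret]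

theorem unary {f : Expr → Expr} {g : Val → Val}
    (hf : ∀ d, eval P (d + 1) env (f a) = Comp.tick ((eval P d env a).andThen fun x =>
      Comp.ret (g x) 0))
    (ha : Runs P env a x T₁) : Runs P env (f a) (g x) (T₁ + 1) := by
  obtain ⟨t₁, ht₁, d₁, h₁⟩ := ha
  refine intro (t := t₁ + 0 + 1) (by omega) d₁ fun d hd => ?_
  rw [hf, h₁ d hd, Comp.ret_andThen, Comp.map_ret, Comp.tick_ret]

theorem add (ha : Runs P env a x T₁) (hb : Runs P env b y T₂) :
    Runs P env (.add a b) (.nat (x.toNat + y.toNat)) (T₁ + T₂ + 1) :=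
  binary (f := .add) (g := fun x y => .nat (x.toNat + y.toNat)) (fun d => by rw [eval]) ha hb

theorem sub (ha : Runs P env a x T₁) (hb : Runs P env b y T₂) :
    Runs P env (.sub a b) (.nat (x.toNat - y.toNat)) (T₁ + T₂ + 1) :=
  binary (f := .sub) (g := fun x y => .nat (x.toNat - y.toNat)) (fun d => by rw [eval]) ha hb

theorem pair (ha : Runs P env a x T₁) (hb : Runs P env b y T₂) :
    Runs P env (.pair a b) (.pair x y) (T₁ + T₂ + 1) :=
  binary (f := .pair) (g := .pair) (fun d => by rw [eval]) ha hb

theorem fst (ha : Runs P env a x T₁) : Runs P env (.fst a) x.fst (T₁ + 1) :=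
  unary (f := .fst) (g := Val.fst) (fun d => by rw [eval]) ha

theorem snd (ha : Runs P env a x T₁) : Runs P env (.snd a) x.snd (T₁ + 1) :=
  unary (f := .snd) (g := Val.snd) (fun d => by rw [eval]) ha

theorem bind_of {f : Val → ℕ → Comp Val} {T₁ T₂ : ℕ}
    (hf : ∀ d, eval P (d + 1) env e = Comp.tick ((eval P d env a).andThen fun x => f x d))
    (ha : Runs P env a x T₁) (hb : ∃ t ≤ T₂, ∃ d₀, ∀ d ≥ d₀, f x d = Comp.ret v t) :
    Runs P env e v (T₁ + T₂ + 1) := by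
  obtain ⟨t₁, ht₁, d₁, h₁⟩ := ha
  obtain ⟨t₂, ht₂, d₂, h₂⟩ := hb
  refine intro (t := t₁ + t₂ + 1) (by omega) (max d₁ d₂) fun d hd => ?_
  rw [hf, h₁ d (le_trans (le_max_left _ _) hd),
    Comp.ret_andThen, h₂ d (le_trans (le_max_right _ _) hd), Comp.map_ret, Comp.tick_ret]

theorem letIn (ha : Runs P env a x T₁) (hb : Runs P (x :: env) b v T₂) :
    Runs P env (.letIn a b) v (T₁ + T₂ + 1) :=
  bind_of (f := fun x d => eval P d (x :: env) b) (fun d => by rw [eval]) ha hb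

theorem call {f : ℕ} (ha : Runs P env a x T₁) (hb : Runs P [x] (P.getD f (.lit 0)) v T₂) :
    Runs P env (.call f a) v (T₁ + T₂ + 1) :=
  bind_of (f := fun x d => eval P d [x] (P.getD f (.lit 0))) (fun d => by rw [eval]) ha hb

theorem ifZero_zero (hc : Runs P env c (.nat 0) T₁) (ha : Runs P env a v T₂) :
    Runs P env (.ifZero c a b) v (T₁ + T₂ + 1) :=
  bind_of (f := fun x d => match x with
    | .nat 0 => eval P d env a
    | _ => eval P d env b) (fun d => by rw [eval]) hc ha

theorem ifZero_ne (hc : Runs P env c x T₁) (hx : x ≠ .nat 0) (hb : Runs P env b v T₂) :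
    Runs P env (.ifZero c a b) v (T₁ + T₂ + 1) :=
  bind_of (f := fun x d => match x with
    | .nat 0 => eval P d env a
    | _ => eval P d env b) (fun d => by rw [eval]) hc (by
      match x, hx with
      | .nat 0, hx => exact absurd rfl hx
      | .nat (m + 1), _ => exact hb
      | .pair _ _, _ => exact hb)

theorem ifZero_succ {m : ℕ} (hc : Runs P env c (.nat (m + 1)) T₁) (hb : Runs P env b v T₂) :
    Runs P env (.ifZero c a b) v (T₁ + T₂ + 1) :=
  ifZero_ne hc (fun h => Nat.succ_ne_zero m (Val.nat.inj h)) hb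

theorem ifZero_nat {m : ℕ} (hc : Runs P env c (.nat m) T) (ha : Runs P env a v T₁)
    (hb : Runs P env b v' T₂) :
    Runs P env (.ifZero c a b) (if m = 0 then v else v') (T + (T₁ + T₂) + 1) := by
  split_ifs with h
  · subst h
    exact ifZero_zero hc (ha.mono (by omega))
  · exact ifZero_ne hc (fun h0 => h (Val.nat.inj h0)) (hb.mono (by omega))

theorem ifPair_pair {x' : Val} (hc : Runs P env c (.pair x x') T₁) (ha : Runs P env a v T₂) :
    Runs P env (.ifPair c a b) v (T₁ + T₂ + 1) :=
  bind_of (f := fun x d => match x with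
    | .pair _ _ => eval P d env a
    | .nat _ => eval P d env b) (fun d => by rw [eval]) hc ha

theorem ifPair_nat {m : ℕ} (hc : Runs P env c (.nat m) T₁) (hb : Runs P env b v T₂) :
    Runs P env (.ifPair c a b) v (T₁ + T₂ + 1) :=
  bind_of (f := fun x d => match x with
    | .pair _ _ => eval P d env a
    | .nat _ => eval P d env b) (fun d => by rw [eval]) hc hb

end Runs

/-- A deterministic run halts within its time bound, with a deterministic output. -/
theorem Runs.haltsWithin {P : Program} {x v : Val} {T : ℕ} {B : ℝ}
    (h : Runs P [x] (P.getD 0 (.lit 0)) v T) (hB : (T : ℝ) ≤ B) :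
    P.HaltsWithin x B (PMF.pure v) := by
  obtain ⟨t, ht, d, h⟩ := h
  refine ⟨d, PMF.pure (v, t), ?_, ?_, ?_⟩
  · rw [h d le_rfl, PMF.pure_map]; rfl
  · intro r hr
    rw [PMF.support_pure, Set.mem_singleton_iff] at hr
    subst hr
    exact le_trans (by exact_mod_cast ht) hB
  · rw [PMF.pure_map]

/-! ### Argument lists and tables -/

/-- The expression for the list of the values of some expressions, used for function arguments. -/
def Expr.args : List Expr → Expr
  | [] => .lit 0
  | a :: l => .pair a (Expr.args l)

/-- The `i`-fold second component of an expression. -/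
def Expr.snds : ℕ → Expr → Expr
  | 0, a => a
  | i + 1, a => Expr.snds i (.snd a)

/-- The `i`-th component of the list stored in variable `d`. -/
def Expr.arg (d i : ℕ) : Expr := .fst (Expr.snds i (.var d))

/-- The `i`-fold second component of a value. -/
def Val.drop : ℕ → Val → Val
  | 0, v => v
  | i + 1, v => Val.drop i v.snd

/-- The `i`-th component of a list. -/
def Val.get (v : Val) (i : ℕ) : Val := (v.drop i).fst

/-- The list of the values of a function. -/
def Val.tab {n : ℕ} (f : Fin n → Val) : Val := Val.ofList (List.ofFn f)

theorem Val.tab_succ {n : ℕ} (f : Fin (n + 1) → Val) :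
    Val.tab f = .pair (f 0) (Val.tab fun i => f i.succ) := by
  simp [Val.tab, Val.ofList, List.ofFn_succ]

theorem Val.drop_nat_zero (i : ℕ) : Val.drop i (.nat 0) = .nat 0 := by
  induction i with
  | zero => rfl
  | succ i ih => exact ih

theorem Val.get_nat_zero (i : ℕ) : Val.get (.nat 0) i = .nat 0 := by
  rw [Val.get, Val.drop_nat_zero]; rfl

theorem Val.get_tab {n : ℕ} (f : Fin n → Val) (i : Fin n) : (Val.tab f).get i = f i := by
  induction n with
  | zero => exact i.elim0
  | succ n ih =>
    rw [Val.tab_succ]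
    refine Fin.cases ?_ (fun i => ?_) i
    · rfl
    · exact ih (fun i => f i.succ) i

namespace Runs

variable {P : Program} {env : List Val} {a : Expr} {l : List Expr} {x y : Val} {T T₁ T₂ : ℕ}

theorem nil : Runs P env (Expr.args []) (.nat 0) 1 := lit 0

theorem cons (ha : Runs P env a x T₁) (hl : Runs P env (Expr.args l) y T₂) :
    Runs P env (Expr.args (a :: l)) (.pair x y) (T₁ + T₂ + 1) := pair ha hl

theorem snds (i : ℕ) (ha : Runs P env a x T) :
    Runs P env (Expr.snds i a) (x.drop i) (T + i) := by
  induction i generalizing a x T with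
  | zero => exact ha
  | succ i ih => exact (ih ha.snd).mono (by omega)

theorem arg (d i : ℕ) : Runs P env (Expr.arg d i) ((env.getD d (.nat 0)).get i) (i + 2) :=
  (fst (snds i (var d))).mono (by omega)

end Runs

end RandProg

/-! ### The program -/

namespace RandProg

namespace Prog

open RandProg.Expr

/-- `(r, s) ↦ ∑ i, if r i = 0 then 0 else s i` -/
def dotBody : Expr :=
  ifPair (arg 0 0)
    (add (ifZero (fst (arg 0 0)) (lit 0) (fst (arg 0 1)))
      (call 1 (args [snd (arg 0 0), snd (arg 0 1)])))
    (lit 0)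

/-- `(rows, W, S, U, h)` is mapped to the indicator list of the vertices of `W ∪ U` whose number of
neighbours in `S`, increased by one for the elements of `U`, is at least `h`. -/
def thresholdBody : Expr :=
  ifPair (arg 0 0)
    (pair
      (ifZero (add (fst (arg 0 1)) (fst (arg 0 3))) (lit 0)
        (ifZero (sub (arg 0 4) (add (call 1 (args [fst (arg 0 0), arg 0 2])) (fst (arg 0 3))))
          (lit 1) (lit 0)))
      (call 2 (args [snd (arg 0 0), snd (arg 0 1), arg 0 2, snd (arg 0 3), arg 0 4])))
    (lit 0)

/-- `(W, A, B) ↦ W - (A - B)`, that is, the set `W \ (A \ B)` -/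
def diffBody : Expr :=
  ifPair (arg 0 0)
    (pair (sub (fst (arg 0 0)) (sub (fst (arg 0 1)) (fst (arg 0 2))))
      (call 3 (args [snd (arg 0 0), snd (arg 0 1), snd (arg 0 2)])))
    (lit 0)

/-- `(l, i)` is mapped to the `i`-th entry of `l`. -/
def nthBody : Expr :=
  ifZero (arg 0 1) (fst (arg 0 0)) (call 4 (args [snd (arg 0 0), sub (arg 0 1) (lit 1)]))

/-- the indicator list of `{x}` -/
def unitBody : Expr :=
  ifZero (arg 0 0) (pair (lit 1) (lit 0)) (pair (lit 0) (call 5 (args [sub (arg 0 0) (lit 1)])))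

/-- `(rows, W, x, i)` is mapped to the open ball of radius `i` around `x`. -/
def ballBody : Expr :=
  ifZero (arg 0 3) (lit 0)
    (call 2 (args [arg 0 0, arg 0 1,
      call 6 (args [arg 0 0, arg 0 1, arg 0 2, sub (arg 0 3) (lit 1)]),
      call 5 (args [arg 0 2]), lit 1]))

/-- `(a, lev, row, st)`: the bidder `a` searches `row` for an item of price at most `lev`. The
result is `0` if there is none, and otherwise a pair of the code of the previous owner and the
new state. The state is a list with an entry `(price, code)` for each item, where the code is `0`
if the item has no owner, and the number of the owner plus one otherwise. -/
def bidBody : Expr :=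
  ifPair (arg 0 2)
    (ifZero (ifZero (fst (arg 0 2)) (lit 1) (sub (fst (fst (arg 0 3))) (arg 0 1)))
      (pair (add (snd (fst (arg 0 3))) (lit 0))
        (pair (pair (add (fst (fst (arg 0 3))) (lit 1)) (add (arg 0 0) (lit 1))) (snd (arg 0 3))))
      (letIn (call 7 (args [arg 0 0, arg 0 1, snd (arg 0 2), snd (arg 0 3)]))
        (ifPair (var 0) (pair (fst (var 0)) (pair (fst (arg 1 3)) (snd (var 0)))) (lit 0))))
    (lit 0)

/-- `(rows, cap, W, a, lev, st)`: the bidder `a` enters the auction at the level `lev`. The result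
is a pair of the number of bidders that gave up (`0` or `1`) and the new state. -/
def insertBody : Expr :=
  ifZero (sub (arg 0 1) (arg 0 4)) (pair (lit 1) (arg 0 5))
    (letIn (call 4 (args [arg 0 0, arg 0 3]))
      (letIn (call 7 (args [arg 1 3, arg 1 4, call 3 (args [var 0, var 0, arg 1 2]), arg 1 5]))
        (ifPair (var 0)
          (ifZero (fst (var 0)) (pair (lit 0) (snd (var 0)))
            (call 8 (args [arg 2 0, arg 2 1, arg 2 2, sub (fst (var 0)) (lit 1), lit 0,
              snd (var 0)])))
          (call 8 (args [arg 2 0, arg 2 1, arg 2 2, arg 2 3, add (arg 2 4) (lit 1), arg 2 5])))))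

/-- `(rows, cap, W, i, st)`: the bidders less than `i` in `W` enter the auction. The result is their
number plus the number of those that give up. -/
def valueBody : Expr :=
  ifZero (arg 0 3) (lit 0)
    (letIn (sub (arg 0 3) (lit 1))
      (ifZero (call 4 (args [arg 1 2, var 0]))
        (call 9 (args [arg 1 0, arg 1 1, arg 1 2, var 0, arg 1 4]))
        (letIn (call 8 (args [arg 1 0, arg 1 1, arg 1 2, var 0, lit 0, arg 1 4]))
          (add (add (lit 1) (fst (var 0)))
            (call 9 (args [arg 2 0, arg 2 1, arg 2 2, var 1, snd (var 0)]))))))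

/-- `(rows, n, W, v)` is mapped to the part, starting at `v`, of the list of an independent subset
of `W`, which is chosen greedily. -/
def solveBody : Expr :=
  ifZero (sub (arg 0 1) (arg 0 3)) (lit 0)
    (ifZero (call 4 (args [arg 0 2, arg 0 3]))
      (pair (lit 0) (call 10 (args [arg 0 0, arg 0 1, arg 0 2, add (arg 0 3) (lit 1)])))
      (letIn (call 3 (args [arg 0 2, call 5 (args [arg 0 3]), lit 0]))
        (letIn (call 3 (args [var 0, call 4 (args [arg 1 0, arg 1 3]), lit 0]))
          (ifZero
            (sub (call 9 (args [arg 2 0, add (arg 2 1) (lit 2), arg 2 2, arg 2 1, lit 0]))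
              (add (call 9 (args [arg 2 0, add (arg 2 1) (lit 2), var 0, arg 2 1, lit 0])) (lit 2)))
            (pair (lit 1) (call 10 (args [arg 2 0, arg 2 1, var 0, add (arg 2 3) (lit 1)])))
            (pair (lit 0) (call 10 (args [arg 2 0, arg 2 1, var 1, add (arg 2 3) (lit 1)])))))))

/-- `(rows, n, W, l)`: perform the deletions in the list `l`, six numbers for each of them, and
solve the rest. -/
def runBody : Expr :=
  ifPair (arg 0 3)
    (letIn (arg 0 3)
      (call 11 (args [arg 1 0, arg 1 1,
        call 3 (args [
          call 3 (args [
            call 3 (args [arg 1 2, call 6 (args [arg 1 0, arg 1 2, arg 0 0, arg 0 2]),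
              call 6 (args [arg 1 0, arg 1 2, arg 0 0, arg 0 1])]),
            call 6 (args [arg 1 0, arg 1 2, arg 0 3, arg 0 4]), lit 0]),
          call 2 (args [arg 1 0, arg 1 2, arg 1 2, lit 0, arg 0 5]), lit 0]),
        snds 6 (var 0)])))
    (call 10 (args [arg 0 0, arg 0 1, arg 0 2, lit 0]))

/-- `(rows, n, W, F, c, l)`: the best result for all extensions of `l` by `F` numbers at most
`n + 1`, the first of which is less than `c`. -/
def searchBody : Expr :=
  ifZero (arg 0 3) (call 11 (args [arg 0 0, arg 0 1, arg 0 2, arg 0 5]))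
    (ifZero (arg 0 4) (lit 0)
      (letIn (sub (arg 0 4) (lit 1))
        (letIn (call 12 (args [arg 1 0, arg 1 1, arg 1 2, sub (arg 1 3) (lit 1),
            add (arg 1 1) (lit 2), pair (var 0) (arg 1 5)]))
          (letIn (call 12 (args [arg 2 0, arg 2 1, arg 2 2, arg 2 3, var 1, arg 2 5]))
            (ifZero (sub (call 1 (args [var 0, var 0])) (call 1 (args [var 1, var 1])))
              (var 1) (var 0))))))

/-- `x ↦ 2 ^ x` -/
def expBody : Expr :=
  ifZero (arg 0 0) (lit 1)
    (letIn (call 13 (args [sub (arg 0 0) (lit 1)])) (add (var 0) (var 0)))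

/-- `(n, m, p)` is mapped to `p` times the number of duplications that take `m` to at least `n`. -/
def logBody : Expr :=
  ifZero (sub (arg 0 0) (arg 0 1)) (lit 0)
    (add (arg 0 2) (call 14 (args [arg 0 0, add (arg 0 1) (arg 0 1), arg 0 2])))

/-- the list of `n` ones -/
def fullBody : Expr :=
  ifZero (arg 0 0) (lit 0) (pair (lit 1) (call 15 (args [sub (arg 0 0) (lit 1)])))

/-- The main function: compute the number `F` of choices and search. The input is
`(k, p, n, rows)`, nested to the right. -/
def mainBody : Expr :=
  letIn (add (arg 0 0) (arg 0 1))
    (letIn (add (var 0) (var 0))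
      (letIn (add (var 0) (var 0))
        (letIn (add (var 0) (var 0))
          (letIn (call 13 (args [add (var 0) (lit 30)]))
            (letIn (call 14 (args [arg 5 2, lit 1, arg 5 1]))
              (letIn (add (add (var 0) (add (var 0) (var 0))) (var 1))
                (letIn (add (var 0) (add (var 0) (var 0)))
                  (call 12 (args [snds 3 (var 8), arg 8 2, call 15 (args [arg 8 2]),
                    add (var 0) (var 0), add (arg 8 2) (lit 2), lit 0])))))))))

end Prog

open Prog in
/-- The program of the algorithm. -/
def prog : Program :=
  [mainBody, dotBody, thresholdBody, diffBody, nthBody, unitBody, ballBody, bidBody, insertBody,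
    valueBody, solveBody, runBody, searchBody, expBody, logBody, fullBody]

/-- On the arguments `l`, function number `f` of the program yields `v` within `T` time units. -/
def RunsFn (f : ℕ) (l : List Val) (v : Val) (T : ℕ) : Prop :=
  Runs prog [Val.ofList l] (prog.getD f (.lit 0)) v T

/-! ### Running times and results of the list functions -/

/-- The list of the values of a function with values in the natural numbers. -/
def Val.natTab {n : ℕ} (f : Fin n → ℕ) : Val := Val.tab fun i => .nat (f i)

theorem Val.natTab_succ {n : ℕ} (f : Fin (n + 1) → ℕ) :
    Val.natTab f = .pair (.nat (f 0)) (Val.natTab fun i => f i.succ) := Val.tab_succ _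

theorem runs_dot {n : ℕ} (f : Fin n → ℕ) (s : Val) :
    RunsFn 1 [Val.natTab f, s] (.nat (∑ i, if f i = 0 then 0 else (s.get i).toNat))
      (40 * (n + 1)) := by
  induction n generalizing s with
  | zero =>
    exact (Runs.ifPair_nat (Runs.arg 0 0) (.lit 0)).mono (by omega)
  | succ n ih =>
    rw [Val.natTab_succ]
    refine Runs.cast (Runs.ifPair_pair (.arg 0 0) (.add (.ifZero_nat (.fst (.arg 0 0))
      (.lit 0) (.fst (.arg 0 1)))
      (.call (.cons (.snd (.arg 0 0)) (.cons (.snd (.arg 0 1)) .nil)) (ih _ s.snd)))) ?_ ?_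
    · rw [Fin.sum_univ_succ]
      change Val.nat (Val.toNat (if f 0 = 0 then .nat 0 else s.fst) + _) = _
      split_ifs <;> rfl
    · omega

theorem runs_threshold {m n : ℕ} (A : Fin m → Fin n → ℕ) (W S U : Val) (h : ℕ) :
    RunsFn 2 [Val.tab fun i => Val.natTab (A i), W, S, U, .nat h]
      (Val.natTab fun i => if (W.get i).toNat + (U.get i).toNat = 0 then 0 else
        if h - ((∑ j, if A i j = 0 then 0 else (S.get j).toNat) + (U.get i).toNat) = 0
        then 1 else 0) ((m + 1) * (40 * n + 300)) := by
  induction m generalizing W U with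
  | zero => exact (Runs.ifPair_nat (Runs.arg 0 0) (.lit 0)).mono (by omega)
  | succ m ih =>
    rw [Val.tab_succ, Val.natTab_succ]
    refine Runs.cast (Runs.ifPair_pair (.arg 0 0) (.pair
      (.ifZero_nat (.add (.fst (.arg 0 1)) (.fst (.arg 0 3))) (.lit 0)
        (.ifZero_nat (.sub (.arg 0 4) (.add (.call (.cons (.fst (.arg 0 0)) (.cons (.arg 0 2) .nil))
          (runs_dot _ _)) (.fst (.arg 0 3)))) (.lit 1) (.lit 0)))
      (.call (.cons (.snd (.arg 0 0)) (.cons (.snd (.arg 0 1)) (.cons (.arg 0 2)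
        (.cons (.snd (.arg 0 3)) (.cons (.arg 0 4) .nil))))) (ih _ W.snd U.snd)))) ?_ ?_
    · refine congrArg₂ Val.pair ?_ rfl
      rw [apply_ite Val.nat, apply_ite Val.nat]
      rfl
    · have e : (m + 1 + 1) * (40 * n + 300) = (m + 1) * (40 * n + 300) + (40 * n + 300) :=
        Nat.succ_mul _ _
      omega

theorem runs_diff {n : ℕ} (w : Fin n → ℕ) (A B : Val) :
    RunsFn 3 [Val.natTab w, A, B]
      (Val.natTab fun i => w i - ((A.get i).toNat - (B.get i).toNat)) (60 * (n + 1)) := by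
  induction n generalizing A B with
  | zero => exact (Runs.ifPair_nat (Runs.arg 0 0) (.lit 0)).mono (by omega)
  | succ n ih =>
    rw [Val.natTab_succ, Val.natTab_succ]
    exact Runs.cast (Runs.ifPair_pair (.arg 0 0) (.pair (.sub (.fst (.arg 0 0))
      (.sub (.fst (.arg 0 1)) (.fst (.arg 0 2)))) (.call (.cons (.snd (.arg 0 0))
        (.cons (.snd (.arg 0 1)) (.cons (.snd (.arg 0 2)) .nil))) (ih _ A.snd B.snd)))) rfl
      (by omega)

theorem runs_nth (l : Val) (i : ℕ) : RunsFn 4 [l, .nat i] (l.get i) (40 * (i + 1)) := by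
  induction i generalizing l with
  | zero => exact Runs.cast (Runs.ifZero_zero (.arg 0 1) (.fst (.arg 0 0))) rfl (by omega)
  | succ i ih =>
    exact Runs.cast (Runs.ifZero_succ (.arg 0 1) (.call (.cons (.snd (.arg 0 0))
      (.cons (.sub (.arg 0 1) (.lit 1)) .nil)) (ih l.snd))) rfl (by omega)

/-- The indicator list of `{x}`. -/
def Val.unit : ℕ → Val
  | 0 => .pair (.nat 1) (.nat 0)
  | x + 1 => .pair (.nat 0) (Val.unit x)

theorem Val.get_unit (x i : ℕ) : (Val.unit x).get i = .nat (if i = x then 1 else 0) := by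
  induction x generalizing i with
  | zero =>
    cases i with
    | zero => rfl
    | succ i => exact (Val.get_nat_zero i).trans (by simp)
  | succ x ih =>
    cases i with
    | zero => rfl
    | succ i => exact (ih i).trans (by simp)

theorem runs_unit (x : ℕ) : RunsFn 5 [.nat x] (Val.unit x) (40 * (x + 1)) := by
  induction x with
  | zero => exact Runs.cast (Runs.ifZero_zero (.arg 0 0) (.pair (.lit 1) (.lit 0))) rfl (by omega)
  | succ x ih =>
    exact Runs.cast (Runs.ifZero_succ (.arg 0 0) (.pair (.lit 0) (.call
      (.cons (.sub (.arg 0 0) (.lit 1)) .nil) ih))) rfl (by omega)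

theorem runs_exp (x : ℕ) : RunsFn 13 [.nat x] (.nat (2 ^ x)) (40 * (x + 1)) := by
  induction x with
  | zero => exact Runs.cast (Runs.ifZero_zero (.arg 0 0) (.lit 1)) rfl (by omega)
  | succ x ih =>
    refine Runs.cast (Runs.ifZero_succ (.arg 0 0) (.letIn (.call
      (.cons (.sub (.arg 0 0) (.lit 1)) .nil) ih) (.add (.var 0) (.var 0)))) ?_ (by omega)
    rw [pow_succ, Nat.mul_two]
    rfl

theorem runs_full (n : ℕ) : RunsFn 15 [.nat n] (Val.natTab fun _ : Fin n => 1) (40 * (n + 1)) := by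
  induction n with
  | zero => exact Runs.cast (Runs.ifZero_zero (.arg 0 0) (.lit 0)) rfl (by omega)
  | succ n ih =>
    rw [Val.natTab_succ]
    exact Runs.cast (Runs.ifZero_succ (.arg 0 0) (.pair (.lit 1) (.call
      (.cons (.sub (.arg 0 0) (.lit 1)) .nil) ih))) rfl (by omega)

theorem runs_log (n p j i : ℕ) (hij : i + j = Nat.clog 2 n) :
    RunsFn 14 [.nat n, .nat (2 ^ i), .nat p] (.nat (p * j)) (60 * (j + 1)) := by
  induction j generalizing i with
  | zero =>
    have h : n - 2 ^ i = 0 :=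
      Nat.sub_eq_zero_of_le ((Nat.clog_le_iff_le_pow one_lt_two).mp (by omega))
    refine Runs.cast (Runs.ifZero_zero (Runs.cast (.sub (.arg 0 0) (.arg 0 1))
      (congrArg Val.nat h) le_rfl) (.lit 0)) rfl (by omega)
  | succ j ih =>
    have h : ∃ m, n - 2 ^ i = m + 1 := by
      have : 2 ^ i < n := Nat.pow_lt_of_lt_clog (by omega)
      exact ⟨n - 2 ^ i - 1, by omega⟩
    obtain ⟨m, hm⟩ := h
    have ih' := ih (i + 1) (by omega)
    rw [pow_succ, Nat.mul_two] at ih'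
    refine Runs.cast (Runs.ifZero_succ (Runs.cast (.sub (.arg 0 0) (.arg 0 1))
      (congrArg Val.nat hm) le_rfl) (.add (.arg 0 2) (.call (.cons (.arg 0 0)
        (.cons (.add (.arg 0 1) (.arg 0 1)) (.cons (.arg 0 2) .nil))) ih'))) ?_ (by omega)
    rw [Nat.mul_succ, Nat.add_comm (p * j)]
    rfl

end RandProg

/-! ### Sets of vertices -/

namespace RandProg

variable {n : ℕ} {G : SimpleGraph (Fin n)} [DecidableRel G.Adj]

/-- The rows of the adjacency matrix as a value. -/
def rowsVal (G : SimpleGraph (Fin n)) [DecidableRel G.Adj] : Val :=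
  Val.tab fun i => Val.natTab fun j => if G.Adj i j then 1 else 0

/-- The entries of the list `v` are the values of the indicator function of `S`. -/
def Rep (v : Val) (S : Finset (Fin n)) : Prop :=
  ∀ i : Fin n, (v.get i).toNat = if i ∈ S then 1 else 0

theorem rep_encodeSet (S : Finset (Fin n)) : Rep (encodeSet S) S := fun i => by
  rw [encodeSet, ← Val.tab, Val.get_tab]; rfl

theorem rep_empty : Rep (.nat 0) (∅ : Finset (Fin n)) := fun i => by
  rw [Val.get_nat_zero]; simp [Val.toNat]

/-- The set with the element `x`, which is empty if `x` is not less than `n`. -/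
def pointSet (n x : ℕ) : Finset (Fin n) := Finset.univ.filter fun i => (i : ℕ) = x

theorem rep_unit (x : ℕ) : Rep (Val.unit x) (pointSet n x) := fun i => by
  rw [Val.get_unit]; simp [pointSet, Val.toNat]

theorem encodeSet_eq (S : Finset (Fin n)) :
    encodeSet S = Val.natTab fun i => if i ∈ S then 1 else 0 := rfl

theorem runs_dot_card {s t : Val} {S T : Finset (Fin n)} (f : Fin n → ℕ) (hs : Rep s S)
    (hf : ∀ i, f i = 0 ↔ i ∉ T) (ht : t = Val.natTab f) :
    RunsFn 1 [t, s] (.nat (T ∩ S).card) (40 * (n + 1)) := by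
  subst ht
  refine Runs.cast (runs_dot f s) (congrArg Val.nat ?_) le_rfl
  rw [Finset.card_eq_sum_ones, ← Finset.sum_filter_add_sum_filter_not Finset.univ (· ∈ T ∩ S)]
  rw [Finset.sum_eq_zero (s := Finset.univ.filter fun i => ¬ i ∈ T ∩ S), Nat.add_zero]
  · rw [Finset.filter_mem_eq_inter, Finset.univ_inter]
    refine Finset.sum_congr rfl fun i hi => ?_
    rw [Finset.mem_inter] at hi
    rw [if_neg (by rw [hf]; exact not_not.mpr hi.1), hs i, if_pos hi.2]
  · intro i hi
    simp only [Finset.mem_filter, Finset.mem_inter, Finset.mem_univ, true_and] at hi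
    rw [ite_eq_left_iff, hf, not_not, hs i]
    exact fun h => if_neg fun h' => hi ⟨h, h'⟩

theorem runs_threshold_set {w s u : Val} {W S U : Finset (Fin n)} (hw : Rep w W) (hs : Rep s S)
    (hu : Rep u U) (h : ℕ) :
    RunsFn 2 [rowsVal G, w, s, u, .nat h]
      (encodeSet ((W ∪ U).filter fun v =>
        h ≤ (S.filter (G.Adj v)).card + if v ∈ U then 1 else 0))
      ((n + 1) * (40 * n + 300)) := by
  refine Runs.cast (runs_threshold _ w s u h) ?_ le_rfl
  rw [encodeSet_eq]
  congr 1
  funext i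
  have hsum : (∑ j, if (if G.Adj i j then 1 else 0) = 0 then 0 else (s.get j).toNat) =
      (S.filter (G.Adj i)).card := by
    rw [Finset.card_filter, ← Finset.sum_filter_add_sum_filter_not Finset.univ (· ∈ S)]
    rw [Finset.sum_eq_zero (s := Finset.univ.filter fun i => ¬ i ∈ S), Nat.add_zero]
    · rw [Finset.filter_mem_eq_inter, Finset.univ_inter]
      refine Finset.sum_congr rfl fun j hj => ?_
      rw [hs j, if_pos hj]
      split_ifs <;> simp_all
    · intro j hj
      rw [hs j, if_neg (Finset.mem_filter.mp hj).2]
      simp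
  rw [hsum, hw i, hu i]
  simp only [Finset.mem_filter, Finset.mem_union]
  by_cases h1 : i ∈ W <;> by_cases h2 : i ∈ U <;> simp [h1, h2, Nat.sub_eq_zero_iff_le]

theorem runs_diff_set {a b : Val} {A B : Finset (Fin n)} (W : Finset (Fin n)) (ha : Rep a A)
    (hb : Rep b B) :
    RunsFn 3 [encodeSet W, a, b] (encodeSet (W \ (A \ B))) (60 * (n + 1)) := by
  refine Runs.cast (runs_diff _ a b) ?_ le_rfl
  rw [encodeSet_eq]
  congr 1
  funext i
  rw [ha i, hb i]
  by_cases h1 : i ∈ W <;> by_cases h2 : i ∈ A <;> by_cases h3 : i ∈ B <;> simp [h1, h2, h3]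

/-- A bound for the running time of one expansion of a ball. -/
def ballCost (n : ℕ) : ℕ := (n + 1) * (40 * n + 300) + 40 * (n + 2) + 100

theorem runs_ball (W : Finset (Fin n)) {x : ℕ} (hx : x ≤ n + 1) (i : ℕ) :
    ∃ v, RunsFn 6 [rowsVal G, encodeSet W, .nat x, .nat i] v ((i + 1) * ballCost n) ∧
      Rep v (ballIn G W (pointSet n x) i) := by
  induction i with
  | zero =>
    exact ⟨_, Runs.cast (Runs.ifZero_zero (.arg 0 3) (.lit 0)) rfl (by unfold ballCost; omega),
      rep_empty⟩
  | succ i ih =>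
    obtain ⟨v, hv, hrep⟩ := ih
    refine ⟨_, Runs.cast (Runs.ifZero_succ (.arg 0 3) (.call (.cons (.arg 0 0) (.cons (.arg 0 1)
      (.cons (.call (.cons (.arg 0 0) (.cons (.arg 0 1) (.cons (.arg 0 2)
        (.cons (.sub (.arg 0 3) (.lit 1)) .nil)))) hv) (.cons (.call (.cons (.arg 0 2) .nil)
          (runs_unit x)) (.cons (.lit 1) .nil)))))
      (runs_threshold_set (rep_encodeSet W) hrep (rep_unit x) 1))) rfl ?_, ?_⟩
    · have e : (i + 1 + 1) * ballCost n = (i + 1) * ballCost n + ballCost n := Nat.succ_mul _ _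
      rw [e]
      conv_rhs => arg 2; unfold ballCost
      omega
    · have hset : (W ∪ pointSet n x).filter (fun v => 1 ≤ ((ballIn G W (pointSet n x) i).filter
          (G.Adj v)).card + if v ∈ pointSet n x then 1 else 0) =
          ballIn G W (pointSet n x) (i + 1) := by
        ext v
        rw [mem_ballIn_succ, Finset.mem_filter]
        refine and_congr_right fun _ => ?_
        by_cases hv : v ∈ pointSet n x
        · simp [hv]
        · simp only [hv, false_or, if_false, Nat.add_zero, Nat.one_le_iff_ne_zero, ne_eq,
            Finset.card_eq_zero, ← Finset.nonempty_iff_ne_empty]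
          simp [Finset.Nonempty]
      rw [← hset]
      exact rep_encodeSet _

end RandProg

/-! ### The auction -/

namespace RandProg

/-- The price of item `b` in the state `st` of the auction. -/
def price (st : Val) (b : ℕ) : ℕ := (st.get b).fst.toNat

/-- The code of the owner of item `b`: `0` if there is none, otherwise the owner plus one. -/
def code (st : Val) (b : ℕ) : ℕ := (st.get b).snd.toNat

/-- `st'` arises from `st` by the sale of item `i` to the bidder `a`. -/
structure Sale (st : Val) (i a : ℕ) (st' : Val) : Prop where
  price_self : price st' i = price st i + 1
  code_self : code st' i = a + 1
  price_ne : ∀ j, j ≠ i → price st' j = price st j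
  code_ne : ∀ j, j ≠ i → code st' j = code st j

/-- A bid fails if all items in the set with the indicator function `f` have a price above `lev`;
otherwise an item of price at most `lev` is sold. -/
theorem runs_bid {n : ℕ} (a lev : ℕ) (f : Fin n → ℕ) (st : Val) :
    ((∀ i, f i ≠ 0 → lev < price st i) ∧
      RunsFn 7 [.nat a, .nat lev, Val.natTab f, st] (.nat 0) (100 * (n + 1))) ∨
    ∃ i : Fin n, f i ≠ 0 ∧ price st i ≤ lev ∧ ∃ st', Sale st i a st' ∧
      RunsFn 7 [.nat a, .nat lev, Val.natTab f, st] (.pair (.nat (code st i)) st')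
        (100 * (n + 1)) := by
  induction n generalizing st with
  | zero =>
    exact .inl ⟨fun i => i.elim0, Runs.cast (Runs.ifPair_nat (.arg 0 2) (.lit 0)) rfl (by omega)⟩
  | succ n ih =>
    rw [Val.natTab_succ]
    have hflag : Runs prog [Val.ofList [.nat a, .nat lev,
        .pair (.nat (f 0)) (Val.natTab fun i => f i.succ), st]]
        (.ifZero (.fst (Expr.arg 0 2)) (.lit 1) (.sub (.fst (.fst (Expr.arg 0 3))) (Expr.arg 0 1)))
        (if f 0 = 0 then .nat 1 else .nat (price st 0 - lev)) 20 :=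
      Runs.cast (Runs.ifZero_nat (.fst (.arg 0 2)) (.lit 1)
        (.sub (.fst (.fst (.arg 0 3))) (.arg 0 1))) rfl (by omega)
    by_cases hadm : f 0 ≠ 0 ∧ price st 0 ≤ lev
    · rw [if_neg hadm.1, Nat.sub_eq_zero_of_le hadm.2] at hflag
      refine .inr ⟨0, hadm.1, hadm.2,
        .pair (.pair (.nat (price st 0 + 1)) (.nat (a + 1))) st.snd, ⟨rfl, rfl, ?_, ?_⟩, ?_⟩
      · intro j hj
        obtain ⟨j, rfl⟩ := Nat.exists_eq_succ_of_ne_zero hj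
        rfl
      · intro j hj
        obtain ⟨j, rfl⟩ := Nat.exists_eq_succ_of_ne_zero hj
        rfl
      · exact Runs.cast (Runs.ifPair_pair (.arg 0 2) (.ifZero_zero hflag
          (.pair (.add (.snd (.fst (.arg 0 3))) (.lit 0)) (.pair (.pair
            (.add (.fst (.fst (.arg 0 3))) (.lit 1)) (.add (.arg 0 0) (.lit 1)))
            (.snd (.arg 0 3)))))) rfl (by omega)
    · have hne : (if f 0 = 0 then Val.nat 1 else .nat (price st 0 - lev)) ≠ .nat 0 := by
        split_ifs with h
        · simp
        · have : ¬ price st 0 ≤ lev := fun h' => hadm ⟨h, h'⟩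
          simp only [ne_eq, Val.nat.injEq]
          omega
      rcases ih (fun i => f i.succ) st.snd with ⟨h1, h2⟩ | ⟨i, h1, h2, st', hs, h3⟩
      · refine .inl ⟨fun i => ?_, ?_⟩
        · cases i using Fin.cases with
          | zero => exact fun h => not_le.mp fun h' => hadm ⟨h, h'⟩
          | succ i => exact h1 i
        · exact Runs.cast (Runs.ifPair_pair (.arg 0 2) (.ifZero_ne hflag hne
            (.letIn (.call (.cons (.arg 0 0) (.cons (.arg 0 1) (.cons (.snd (.arg 0 2))
              (.cons (.snd (.arg 0 3)) .nil)))) h2) (.ifPair_nat (.var 0) (.lit 0))))) rfl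
            (by omega)
      · refine .inr ⟨i.succ, h1, h2, .pair st.fst st', ⟨hs.1, hs.2, ?_, ?_⟩, ?_⟩
        · intro j hj
          cases j with
          | zero => rfl
          | succ j => exact hs.3 j fun h => hj (by simp [h])
        · intro j hj
          cases j with
          | zero => rfl
          | succ j => exact hs.4 j fun h => hj (by simp [h])
        · exact Runs.cast (Runs.ifPair_pair (.arg 0 2) (.ifZero_ne hflag hne
            (.letIn (.call (.cons (.arg 0 0) (.cons (.arg 0 1) (.cons (.snd (.arg 0 2))
              (.cons (.snd (.arg 0 3)) .nil)))) h3) (.ifPair_pair (.var 0)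
              (.pair (.fst (.var 0)) (.pair (.fst (.arg 1 3)) (.snd (.var 0)))))))) rfl (by omega)

variable {n : ℕ} {G : SimpleGraph (Fin n)} {W M : Finset (Fin n)} {cap : ℕ} {st st' : Val}

/-- The invariant of the auction on the bipartite double cover of `G[W]`, in which every vertex is
both a bidder and an item, and bids for its neighbours: `M` is the set of the bidders that own an
item, and every owner has paid at most one unit more than the least price of the items it is
interested in. -/
structure Auction (G : SimpleGraph (Fin n)) (W : Finset (Fin n)) (cap : ℕ) (st : Val)
    (M : Finset (Fin n)) : Prop where
  price_of_free : ∀ b : Fin n, code st b = 0 → price st b = 0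
  owner : ∀ a b : Fin n, code st b = a + 1 → a ∈ M ∧ G.Adj a b ∧ b ∈ W ∧
    ∀ b' ∈ W, G.Adj a b' → price st b ≤ price st b' + 1
  code_le : ∀ b : Fin n, code st b ≤ n
  inj : ∀ b b' : Fin n, code st b = code st b' → code st b ≠ 0 → b = b'
  surj : ∀ a ∈ M, ∃ b : Fin n, code st b = a + 1
  le_cap : ∀ b : Fin n, price st b ≤ cap

theorem Sale.price_le {i a : ℕ} (h : Sale st i a st') (j : ℕ) : price st j ≤ price st' j := by
  by_cases hj : j = i
  · subst hj; rw [h.price_self]; omega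
  · rw [h.price_ne j hj]

theorem auction_start (cap : ℕ) : Auction G W cap (.nat 0) ∅ := by
  have hc : ∀ b, code (.nat 0) b = 0 := fun b => by rw [code, Val.get_nat_zero]; rfl
  have hp : ∀ b, price (.nat 0) b = 0 := fun b => by rw [price, Val.get_nat_zero]; rfl
  exact ⟨fun b _ => hp b, fun a b h => by rw [hc] at h; omega, fun b => by rw [hc]; omega,
    fun b b' _ h => absurd (hc b) h, by simp, fun b => by rw [hp]; omega⟩

/-- A sale preserves the invariant, provided that no item of interest to the bidder `a` has a price
below the level `lev`. The previous owner of the item, if any, leaves the set of owners. -/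
theorem Auction.sale (h : Auction G W cap st M) {a i : Fin n} {lev : ℕ} (ha : a ∉ M)
    (hlev : ∀ b ∈ W, G.Adj a b → lev ≤ price st b) (hcap : lev < cap) (hi : i ∈ W)
    (hai : G.Adj a i) (hprice : price st i ≤ lev) (hs : Sale st i a st') :
    Auction G W cap st' ((insert a M).filter fun x => code st i ≠ x + 1) := by
  have hne : ∀ {b : Fin n}, b ≠ i → (b : ℕ) ≠ i := fun hb h => hb (Fin.ext h)
  constructor
  · intro b hb
    by_cases hbi : b = i
    · subst hbi; rw [hs.code_self] at hb; omega
    · rw [hs.code_ne _ (hne hbi)] at hb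
      rw [hs.price_ne _ (hne hbi)]
      exact h.price_of_free b hb
  · intro x b hb
    by_cases hbi : b = i
    · subst hbi
      rw [hs.code_self] at hb
      obtain rfl : a = x := Fin.ext (by omega)
      refine ⟨?_, hai, hi, fun b' hb' hab' => ?_⟩
      · rw [Finset.mem_filter]
        exact ⟨Finset.mem_insert_self _ _, fun hc => ha (h.owner _ _ hc).1⟩
      · rw [hs.price_self]
        have := hlev b' hb' hab'
        have := hs.price_le b'
        omega
    · rw [hs.code_ne _ (hne hbi)] at hb
      obtain ⟨h1, h2, h3, h4⟩ := h.owner x b hb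
      refine ⟨?_, h2, h3, fun b' hb' hab' => ?_⟩
      · rw [Finset.mem_filter]
        exact ⟨Finset.mem_insert_of_mem h1, fun hc =>
          hbi (h.inj b i (hb.trans hc.symm) (by omega))⟩
      · rw [hs.price_ne _ (hne hbi)]
        have := h4 b' hb' hab'
        have := hs.price_le b'
        omega
  · intro b
    by_cases hbi : b = i
    · subst hbi; rw [hs.code_self]; omega
    · rw [hs.code_ne _ (hne hbi)]; exact h.code_le b
  · have key : ∀ b : Fin n, b ≠ i → code st' b ≠ a + 1 := by
      intro b hbi hb
      rw [hs.code_ne _ (hne hbi)] at hb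
      exact ha (h.owner a b hb).1
    intro b b' hbb hb0
    by_cases hbi : b = i <;> by_cases hbi' : b' = i
    · rw [hbi, hbi']
    · subst hbi
      exact absurd (hbb.symm.trans hs.code_self) (key b' hbi')
    · subst hbi'
      exact absurd (hbb.trans hs.code_self) (key b hbi)
    · rw [hs.code_ne _ (hne hbi)] at hbb hb0
      rw [hs.code_ne _ (hne hbi')] at hbb
      exact h.inj b b' hbb hb0
  · intro x hx
    rw [Finset.mem_filter, Finset.mem_insert] at hx
    rcases hx.1 with rfl | hxM
    · exact ⟨i, hs.code_self⟩
    · obtain ⟨b, hb⟩ := h.surj x hxM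
      have hbi : b ≠ i := fun hbi => hx.2 (hbi ▸ hb)
      exact ⟨b, (hs.code_ne _ (hne hbi)).trans hb⟩
  · intro b
    by_cases hbi : b = i
    · subst hbi; rw [hs.price_self]; omega
    · rw [hs.price_ne _ (hne hbi)]; exact h.le_cap b

/-- The amount by which prices can still rise. -/
def slack (n cap : ℕ) (st : Val) : ℕ := ∑ b : Fin n, (cap - price st b)

theorem Sale.slack_lt {i : Fin n} {a : ℕ} (h : Sale st i a st') (hi : price st i < cap) :
    slack n cap st' < slack n cap st := by
  refine Finset.sum_lt_sum (fun b _ => ?_) ⟨i, Finset.mem_univ _, ?_⟩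
  · have := h.price_le b; omega
  · rw [h.price_self]; omega

/-- A bound for the running time of one round of the auction. -/
def roundCost (n : ℕ) : ℕ := 200 * (n + 1) + 300

/-- The entrance of the bidder `a`, which may expel a chain of other bidders. The set `A` of those
that give up has at most one element. The number of rounds is bounded by `N`, because in each round
a price rises, or no price changes and the level of the current bidder rises. -/
theorem runs_insert [DecidableRel G.Adj] (N : ℕ) : ∀ (a : Fin n) (lev : ℕ) (st : Val)
    (M : Finset (Fin n)), slack n cap st * (cap + 1) + (cap - lev) ≤ N → Auction G W cap st M →
    a ∉ M → lev ≤ cap → (∀ b ∈ W, G.Adj a b → lev ≤ price st b) →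
    ∃ (st' : Val) (A : Finset (Fin n)), A ⊆ insert a M ∧
      RunsFn 8 [rowsVal G, .nat cap, encodeSet W, .nat a, .nat lev, st] (.pair (.nat A.card) st')
        ((N + 1) * roundCost n) ∧
      Auction G W cap st' (insert a M \ A) ∧
      (∀ x ∈ A, ∀ b ∈ W, G.Adj x b → cap ≤ price st' b) ∧
      ∀ b : Fin n, price st b ≤ price st' b := by
  induction N with
  | zero =>
    intro a lev st M hN h ha hlc hlev
    have hcap : cap - lev = 0 := by omega
    refine ⟨st, {a}, by simp, ?_, ?_, ?_, fun _ => le_rfl⟩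
    · exact Runs.cast (Runs.ifZero_zero (Runs.cast (.sub (.arg 0 1) (.arg 0 4))
        (congrArg Val.nat hcap) le_rfl) (.pair (.lit 1) (.arg 0 5))) rfl
        (by unfold roundCost; omega)
    · rwa [Finset.insert_sdiff_of_mem _ (Finset.mem_singleton_self a),
        Finset.sdiff_singleton_eq_erase, Finset.erase_eq_of_notMem ha]
    · intro x hx b hb hxb
      rw [Finset.mem_singleton] at hx
      subst hx
      have := hlev b hb hxb
      omega
  | succ N ih =>
    intro a lev st M hN h ha hlc hlev
    by_cases hcap : cap - lev = 0
    · refine ⟨st, {a}, by simp, ?_, ?_, ?_, fun _ => le_rfl⟩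
      · exact Runs.cast (Runs.ifZero_zero (Runs.cast (.sub (.arg 0 1) (.arg 0 4))
          (congrArg Val.nat hcap) le_rfl) (.pair (.lit 1) (.arg 0 5))) rfl
          (by unfold roundCost; nlinarith)
      · rwa [Finset.insert_sdiff_of_mem _ (Finset.mem_singleton_self a),
          Finset.sdiff_singleton_eq_erase, Finset.erase_eq_of_notMem ha]
      · intro x hx b hb hxb
        rw [Finset.mem_singleton] at hx
        subst hx
        have := hlev b hb hxb
        omega
    set row : Fin n → ℕ := fun j => if G.Adj a j then 1 else 0 with hrow
    have hnth : RunsFn 4 [rowsVal G, .nat a] (Val.natTab row) (40 * (n + 1)) :=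
      Runs.cast (runs_nth _ _) (Val.get_tab _ a) (by have := a.2; omega)
    set f : Fin n → ℕ := fun j => row j -
      (((Val.natTab row).get j).toNat - ((encodeSet W).get j).toNat) with hf
    have hf0 : ∀ j, f j ≠ 0 ↔ G.Adj a j ∧ j ∈ W := by
      intro j
      have e1 : ((Val.natTab row).get j).toNat = row j := by rw [Val.natTab, Val.get_tab]; rfl
      rw [hf]
      simp only
      rw [e1, rep_encodeSet W j]
      by_cases h1 : G.Adj a j <;> by_cases h2 : j ∈ W <;> simp [hrow, h1, h2]
    have hstep : (N + 1 + 1) * roundCost n = (N + 1) * roundCost n + roundCost n :=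
      Nat.succ_mul _ _
    have hrc : roundCost n = 200 * (n + 1) + 300 := rfl
    rcases runs_bid a lev f st with ⟨h1, h2⟩ | ⟨i, h1, h2, st₁, hs, h3⟩
    · obtain ⟨st', A, hA, hr, hauc, hab, hmono⟩ := ih a (lev + 1) st M (by omega) h ha (by omega)
        (fun b hb hab => h1 b ((hf0 b).mpr ⟨hab, hb⟩))
      refine ⟨st', A, hA, ?_, hauc, hab, hmono⟩
      exact Runs.cast (Runs.ifZero_ne (.sub (.arg 0 1) (.arg 0 4))
        (fun h => hcap (Val.nat.inj h)) (.letIn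
          (.call (.cons (.arg 0 0) (.cons (.arg 0 3) .nil)) hnth)
          (.letIn (.call (.cons (.arg 1 3) (.cons (.arg 1 4) (.cons (.call (.cons (.var 0)
            (.cons (.var 0) (.cons (.arg 1 2) .nil))) (runs_diff row _ _))
            (.cons (.arg 1 5) .nil)))) h2) (.ifPair_nat (.var 0)
              (.call (.cons (.arg 2 0) (.cons (.arg 2 1) (.cons (.arg 2 2)
              (.cons (.arg 2 3) (.cons (.add (.arg 2 4) (.lit 1)) (.cons (.arg 2 5) .nil))))))
              hr))))) rfl (by omega)
    · have hiW := (hf0 i).mp h1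
      have hsale := h.sale ha hlev (by omega) hiW.2 hiW.1 h2 hs
      have hslack := hs.slack_lt (cap := cap) (i := i) (by omega)
      have hslack' : slack n cap st₁ * (cap + 1) + (cap + 1) ≤ slack n cap st * (cap + 1) := by
        rw [← Nat.succ_mul]
        exact Nat.mul_le_mul_right _ hslack
      by_cases hfree : code st i = 0
      · refine ⟨st₁, ∅, by simp, ?_, ?_, by simp, fun b => hs.price_le b⟩
        · rw [hfree] at h3
          exact Runs.cast (Runs.ifZero_ne (.sub (.arg 0 1) (.arg 0 4))
            (fun h => hcap (Val.nat.inj h)) (.letIn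
          (.call (.cons (.arg 0 0) (.cons (.arg 0 3) .nil)) hnth)
              (.letIn (.call (.cons (.arg 1 3) (.cons (.arg 1 4) (.cons (.call (.cons (.var 0)
                (.cons (.var 0) (.cons (.arg 1 2) .nil))) (runs_diff row _ _))
                (.cons (.arg 1 5) .nil)))) h3) (.ifPair_pair (.var 0) (.ifZero_zero (.fst (.var 0))
                (.pair (.lit 0) (.snd (.var 0)))))))) rfl (by omega)
        · have e : ((insert a M).filter fun x : Fin n => code st i ≠ x + 1) = insert a M \ ∅ := by
            rw [Finset.sdiff_empty]
            exact Finset.filter_true_of_mem fun x _ => by omega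
          rwa [e] at hsale
      · obtain ⟨m, hm⟩ := Nat.exists_eq_succ_of_ne_zero hfree
        have hmn : m < n := by have := h.code_le i; omega
        set x : Fin n := ⟨m, hmn⟩ with hx
        have hxM : x ∈ M := (h.owner x i hm).1
        have e : ((insert a M).filter fun y : Fin n => code st i ≠ y + 1) =
            (insert a M).erase x := by
          ext y
          rw [Finset.mem_filter, Finset.mem_erase, hm, and_comm]
          refine and_congr_left fun _ => not_congr ⟨fun h => Fin.ext ?_, fun h => ?_⟩
          · simp only [hx]; omega
          · simp [h, hx]
        rw [e] at hsale
        obtain ⟨st', A, hA, hr, hauc, hab, hmono⟩ := ih x 0 st₁ ((insert a M).erase x) (by omega)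
          hsale (by simp) (by omega) (fun _ _ _ => by omega)
        rw [Finset.insert_erase (Finset.mem_insert_of_mem hxM)] at hA hauc
        refine ⟨st', A, hA, ?_, hauc, hab, fun b => (hs.price_le b).trans (hmono b)⟩
        rw [hm] at h3
        exact Runs.cast (Runs.ifZero_ne (.sub (.arg 0 1) (.arg 0 4))
          (fun h => hcap (Val.nat.inj h)) (.letIn
          (.call (.cons (.arg 0 0) (.cons (.arg 0 3) .nil)) hnth)
            (.letIn (.call (.cons (.arg 1 3) (.cons (.arg 1 4) (.cons (.call (.cons (.var 0)
              (.cons (.var 0) (.cons (.arg 1 2) .nil))) (runs_diff row _ _))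
              (.cons (.arg 1 5) .nil)))) h3) (.ifPair_pair (.var 0) (.ifZero_succ (.fst (.var 0))
              (.call (.cons (.arg 2 0) (.cons (.arg 2 1) (.cons (.arg 2 2)
                (.cons (.sub (.fst (.var 0)) (.lit 1)) (.cons (.lit 0)
                  (.cons (.snd (.var 0)) .nil)))))) hr)))))) rfl (by omega)

end RandProg

/-! ### The value of the auction -/

namespace RandProg

variable {n : ℕ} {G : SimpleGraph (Fin n)} {W M A : Finset (Fin n)} {cap : ℕ} {st : Val}

/-- The bidders in `A` gave up: all items they are interested in have the maximal price. -/
def GaveUp (G : SimpleGraph (Fin n)) (W : Finset (Fin n)) (cap : ℕ) (st : Val)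
    (A : Finset (Fin n)) : Prop :=
  ∀ x ∈ A, ∀ b ∈ W, G.Adj x b → cap ≤ price st b

/-- Every owner in an independent set excludes the vertex it owns. -/
theorem Auction.two_mul_card_le (h : Auction G W cap st M) (hMA : M ∪ A = W)
    {S : Finset (Fin n)} (hSW : S ⊆ W) (hS : G.IsIndepSet (S : Set (Fin n))) :
    2 * S.card ≤ W.card + A.card := by
  choose! item hitem using h.surj
  have h1 : (S \ A).card ≤ (W \ S).card := by
    refine Finset.card_le_card_of_injOn item ?_ ?_
    · intro x hx
      simp only [Finset.coe_sdiff, Set.mem_sdiff, Finset.mem_coe] at hx ⊢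
      have hxM : x ∈ M := by
        have := hSW hx.1
        rw [← hMA, Finset.mem_union] at this
        exact this.resolve_right hx.2
      obtain ⟨-, hadj, hW, -⟩ := h.owner _ _ (hitem x hxM)
      exact ⟨hW, fun hi => hS hx.1 hi hadj.ne hadj⟩
    · intro x hx y hy hxy
      simp only [Finset.coe_sdiff, Set.mem_sdiff, Finset.mem_coe] at hx hy
      have hM : ∀ z, z ∈ S ∧ z ∉ A → z ∈ M := by
        intro z hz
        have := hSW hz.1
        rw [← hMA, Finset.mem_union] at this
        exact this.resolve_right hz.2
      have e1 := hitem x (hM x hx)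
      have e2 := hitem y (hM y hy)
      rw [hxy, e2] at e1
      exact Fin.ext (by omega)
  have h2 := Finset.card_sdiff_add_card_eq_card hSW
  have h3 := Finset.le_card_sdiff A S
  omega

/-- Some price strictly between `0` and `cap` does not occur. The items below it, together with the
bidders all of whose items are above it, form an independent set in the bipartite double cover of
`G[W]` of size `|W| + |A|`. If `G[W]` is bipartite, the double cover consists of two copies of
`G[W]`. -/
theorem Auction.exists_indep (h : Auction G W (n + 2) st M) (hMA : M ∪ A = W)
    (hdisj : Disjoint M A) (hA : GaveUp G W (n + 2) st A) (hb : Bip G W) :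
    ∃ S ⊆ W, G.IsIndepSet (S : Set (Fin n)) ∧ W.card + A.card ≤ 2 * S.card := by
  classical
  obtain ⟨t, ht1, htn, ht⟩ : ∃ t, 1 ≤ t ∧ t ≤ n + 1 ∧ ∀ b : Fin n, price st b ≠ t := by
    by_contra! hcon
    have h1 : Finset.Icc 1 (n + 1) ⊆ Finset.univ.image fun b : Fin n => price st b := by
      intro t ht
      rw [Finset.mem_Icc] at ht
      obtain ⟨b, hb⟩ := hcon t ht.1 ht.2
      exact Finset.mem_image.mpr ⟨b, Finset.mem_univ _, hb⟩
    have h2 := (Finset.card_le_card h1).trans Finset.card_image_le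
    simp at h2
  set Hi := W.filter fun b : Fin n => t < price st b with hHi
  set Y := W.filter fun b : Fin n => ¬ t < price st b with hY
  set X := W.filter fun a => ∀ b ∈ W, G.Adj a b → t < price st b with hX
  have hXA : A ⊆ X := by
    intro x hx
    rw [hX, Finset.mem_filter]
    refine ⟨hMA ▸ Finset.mem_union_right _ hx, fun b hb hxb => ?_⟩
    have := hA x hx b hb hxb
    omega
  have hcard : Hi.card ≤ (X \ A).card := by
    have hown : ∀ b : Fin n, b ∈ Hi → ∃ a : Fin n, code st b = a + 1 := by
      intro b hb
      rw [hHi, Finset.mem_filter] at hb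
      have h0 : code st b ≠ 0 := fun h0 => by
        have := h.price_of_free b h0
        omega
      have := h.code_le b
      exact ⟨⟨code st b - 1, by omega⟩, by simp only; omega⟩
    choose! own hown using hown
    refine Finset.card_le_card_of_injOn own ?_ ?_
    · intro b hb
      rw [Finset.mem_coe] at hb
      obtain ⟨h1, h2, h3, h4⟩ := h.owner _ _ (hown b hb)
      rw [hHi, Finset.mem_filter] at hb
      rw [Finset.mem_coe, Finset.mem_sdiff, hX, Finset.mem_filter]
      refine ⟨⟨hMA ▸ Finset.mem_union_left _ h1, fun b' hb' hab' => ?_⟩,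
        Finset.disjoint_left.mp hdisj h1⟩
      have := h4 b' hb' hab'
      have := ht b'
      omega
    · intro b hb b' hb' hbb
      rw [Finset.mem_coe] at hb hb'
      have e1 := hown b hb
      have e2 := hown b' hb'
      exact h.inj b b' (by rw [e1, e2, hbb]) (by omega)
  have hXY : ∀ a ∈ X, ∀ b ∈ Y, ¬ G.Adj a b := by
    intro a ha b hb hab
    rw [hX, Finset.mem_filter] at ha
    rw [hY, Finset.mem_filter] at hb
    exact hb.2 (ha.2 b hb.1 hab)
  have hXW : X ⊆ W := Finset.filter_subset _ _
  have hYW : Y ⊆ W := Finset.filter_subset _ _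
  obtain ⟨col, hcol⟩ := hb
  have key : ∀ c : Bool, ∃ S ⊆ W, G.IsIndepSet (S : Set (Fin n)) ∧
      S.card = (X.filter fun v => col v = c).card + (Y.filter fun v => ¬ col v = c).card := by
    intro c
    refine ⟨(X.filter fun v => col v = c) ∪ Y.filter fun v => ¬ col v = c,
      Finset.union_subset ((Finset.filter_subset _ _).trans hXW)
        ((Finset.filter_subset _ _).trans hYW), ?_, Finset.card_union_of_disjoint ?_⟩
    · intro u hu v hv _ huv
      simp only [Finset.coe_union, Finset.coe_filter, Set.mem_union, Set.mem_ofPred_eq] at hu hv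
      rcases hu with hu | hu <;> rcases hv with hv | hv
      · exact hcol u (hXW hu.1) v (hXW hv.1) huv (hu.2.trans hv.2.symm)
      · exact hXY u hu.1 v hv.1 huv
      · exact hXY v hv.1 u hu.1 huv.symm
      · refine hcol u (hYW hu.1) v (hYW hv.1) huv ?_
        have h1 := hu.2
        have h2 := hv.2
        revert h1 h2
        cases col u <;> cases col v <;> cases c <;> simp
    · rw [Finset.disjoint_left]
      intro v hv hv'
      exact (Finset.mem_filter.mp hv').2 (Finset.mem_filter.mp hv).2
  obtain ⟨S₁, hS₁, hi₁, hc₁⟩ := key true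
  obtain ⟨S₂, hS₂, hi₂, hc₂⟩ := key false
  have e1 := Finset.card_filter_add_card_filter_not (s := X) (fun v => col v = true)
  have e2 := Finset.card_filter_add_card_filter_not (s := Y) (fun v => col v = true)
  have e3 : Hi.card + Y.card = W.card := Finset.card_filter_add_card_filter_not _
  have e4 := Finset.card_sdiff_add_card_eq_card hXA
  simp only [Bool.not_eq_true, Bool.not_eq_false] at e1 e2 hc₁ hc₂
  by_cases hle : S₁.card ≤ S₂.card
  · exact ⟨S₂, hS₂, hi₂, by omega⟩
  · exact ⟨S₁, hS₁, hi₁, by omega⟩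

/-- A bound for the running time of the entrance of one bidder. -/
def bidderCost (n : ℕ) : ℕ :=
  (n * (n + 2) * (n + 3) + (n + 2) + 1) * roundCost n + 40 * (n + 1) + 200

theorem slack_le (n cap : ℕ) (st : Val) : slack n cap st ≤ n * cap := by
  refine (Finset.sum_le_card_nsmul _ _ cap fun b _ => Nat.sub_le _ _).trans ?_
  simp

/-- The bidders less than `i` enter the auction in decreasing order, after the larger ones have
entered. -/
theorem runs_value_aux [DecidableRel G.Adj] (i : ℕ) : i ≤ n → ∀ (st : Val) (M A : Finset (Fin n)),
    Auction G W (n + 2) st M → Disjoint M A → (M ∪ A = W.filter fun v : Fin n => i ≤ v) →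
    GaveUp G W (n + 2) st A →
    ∃ (st' : Val) (M' A' : Finset (Fin n)) (r : ℕ), Auction G W (n + 2) st' M' ∧ Disjoint M' A' ∧
      M' ∪ A' = W ∧ GaveUp G W (n + 2) st' A' ∧
      RunsFn 9 [rowsVal G, .nat (n + 2), encodeSet W, .nat i, st] (.nat r)
        ((i + 1) * bidderCost n) ∧
      r + A.card = (W.filter fun v : Fin n => (v : ℕ) < i).card + A'.card := by
  have hbc : bidderCost n =
    (n * (n + 2) * (n + 3) + (n + 2) + 1) * roundCost n + 40 * (n + 1) + 200 := rfl
  induction i with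
  | zero =>
    intro _ st M A h hd hMA hA
    refine ⟨st, M, A, 0, h, hd, by simpa using hMA, hA, ?_, by simp⟩
    exact Runs.cast (Runs.ifZero_zero (.arg 0 3) (.lit 0)) rfl (by omega)
  | succ i ih =>
    intro hi st M A h hd hMA hA
    set a : Fin n := ⟨i, by omega⟩ with ha
    have hnth := runs_nth (encodeSet W) i
    have hget : (encodeSet W).get i = .nat (if a ∈ W then 1 else 0) := by
      have := Val.get_tab (fun i => Val.nat (if i ∈ W then 1 else 0)) a
      exact this
    rw [hget] at hnth
    have hstep : (i + 1 + 1) * bidderCost n = (i + 1) * bidderCost n + bidderCost n :=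
      Nat.succ_mul _ _
    have hval : ∀ v : Fin n, v ≠ a → (v : ℕ) ≠ i := fun v hv hvi => hv (Fin.ext hvi)
    by_cases haW : a ∈ W
    · rw [if_pos haW] at hnth
      have haMA : a ∉ M ∪ A := by rw [hMA]; simp [ha]
      rw [Finset.mem_union, not_or] at haMA
      obtain ⟨st₁, B, hB, hr₁, hauc, hgave, hmono⟩ := runs_insert (G := G) (W := W) (cap := n + 2)
        (n * (n + 2) * (n + 3) + (n + 2)) a 0 st M
        (Nat.add_le_add (Nat.mul_le_mul_right _ (slack_le _ _ _)) (Nat.sub_le _ _)) h haMA.1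
        (by omega) (fun _ _ _ => Nat.zero_le _)
      have hBA : Disjoint A B := by
        rw [Finset.disjoint_left]
        intro x hx hxB
        rcases Finset.mem_insert.mp (hB hxB) with rfl | hxM
        · exact haMA.2 hx
        · exact Finset.disjoint_left.mp hd hxM hx
      obtain ⟨st', M', A', r, h1, h2, h3, h4, h5, h6⟩ := ih (by omega) st₁ (insert a M \ B) (A ∪ B)
        hauc (by
          rw [Finset.disjoint_left]
          intro x hx hxAB
          rw [Finset.mem_sdiff, Finset.mem_insert] at hx
          rcases Finset.mem_union.mp hxAB with hxA | hxB
          · rcases hx.1 with rfl | hxM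
            · exact haMA.2 hxA
            · exact Finset.disjoint_left.mp hd hxM hxA
          · exact hx.2 hxB)
        (by
          have e : insert a M \ B ∪ (A ∪ B) = insert a (M ∪ A) := by
            ext x
            have := @hB x
            simp only [Finset.mem_union, Finset.mem_sdiff, Finset.mem_insert] at this ⊢
            tauto
          rw [e, hMA]
          ext x
          simp only [Finset.mem_insert, Finset.mem_filter]
          by_cases hx : x = a
          · subst hx; exact iff_of_true (.inl rfl) ⟨haW, le_rfl⟩
          · have := hval x hx
            simp only [hx, false_or]
            exact and_congr_right fun _ => by omega)
        (by
          intro x hx b hb hxb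
          rcases Finset.mem_union.mp hx with hx | hx
          · exact (hA x hx b hb hxb).trans (hmono b)
          · exact hgave x hx b hb hxb)
      refine ⟨st', M', A', 1 + B.card + r, h1, h2, h3, h4, ?_, ?_⟩
      · exact Runs.cast (Runs.ifZero_succ (.arg 0 3) (.letIn (.sub (.arg 0 3) (.lit 1))
          (.ifZero_succ (.call (.cons (.arg 1 2) (.cons (.var 0) .nil)) hnth)
            (.letIn (.call (.cons (.arg 1 0) (.cons (.arg 1 1) (.cons (.arg 1 2) (.cons (.var 0)
              (.cons (.lit 0) (.cons (.arg 1 4) .nil)))))) hr₁)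
              (.add (.add (.lit 1) (.fst (.var 0))) (.call (.cons (.arg 2 0) (.cons (.arg 2 1)
                (.cons (.arg 2 2) (.cons (.var 1) (.cons (.snd (.var 0)) .nil))))) h5)))))) rfl
          (by omega)
      · rw [Finset.card_union_of_disjoint hBA] at h6
        have e : (W.filter fun v : Fin n => (v : ℕ) < i + 1) =
            insert a (W.filter fun v : Fin n => (v : ℕ) < i) := by
          ext x
          simp only [Finset.mem_insert, Finset.mem_filter]
          by_cases hx : x = a
          · subst hx; exact iff_of_true ⟨haW, Nat.lt_succ_self _⟩ (.inl rfl)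
          · have := hval x hx
            simp only [hx, false_or]
            exact and_congr_right fun _ => by omega
        rw [e, Finset.card_insert_of_notMem (by simp [ha])]
        omega
    · rw [if_neg haW] at hnth
      have hx : ∀ x ∈ W, x ≠ a := fun x hx h => haW (h ▸ hx)
      obtain ⟨st', M', A', r, h1, h2, h3, h4, h5, h6⟩ := ih (by omega) st M A h hd (by
        rw [hMA]
        exact Finset.filter_congr fun x hxW => by have := hval x (hx x hxW); omega) hA
      refine ⟨st', M', A', r, h1, h2, h3, h4, ?_, ?_⟩
      · exact Runs.cast (Runs.ifZero_succ (.arg 0 3) (.letIn (.sub (.arg 0 3) (.lit 1))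
          (.ifZero_zero (.call (.cons (.arg 1 2) (.cons (.var 0) .nil)) hnth)
            (.call (.cons (.arg 1 0) (.cons (.arg 1 1) (.cons (.arg 1 2) (.cons (.var 0)
              (.cons (.arg 1 4) .nil))))) h5)))) rfl
          (by omega)
      · rw [h6]
        congr 2
        exact Finset.filter_congr fun x hxW => by have := hval x (hx x hxW); omega

/-- The auction computes an upper bound for twice the independence number of `G[W]`, which is
attained if `G[W]` is bipartite. -/
theorem runs_value [DecidableRel G.Adj] (W : Finset (Fin n)) :
    ∃ r, RunsFn 9 [rowsVal G, .nat (n + 2), encodeSet W, .nat n, .nat 0] (.nat r)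
        ((n + 1) * bidderCost n) ∧
      (∀ S ⊆ W, G.IsIndepSet (S : Set (Fin n)) → 2 * S.card ≤ r) ∧
      (Bip G W → ∃ S ⊆ W, G.IsIndepSet (S : Set (Fin n)) ∧ r ≤ 2 * S.card) := by
  obtain ⟨st, M, A, r, h1, h2, h3, h4, h5, h6⟩ := runs_value_aux (G := G) (W := W) n le_rfl (.nat 0)
    ∅ ∅ (auction_start _) (by simp) (by
      rw [Finset.empty_union, eq_comm, Finset.filter_eq_empty_iff]
      intro x _
      have := x.2
      omega) (by intro x hx; simp at hx)
  have h7 : (W.filter fun v : Fin n => (v : ℕ) < n) = W := Finset.filter_true_of_mem fun x _ => x.2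
  rw [h7, Finset.card_empty, Nat.add_zero] at h6
  refine ⟨r, h5, fun S hS hi => ?_, fun hb => ?_⟩
  · rw [h6]; exact h1.two_mul_card_le h3 hS hi
  · rw [h6]; exact h1.exists_indep h3 h2 h4 hb

end RandProg

/-! ### Solving the bipartite case, and the search -/

namespace RandProg

variable {n : ℕ} {G : SimpleGraph (Fin n)}

/-- The part of the indicator list of `S` that starts at position `v`. -/
def suffixVal (v : ℕ) (S : Finset (Fin n)) : Val :=
  Val.ofList (((List.finRange n).drop v).map fun i => .nat (if i ∈ S then 1 else 0))

theorem suffixVal_zero (S : Finset (Fin n)) : suffixVal 0 S = encodeSet S := by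
  rw [suffixVal, encodeSet, List.drop_zero, List.ofFn_eq_map]

theorem suffixVal_length (S : Finset (Fin n)) : suffixVal n S = .nat 0 := by
  rw [suffixVal, List.drop_eq_nil_of_le (by simp)]; rfl

theorem suffixVal_succ (v : Fin n) (S : Finset (Fin n)) :
    suffixVal v S = .pair (.nat (if v ∈ S then 1 else 0)) (suffixVal (v + 1) S) := by
  rw [suffixVal, List.drop_eq_getElem_cons (by simp), List.map_cons, Val.ofList,
    List.getElem_finRange]
  rfl

theorem suffixVal_insert {v : ℕ} {x : Fin n} (hx : (x : ℕ) < v) (S : Finset (Fin n)) :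
    suffixVal v (insert x S) = suffixVal v S := by
  rw [suffixVal, suffixVal]
  congr 1
  refine List.map_congr_left fun i hi => ?_
  obtain ⟨j, hj, rfl⟩ := List.mem_iff_getElem.mp hi
  have hne : ((List.finRange n).drop v)[j] ≠ x := by
    intro h
    have := congrArg Fin.val h
    simp at this
    omega
  simp only [Finset.mem_insert, hne, false_or]

theorem rep_natTab {f : Fin n → ℕ} {S : Finset (Fin n)} (h : ∀ i, f i = if i ∈ S then 1 else 0) :
    Rep (Val.natTab f) S := fun i => by rw [Val.natTab, Val.get_tab, ← h]; rfl

/-- A bound for the running time of one step of the greedy choice. -/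
def greedyCost (n : ℕ) : ℕ := 2 * ((n + 1) * bidderCost n) + 300 * (n + 1) + 500

/-- The greedy choice, guided by the values computed by the auction, yields an independent set,
which is a maximum one if `G[W]` is bipartite. -/
theorem runs_solve [DecidableRel G.Adj] (j : ℕ) : ∀ (v : ℕ) (W : Finset (Fin n)), v + j = n →
    (∀ x ∈ W, v ≤ (x : ℕ)) → ∃ S ⊆ W, G.IsIndepSet (S : Set (Fin n)) ∧
      RunsFn 10 [rowsVal G, .nat n, encodeSet W, .nat v] (suffixVal v S)
        ((j + 1) * greedyCost n) ∧
      (Bip G W → ∀ T ⊆ W, G.IsIndepSet (T : Set (Fin n)) → T.card ≤ S.card) := by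
  have hgc : greedyCost n = 2 * ((n + 1) * bidderCost n) + 300 * (n + 1) + 500 := rfl
  induction j with
  | zero =>
    intro v W hv hW
    obtain rfl : v = n := hv
    have hW0 : W = ∅ := Finset.eq_empty_of_forall_notMem fun x hx => by
      have := hW x hx; have := x.2; omega
    refine ⟨∅, by simp, by simp, ?_, fun _ T hT _ => by
      rw [hW0] at hT; exact Finset.card_le_card hT⟩
    rw [suffixVal_length]
    exact Runs.cast (Runs.ifZero_zero (Runs.cast (.sub (.arg 0 1) (.arg 0 3))
      (congrArg Val.nat (Nat.sub_self v)) le_rfl) (.lit 0)) rfl (by omega)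
  | succ j ih =>
    intro v W hv hW
    set a : Fin n := ⟨v, by omega⟩ with ha
    have hsuf := fun S : Finset (Fin n) => suffixVal_succ a S
    have hnth := runs_nth (encodeSet W) v
    have hget : (encodeSet W).get v = .nat (if a ∈ W then 1 else 0) :=
      Val.get_tab (fun i => Val.nat (if i ∈ W then 1 else 0)) a
    rw [hget] at hnth
    have hstep : (j + 1 + 1) * greedyCost n = (j + 1) * greedyCost n + greedyCost n :=
      Nat.succ_mul _ _
    have hnv : ∃ m, n - v = m + 1 := ⟨n - v - 1, by omega⟩
    obtain ⟨m, hm⟩ := hnv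
    have hval : ∀ x : Fin n, v ≤ (x : ℕ) → x ≠ a → v + 1 ≤ (x : ℕ) := by
      intro x hx hne
      have : (x : ℕ) ≠ v := fun h => hne (Fin.ext h)
      omega
    by_cases haW : a ∈ W
    · rw [if_pos haW] at hnth
      set row : Fin n → ℕ := fun i => if G.Adj a i then 1 else 0 with hrow
      have hnth' : RunsFn 4 [rowsVal G, .nat v] (Val.natTab row) (40 * (v + 1)) :=
        Runs.cast (runs_nth _ _) (Val.get_tab _ a) le_rfl
      have hrowrep : Rep (Val.natTab row) (Finset.univ.filter (G.Adj a)) :=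
        rep_natTab fun i => by simp [hrow]
      set Wd := W \ (pointSet n v \ ∅) with hWd
      set W₁ := Wd \ (Finset.univ.filter (G.Adj a) \ ∅) with hW₁
      have hmemd : ∀ x, x ∈ Wd ↔ x ∈ W ∧ x ≠ a := by
        intro x
        simp [hWd, pointSet, ha, Fin.ext_iff]
      have hmem₁ : ∀ x, x ∈ W₁ ↔ (x ∈ W ∧ x ≠ a) ∧ ¬ G.Adj a x := by
        intro x
        simp [hW₁, hmemd]
      have r1 : RunsFn 3 [encodeSet W, Val.unit v, .nat 0] (encodeSet Wd) (60 * (n + 1)) :=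
        runs_diff_set W (rep_unit v) rep_empty
      have r2 : RunsFn 3 [encodeSet Wd, Val.natTab row, .nat 0] (encodeSet W₁) (60 * (n + 1)) :=
        runs_diff_set Wd hrowrep rep_empty
      have hWdW : Wd ⊆ W := fun x hx => ((hmemd x).mp hx).1
      have hW₁d : W₁ ⊆ Wd := fun x hx => (hmemd x).mpr ((hmem₁ x).mp hx).1
      obtain ⟨r, hr, hr1, hr2⟩ := runs_value (G := G) W
      obtain ⟨r', hr', hr1', hr2'⟩ := runs_value (G := G) W₁
      have herase : ∀ T ⊆ W, G.IsIndepSet (T : Set (Fin n)) → a ∈ T → 2 * T.card ≤ r' + 2 := by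
        intro T hT hTi haT
        have := hr1' (T.erase a) (by
          intro x hx
          rw [Finset.mem_erase] at hx
          exact (hmem₁ x).mpr ⟨⟨hT hx.2, hx.1⟩, fun hadj => hTi haT hx.2 hx.1.symm hadj⟩)
          (hTi.mono (by simp))
        rw [Finset.card_erase_of_mem haT] at this
        have := Finset.card_pos.mpr ⟨a, haT⟩
        omega
      -- For bipartite `G[W]` the values tell whether some maximum independent set contains `a`.
      by_cases hle : r ≤ r' + 2
      · obtain ⟨S, hS, hSi, hrun, hopt⟩ := ih (v + 1) W₁ (by omega) (fun x hx =>
          hval x (hW x (hWdW (hW₁d hx))) ((hmem₁ x).mp hx).1.2)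
        have haS : a ∉ S := fun h => ((hmem₁ a).mp (hS h)).1.2 rfl
        refine ⟨insert a S, Finset.insert_subset haW (hS.trans (hW₁d.trans hWdW)), ?_, ?_, ?_⟩
        · rw [Finset.coe_insert, SimpleGraph.isIndepSet_iff, Set.pairwise_insert]
          refine ⟨hSi, fun b hb _ => ⟨((hmem₁ b).mp (hS hb)).2, fun h =>
            ((hmem₁ b).mp (hS hb)).2 h.symm⟩⟩
        · have e := hsuf (insert a S)
          rw [if_pos (Finset.mem_insert_self a S), suffixVal_insert (Nat.lt_succ_self _)] at e
          refine Runs.cast (Runs.ifZero_succ (Runs.cast (.sub (.arg 0 1) (.arg 0 3))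
            (congrArg Val.nat hm) le_rfl) (.ifZero_succ (.call (.cons (.arg 0 2) (.cons (.arg 0 3)
              .nil)) hnth) (.letIn (.call (.cons (.arg 0 2) (.cons (.call (.cons (.arg 0 3) .nil)
              (runs_unit v)) (.cons (.lit 0) .nil))) r1) (.letIn (.call (.cons (.var 0) (.cons
                (.call (.cons (.arg 1 0) (.cons (.arg 1 3) .nil)) hnth') (.cons (.lit 0) .nil)))
                r2) (.ifZero_zero (Runs.cast (.sub (.call (.cons (.arg 2 0) (.cons (.add (.arg 2 1)
                  (.lit 2)) (.cons (.arg 2 2) (.cons (.arg 2 1) (.cons (.lit 0) .nil))))) hr)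
                  (.add (.call (.cons (.arg 2 0) (.cons (.add (.arg 2 1) (.lit 2)) (.cons (.var 0)
                    (.cons (.arg 2 1) (.cons (.lit 0) .nil))))) hr') (.lit 2)))
                  (congrArg Val.nat (Nat.sub_eq_zero_of_le hle)) le_rfl)
                  (.pair (.lit 1) (.call (.cons (.arg 2 0) (.cons (.arg 2 1) (.cons (.var 0)
                    (.cons (.add (.arg 2 3) (.lit 1)) .nil)))) hrun)))))))
            e.symm (by omega)
        · intro hb T hT hTi
          obtain ⟨S₁, hS₁, hS₁i, hS₁c⟩ := hr2' (hb.mono (hW₁d.trans hWdW))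
          have h1 := hr1 T hT hTi
          have h2 := hopt (hb.mono (hW₁d.trans hWdW)) S₁ hS₁ hS₁i
          rw [Finset.card_insert_of_notMem haS]
          omega
      · obtain ⟨S, hS, hSi, hrun, hopt⟩ := ih (v + 1) Wd (by omega) (fun x hx =>
          hval x (hW x (hWdW hx)) ((hmemd x).mp hx).2)
        have haS : a ∉ S := fun h => ((hmemd a).mp (hS h)).2 rfl
        refine ⟨S, hS.trans hWdW, hSi, ?_, ?_⟩
        · have e := hsuf S
          rw [if_neg haS] at e
          refine Runs.cast (Runs.ifZero_succ (Runs.cast (.sub (.arg 0 1) (.arg 0 3))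
            (congrArg Val.nat hm) le_rfl) (.ifZero_succ (.call (.cons (.arg 0 2) (.cons (.arg 0 3)
              .nil)) hnth) (.letIn (.call (.cons (.arg 0 2) (.cons (.call (.cons (.arg 0 3) .nil)
              (runs_unit v)) (.cons (.lit 0) .nil))) r1) (.letIn (.call (.cons (.var 0) (.cons
                (.call (.cons (.arg 1 0) (.cons (.arg 1 3) .nil)) hnth') (.cons (.lit 0) .nil)))
                r2) (.ifZero_ne (.sub (.call (.cons (.arg 2 0) (.cons (.add (.arg 2 1)
                  (.lit 2)) (.cons (.arg 2 2) (.cons (.arg 2 1) (.cons (.lit 0) .nil))))) hr)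
                  (.add (.call (.cons (.arg 2 0) (.cons (.add (.arg 2 1) (.lit 2)) (.cons (.var 0)
                    (.cons (.arg 2 1) (.cons (.lit 0) .nil))))) hr') (.lit 2)))
                  (fun h => hle (Nat.le_of_sub_eq_zero (Val.nat.inj h)))
                  (.pair (.lit 0) (.call (.cons (.arg 2 0) (.cons (.arg 2 1) (.cons (.var 1)
                    (.cons (.add (.arg 2 3) (.lit 1)) .nil)))) hrun)))))))
            e.symm (by omega)
        · intro hb T hT hTi
          have hd : ∀ T ⊆ W, G.IsIndepSet (T : Set (Fin n)) → a ∉ T → T.card ≤ S.card :=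
            fun T hT hTi haT => hopt (hb.mono hWdW) T
              (fun x hx => (hmemd x).mpr ⟨hT hx, fun h => haT (h ▸ hx)⟩) hTi
          by_cases haT : a ∈ T
          · obtain ⟨S₀, hS₀, hS₀i, hS₀c⟩ := hr2 hb
            have h1 := herase T hT hTi haT
            have h2 : a ∉ S₀ := fun h => by
              have := herase S₀ hS₀ hS₀i h
              omega
            have h3 := hd S₀ hS₀ hS₀i h2
            omega
          · exact hd T hT hTi haT
    · rw [if_neg haW] at hnth
      obtain ⟨S, hS, hSi, hrun, hopt⟩ := ih (v + 1) W (by omega)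
        (fun x hx => hval x (hW x hx) fun h => haW (h ▸ hx))
      have e := hsuf S
      rw [if_neg fun h => haW (hS h)] at e
      exact ⟨S, hS, hSi, Runs.cast (Runs.ifZero_succ (Runs.cast (.sub (.arg 0 1) (.arg 0 3))
        (congrArg Val.nat hm) le_rfl) (.ifZero_zero (.call (.cons (.arg 0 2) (.cons (.arg 0 3)
          .nil)) hnth) (.pair (.lit 0) (.call (.cons (.arg 0 0) (.cons (.arg 0 1) (.cons (.arg 0 2)
            (.cons (.add (.arg 0 3) (.lit 1)) .nil)))) hrun)))) e.symm (by omega), hopt⟩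

/-- The deletions described by a list of numbers, six numbers for each deletion. -/
def applyOps (G : SimpleGraph (Fin n)) [DecidableRel G.Adj] :
    List ℕ → Finset (Fin n) → Finset (Fin n)
  | x :: i :: j :: z :: q :: h :: l, W =>
      applyOps G l (delStep G W (pointSet n x) i j (pointSet n z) q h)
  | _, W => W

/-- A list of numbers as a value. -/
def numsVal (l : List ℕ) : Val := Val.ofList (l.map Val.nat)

/-- `S` is at least as good as every independent set that survives the deletions in `l`, provided
that they lead to a bipartite graph. -/
def Good (G : SimpleGraph (Fin n)) [DecidableRel G.Adj] (W S : Finset (Fin n)) (l : List ℕ) :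
    Prop :=
  Bip G (applyOps G l W) → ∀ T ⊆ applyOps G l W, G.IsIndepSet (T : Set (Fin n)) →
    T.card ≤ S.card

/-- A bound for the running time of one deletion or of the final solution. -/
def deleteCost (n : ℕ) : ℕ :=
  3 * ((n + 2) * ballCost n) + (n + 1) * (40 * n + 300) + 180 * (n + 1) + 1000 +
    (n + 1) * greedyCost n

/-- The deletions in the list `l`, followed by the greedy choice. -/
theorem runs_run [DecidableRel G.Adj] (a : ℕ) : ∀ (l : List ℕ) (W : Finset (Fin n)),
    l.length = 6 * a → (∀ y ∈ l, y ≤ n + 1) → ∃ S : Finset (Fin n), G.IsIndepSet (S : Set (Fin n)) ∧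
      RunsFn 11 [rowsVal G, .nat n, encodeSet W, numsVal l] (encodeSet S)
        ((a + 1) * deleteCost n) ∧ Good G W S l := by
  have hdc : deleteCost n = 3 * ((n + 2) * ballCost n) + (n + 1) * (40 * n + 300) +
    180 * (n + 1) + 1000 + (n + 1) * greedyCost n := rfl
  induction a with
  | zero =>
    intro l W hl _
    obtain rfl := List.eq_nil_of_length_eq_zero hl
    obtain ⟨S, -, h2, h3, h4⟩ := runs_solve (G := G) n 0 W (by omega) (fun _ _ => Nat.zero_le _)
    rw [suffixVal_zero] at h3
    exact ⟨S, h2, Runs.cast (Runs.ifPair_nat (.arg 0 3) (.call (.cons (.arg 0 0) (.cons (.arg 0 1)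
      (.cons (.arg 0 2) (.cons (.lit 0) .nil)))) h3)) rfl (by omega), h4⟩
  | succ a ih =>
    intro l W hl hy
    obtain ⟨x, i, j, z, q, h, l, rfl⟩ : ∃ x i j z q h l', l = x :: i :: j :: z :: q :: h :: l' := by
      match l, hl with
      | x :: i :: j :: z :: q :: h :: l', _ => exact ⟨x, i, j, z, q, h, l', rfl⟩
      | [], hl | [_], hl | [_, _], hl | [_, _, _], hl | [_, _, _, _], hl | [_, _, _, _, _], hl =>
        simp at hl; try omega
    simp only [List.mem_cons, forall_eq_or_imp] at hy
    obtain ⟨hx, hi, hj, hz, hq, hh, hl'⟩ := hy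
    obtain ⟨S, h1, h2, h3⟩ := ih l (delStep G W (pointSet n x) i j (pointSet n z) q h)
      (by simp at hl; omega) hl'
    obtain ⟨vj, hvj, hrj⟩ := runs_ball (G := G) W hx j
    obtain ⟨vi, hvi, hri⟩ := runs_ball (G := G) W hx i
    obtain ⟨vq, hvq, hrq⟩ := runs_ball (G := G) W hz q
    have hth := runs_threshold_set (G := G) (rep_encodeSet W) (rep_encodeSet W) rep_empty h
    have hdel := runs_diff_set
      ((W \ (ballIn G W (pointSet n x) j \ ballIn G W (pointSet n x) i)) \
        (ballIn G W (pointSet n z) q \ ∅))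
      (rep_encodeSet ((W ∪ ∅).filter fun v =>
        h ≤ (W.filter (G.Adj v)).card + if v ∈ (∅ : Finset (Fin n)) then 1 else 0)) rep_empty
    have hset : ((W \ (ballIn G W (pointSet n x) j \ ballIn G W (pointSet n x) i)) \
        (ballIn G W (pointSet n z) q \ ∅)) \ (((W ∪ ∅).filter fun v =>
      h ≤ (W.filter (G.Adj v)).card + if v ∈ (∅ : Finset (Fin n)) then 1 else 0) \ ∅) =
        delStep G W (pointSet n x) i j (pointSet n z) q h := by
      simp [delStep]
    rw [hset] at hdel
    have hball : ∀ m ≤ n + 1, (m + 1) * ballCost n ≤ (n + 2) * ballCost n := fun m hm =>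
      Nat.mul_le_mul_right _ (by omega)
    have b1 := hball j hj
    have b2 := hball i hi
    have b3 := hball q hq
    have hstep : (a + 1 + 1) * deleteCost n = (a + 1) * deleteCost n + deleteCost n :=
      Nat.succ_mul _ _
    refine ⟨S, h1, ?_, h3⟩
    exact Runs.cast (Runs.ifPair_pair (.arg 0 3) (.letIn (.arg 0 3) (.call (.cons (.arg 1 0)
      (.cons (.arg 1 1) (.cons (.call (.cons (.call (.cons (.call (.cons (.arg 1 2) (.cons
        (.call (.cons (.arg 1 0) (.cons (.arg 1 2) (.cons (.arg 0 0) (.cons (.arg 0 2) .nil)))) hvj)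
        (.cons (.call (.cons (.arg 1 0) (.cons (.arg 1 2) (.cons (.arg 0 0) (.cons (.arg 0 1)
          .nil)))) hvi) .nil))) (runs_diff_set W hrj hri))
        (.cons (.call (.cons (.arg 1 0) (.cons (.arg 1 2) (.cons (.arg 0 3) (.cons (.arg 0 4)
          .nil)))) hvq) (.cons (.lit 0) .nil))) (runs_diff_set _ hrq rep_empty))
        (.cons (.call (.cons (.arg 1 0) (.cons (.arg 1 2) (.cons (.arg 1 2) (.cons (.lit 0)
          (.cons (.arg 0 5) .nil))))) hth) (.cons (.lit 0) .nil))) hdel)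
        (.cons (.snds 6 (.var 0)) .nil)))) h2))) rfl (by omega)

/-- The part of the running time of the search that is due to the comparison of two results. -/
def compareCost (n : ℕ) : ℕ := 80 * (n + 1) + 300

/-- A bound for the running time of the search. -/
def searchCost (n a : ℕ) : ℕ → ℕ
  | 0 => (a + 1) * deleteCost n + 100
  | F + 1 => (n + 2) * (searchCost n a F + compareCost n) + compareCost n

/-- The search tries all extensions of `l` to a list of `6 * a` numbers, and returns the largest of
the independent sets found. -/
theorem runs_search [DecidableRel G.Adj] {a : ℕ} (W : Finset (Fin n)) (F : ℕ) : ∀ l : List ℕ,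
    l.length + F = 6 * a → (∀ y ∈ l, y ≤ n + 1) →
    ∃ S : Finset (Fin n), G.IsIndepSet (S : Set (Fin n)) ∧
      RunsFn 12 [rowsVal G, .nat n, encodeSet W, .nat F, .nat (n + 2), numsVal l] (encodeSet S)
        (searchCost n a F) ∧
      ∀ l' : List ℕ, l'.length = F → (∀ y ∈ l', y ≤ n + 1) → Good G W S (l' ++ l) := by
  induction F with
  | zero =>
    intro l hl hy
    obtain ⟨S, h1, h2, h3⟩ := runs_run (G := G) a l W (by omega) hy
    refine ⟨S, h1, ?_, fun l' hl' _ => ?_⟩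
    · exact Runs.cast (Runs.ifZero_zero (.arg 0 3) (.call (.cons (.arg 0 0) (.cons (.arg 0 1)
        (.cons (.arg 0 2) (.cons (.arg 0 5) .nil)))) h2)) rfl (by rw [searchCost]; omega)
    · obtain rfl := List.eq_nil_of_length_eq_zero hl'
      exact h3
  | succ F ih =>
    intro l hl hy
    have hcc : compareCost n = 80 * (n + 1) + 300 := rfl
    -- The search in which the next number is less than `c`: for `c = 0` there is nothing to try,
    -- and the result is the empty list, which counts as a set of size `0`.
    have key : ∀ c, c ≤ n + 2 → ∃ v m, RunsFn 12 [rowsVal G, .nat n, encodeSet W, .nat (F + 1),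
        .nat c, numsVal l] v (c * (searchCost n a F + compareCost n) + compareCost n) ∧
        RunsFn 1 [v, v] (.nat m) (40 * (n + 1)) ∧
        ((c = 0 ∧ m = 0) ∨ ∃ S : Finset (Fin n), G.IsIndepSet (S : Set (Fin n)) ∧
          v = encodeSet S ∧ m = S.card ∧ ∀ y < c, ∀ l' : List ℕ, l'.length = F →
            (∀ y ∈ l', y ≤ n + 1) → Good G W S (l' ++ y :: l)) := by
      intro c
      induction c with
      | zero =>
        intro _
        refine ⟨.nat 0, 0, ?_, ?_, .inl ⟨rfl, rfl⟩⟩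
        · exact Runs.cast (Runs.ifZero_succ (.arg 0 3) (.ifZero_zero (.arg 0 4) (.lit 0))) rfl
            (by omega)
        · exact Runs.cast (runs_dot Fin.elim0 (.nat 0)) rfl (by omega)
      | succ c ihc =>
        intro hc
        obtain ⟨vB, mB, hB, hdB, hvB⟩ := ihc (by omega)
        obtain ⟨S, hSi, hA, hgood⟩ := ih (c :: l) (by simp; omega) (by
          simp only [List.mem_cons, forall_eq_or_imp]
          exact ⟨by omega, hy⟩)
        have hdA := runs_dot_card (n := n) (S := S) (T := S) (t := encodeSet S)
          (fun i => if i ∈ S then 1 else 0) (rep_encodeSet S) (by simp) rfl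
        rw [Finset.inter_self] at hdA
        have hstep : (c + 1) * (searchCost n a F + compareCost n) =
          c * (searchCost n a F + compareCost n) + (searchCost n a F + compareCost n) :=
          Nat.succ_mul _ _
        by_cases hle : mB ≤ S.card
        · refine ⟨encodeSet S, S.card, ?_, hdA, .inr ⟨S, hSi, rfl, rfl, fun y hyc l' hl' hy' => ?_⟩⟩
          · exact Runs.cast (Runs.ifZero_succ (.arg 0 3) (.ifZero_succ (.arg 0 4) (.letIn
              (.sub (.arg 0 4) (.lit 1)) (.letIn (.call (.cons (.arg 1 0) (.cons (.arg 1 1)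
                (.cons (.arg 1 2) (.cons (.sub (.arg 1 3) (.lit 1)) (.cons (.add (.arg 1 1)
                  (.lit 2)) (.cons (.pair (.var 0) (.arg 1 5)) .nil)))))) hA)
                (.letIn (.call (.cons (.arg 2 0) (.cons (.arg 2 1) (.cons (.arg 2 2) (.cons
                  (.arg 2 3) (.cons (.var 1) (.cons (.arg 2 5) .nil)))))) hB)
                  (.ifZero_zero (Runs.cast (.sub (.call (.cons (.var 0) (.cons (.var 0) .nil)) hdB)
                    (.call (.cons (.var 1) (.cons (.var 1) .nil)) hdA))
                    (congrArg Val.nat (Nat.sub_eq_zero_of_le hle)) le_rfl) (.var 1))))))) rfl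
              (by omega)
          · rcases Nat.lt_succ_iff_lt_or_eq.mp hyc with hlt | rfl
            · rcases hvB with ⟨rfl, -⟩ | ⟨SB, -, -, rfl, hgB⟩
              · omega
              · exact fun hb T hT hTi => (hgB y hlt l' hl' hy' hb T hT hTi).trans hle
            · exact hgood l' hl' hy'
        · refine ⟨vB, mB, ?_, hdB, ?_⟩
          · exact Runs.cast (Runs.ifZero_succ (.arg 0 3) (.ifZero_succ (.arg 0 4) (.letIn
              (.sub (.arg 0 4) (.lit 1)) (.letIn (.call (.cons (.arg 1 0) (.cons (.arg 1 1)
                (.cons (.arg 1 2) (.cons (.sub (.arg 1 3) (.lit 1)) (.cons (.add (.arg 1 1)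
                  (.lit 2)) (.cons (.pair (.var 0) (.arg 1 5)) .nil)))))) hA)
                (.letIn (.call (.cons (.arg 2 0) (.cons (.arg 2 1) (.cons (.arg 2 2) (.cons
                  (.arg 2 3) (.cons (.var 1) (.cons (.arg 2 5) .nil)))))) hB)
                  (.ifZero_ne (.sub (.call (.cons (.var 0) (.cons (.var 0) .nil)) hdB)
                    (.call (.cons (.var 1) (.cons (.var 1) .nil)) hdA))
                    (fun h => hle (Nat.le_of_sub_eq_zero (Val.nat.inj h))) (.var 0))))))) rfl
              (by omega)
          · rcases hvB with ⟨-, rfl⟩ | ⟨SB, hSBi, hSB, rfl, hgB⟩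
            · omega
            · refine .inr ⟨SB, hSBi, hSB, rfl, fun y hyc l' hl' hy' => ?_⟩
              rcases Nat.lt_succ_iff_lt_or_eq.mp hyc with hlt | rfl
              · exact hgB y hlt l' hl' hy'
              · exact fun hb T hT hTi => (hgood l' hl' hy' hb T hT hTi).trans (by omega)
    obtain ⟨v, m, h1, -, h3⟩ := key (n + 2) le_rfl
    rcases h3 with ⟨h0, -⟩ | ⟨S, hSi, rfl, -, hg⟩
    · omega
    · refine ⟨S, hSi, h1, fun l' hl' hy' => ?_⟩
      -- The number chosen first is the last one of `l'`.
      obtain ⟨l₁, y, rfl⟩ : ∃ l₁ y, l' = l₁ ++ [y] := by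
        rcases List.eq_nil_or_concat l' with rfl | ⟨l₁, y, rfl⟩
        · simp at hl'
        · exact ⟨l₁, y, by simp⟩
      rw [List.append_assoc]
      refine hg y ?_ l₁ (by simpa using hl') (fun z hz => hy' z (by simp [hz]))
      have := hy' y (by simp)
      omega

theorem exists_pointSet_eq {X : Finset (Fin n)} (hX : X.card ≤ 1) :
    ∃ x ≤ n, pointSet n x = X := by
  by_cases h0 : X = ∅
  · refine ⟨n, le_rfl, ?_⟩
    rw [h0, pointSet, Finset.filter_eq_empty_iff]
    intro i _
    exact i.2.ne
  · obtain ⟨v, rfl⟩ := Finset.card_eq_one.mp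
      (le_antisymm hX (Finset.card_pos.mpr (Finset.nonempty_iff_ne_empty.mpr h0)))
    refine ⟨v, v.2.le, ?_⟩
    ext i
    simp [pointSet, Fin.ext_iff]

/-- Every sequence of deletions is described by a list that the search tries. -/
theorem exists_applyOps_of_reach [DecidableRel G.Adj] {a : ℕ} {W W' : Finset (Fin n)}
    (h : Reach G a W W') :
    ∃ l : List ℕ, l.length = 6 * a ∧ (∀ y ∈ l, y ≤ n + 1) ∧ applyOps G l W = W' := by
  induction a generalizing W with
  | zero => exact ⟨[], rfl, by simp, h.symm⟩
  | succ a ih =>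
    obtain ⟨W₁, ⟨X, Z, i, j, q, h, hX, hZ, hi, hj, hq, hh, rfl⟩, hr⟩ := h
    obtain ⟨l, h1, h2, h3⟩ := ih hr
    obtain ⟨x, hx, rfl⟩ := exists_pointSet_eq hX
    obtain ⟨z, hz, rfl⟩ := exists_pointSet_eq hZ
    rw [Fintype.card_fin] at hi hj hq hh
    refine ⟨x :: i :: j :: z :: q :: h :: l, by simp [h1]; omega, ?_, h3⟩
    simp only [List.mem_cons, forall_eq_or_imp]
    exact ⟨by omega, hi, hj, by omega, hq, hh, h2⟩

end RandProg

/-! ### The main function and its running time -/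

namespace RandProg

variable {n : ℕ} {G : SimpleGraph (Fin n)}

theorem encodeGraph_eq [DecidableRel G.Adj] : encodeGraph G = .pair (.nat n) (rowsVal G) := by
  refine congrArg (Val.pair _) (congrArg Val.tab (funext fun i => congrArg Val.tab
    (funext fun j => congrArg Val.nat ?_)))
  congr

/-- The part of the number of deletions that depends on `k` and `p` only. A power of two can be
computed by additions. -/
@[irreducible]
def baseSteps (k p : ℕ) : ℕ := 2 ^ (8 * (k + p) + 30)

/-- The number of deletions that the search allows. -/
@[irreducible]
def maxSteps (k p n : ℕ) : ℕ := 3 * (p * Nat.clog 2 n) + baseSteps k p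

theorem numSteps_le (k p : ℕ) : 3 * p + 3 * k + numSteps k p ≤ baseSteps k p := by
  have hk : k + 1 ≤ 2 ^ k := Nat.lt_two_pow_self
  have hp : p + 1 ≤ 2 ^ p := Nat.lt_two_pow_self
  have hE : baseSteps k p = 2 ^ 30 * ((2 ^ k) ^ 8 * (2 ^ p) ^ 8) := by
    rw [baseSteps, ← pow_mul, ← pow_mul, ← pow_add, ← pow_add]
    congr 1
    ring
  rw [hE]
  set x := 2 ^ k
  set y := 2 ^ p
  have hx : 1 ≤ x := by omega
  have hy : 1 ≤ y := by omega
  have hpy : p ≤ y := by omega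
  have hs : shortLength p ≤ 64 * y ^ 2 := by
    rw [shortLength]
    exact Nat.mul_le_mul (by norm_num) (Nat.pow_le_pow_left hpy 2)
  have hM : samplePrecision k p ≤ 2 ^ 12 * (x * y ^ 4) := by
    calc samplePrecision k p ≤ 8 * (8 * x) * y ^ 2 * (64 * y ^ 2) := by
          rw [samplePrecision]
          gcongr
          omega
      _ = 2 ^ 12 * (x * y ^ 4) := by ring
  have hz : x * y ^ 4 ≤ x ^ 4 * y ^ 4 := Nat.mul_le_mul_right _ (Nat.le_self_pow (by norm_num) x)
  set z := x ^ 4 * y ^ 4 with hzdef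
  have hzz : x ^ 8 * y ^ 8 = z * z := by rw [hzdef]; ring
  have hz1 : 1 ≤ z := Nat.mul_pos (Nat.pow_pos hx) (Nat.pow_pos hy)
  have hzle : z ≤ z * z := Nat.le_mul_self z
  have hxz : x ≤ z := (Nat.le_self_pow (by norm_num) x).trans
    (Nat.le_mul_of_pos_right _ (Nat.pow_pos hy))
  have hyz : y ^ 2 ≤ z := (Nat.pow_le_pow_right hy (by norm_num)).trans
    (Nat.le_mul_of_pos_left _ (Nat.pow_pos hx))
  have hyz' : y ≤ z := (Nat.le_self_pow (by norm_num) y).trans hyz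
  have h1 : samplePrecision k p * samplePrecision k p ≤ 2 ^ 24 * (z * z) :=
    (Nat.mul_le_mul (hM.trans (Nat.mul_le_mul_left _ hz))
      (hM.trans (Nat.mul_le_mul_left _ hz))).trans (le_of_eq (by ring))
  have h2 : shortLength p * k ≤ 64 * (z * z) :=
    (Nat.mul_le_mul (hs.trans (Nat.mul_le_mul_left _ hyz)) (show k ≤ z by omega)).trans
      (le_of_eq (by ring))
  rw [hzz, numSteps]
  omega

/-- The additional term on the left makes the bound stable under the recursion. -/
theorem searchCost_le (n a F : ℕ) : searchCost n a F + 2 * compareCost n ≤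
    (2 * (n + 2)) ^ F * ((a + 1) * deleteCost n + 100 + 2 * compareCost n) := by
  induction F with
  | zero => rw [searchCost, pow_zero, Nat.one_mul]
  | succ F ih =>
    rw [searchCost, pow_succ, Nat.mul_right_comm]
    refine le_trans ?_ (Nat.mul_le_mul_right _ ih)
    nlinarith [Nat.zero_le (n * searchCost n a F), Nat.zero_le (n * compareCost n)]

theorem deleteCost_le (n : ℕ) : deleteCost n ≤ 200000 * (n + 1) ^ 6 := by
  unfold deleteCost greedyCost bidderCost roundCost ballCost
  ring_nf
  omega

/-- The running time of the program. -/
@[irreducible]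
def totalCost (k p n : ℕ) : ℕ :=
  searchCost n (maxSteps k p n) (6 * maxSteps k p n) + 40 * (8 * (k + p) + 31) +
    60 * (Nat.clog 2 n + 1) + 40 * (n + 1) + 500

/-- The whole program on the input `(k, p, G)`. -/
theorem runs_main [DecidableRel G.Adj] (k p : ℕ) :
    ∃ S : Finset (Fin n), G.IsIndepSet (S : Set (Fin n)) ∧
      Runs prog [encodeInput k p G] (prog.getD 0 (.lit 0)) (encodeSet S) (totalCost k p n) ∧
      ∀ l : List ℕ, l.length = 6 * maxSteps k p n → (∀ y ∈ l, y ≤ n + 1) →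
        Good G Finset.univ S l := by
  have hc : totalCost k p n = searchCost n (maxSteps k p n) (6 * maxSteps k p n) +
    40 * (8 * (k + p) + 31) + 60 * (Nat.clog 2 n + 1) + 40 * (n + 1) + 500 := by
    rw [totalCost]
  have hin : encodeInput k p G = .pair (.nat k) (.pair (.nat p) (.pair (.nat n) (rowsVal G))) := by
    rw [encodeInput, encodeGraph_eq]
  rw [hin, hc]
  have hexp : RunsFn 13 [.nat (k + p + (k + p) + (k + p + (k + p)) +
      (k + p + (k + p) + (k + p + (k + p))) + 30)] (.nat (baseSteps k p))
      (40 * (8 * (k + p) + 31)) := by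
    have h8 : k + p + (k + p) + (k + p + (k + p)) + (k + p + (k + p) + (k + p + (k + p))) + 30 =
      8 * (k + p) + 30 := by omega
    rw [h8, baseSteps]
    exact runs_exp _
  set lg := p * Nat.clog 2 n with hlg
  have ha : maxSteps k p n = lg + (lg + lg) + baseSteps k p := by
    rw [maxSteps]; omega
  have hlog : RunsFn 14 [.nat n, .nat 1, .nat p] (.nat lg) (60 * (Nat.clog 2 n + 1)) :=
    runs_log n p _ 0 (by omega)
  have hfull : RunsFn 15 [.nat n] (encodeSet (Finset.univ : Finset (Fin n))) (40 * (n + 1)) := by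
    refine Runs.cast (runs_full n) ?_ le_rfl
    rw [encodeSet_eq]
    simp
  have h6 : 6 * maxSteps k p n = maxSteps k p n + (maxSteps k p n + maxSteps k p n) +
    (maxSteps k p n + (maxSteps k p n + maxSteps k p n)) := by omega
  obtain ⟨S, h1, h2, h3⟩ := runs_search (G := G) (a := maxSteps k p n) Finset.univ
    (6 * maxSteps k p n) [] (by simp) (by simp)
  refine ⟨S, h1, ?_, fun l hl hy => by simpa using h3 l hl hy⟩
  rw [h6] at h2 ⊢
  generalize maxSteps k p n = a at *
  generalize baseSteps k p = b at *
  subst ha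
  exact Runs.cast (Runs.letIn (.add (.arg 0 0) (.arg 0 1)) (.letIn (.add (.var 0) (.var 0))
    (.letIn (.add (.var 0) (.var 0)) (.letIn (.add (.var 0) (.var 0))
      (.letIn (.call (.cons (.add (.var 0) (.lit 30)) .nil) hexp)
        (.letIn (.call (.cons (.arg 5 2) (.cons (.lit 1) (.cons (.arg 5 1) .nil))) hlog)
          (.letIn (.add (.add (.var 0) (.add (.var 0) (.var 0))) (.var 1))
            (.letIn (.add (.var 0) (.add (.var 0) (.var 0)))
              (.call (.cons (.snds 3 (.var 8)) (.cons (.arg 8 2) (.cons (.call (.cons (.arg 8 2)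
                .nil) hfull) (.cons (.add (.var 0) (.var 0)) (.cons (.add (.arg 8 2) (.lit 2))
                  (.cons (.lit 0) .nil)))))) h2))))))))) rfl (by omega)

theorem totalCost_le (k p n : ℕ) (hp : 1 ≤ p) (hn : 1 ≤ n) :
    totalCost k p n ≤
      10 ^ 9 * n ^ 6 * 2 ^ maxSteps k p n * (6 * n) ^ (6 * maxSteps k p n) := by
  set a := maxSteps k p n with ha
  have h1 := searchCost_le n a (6 * a)
  have h2 := deleteCost_le n
  have hE : 8 * (k + p) + 31 ≤ a := by
    have : 8 * (k + p) + 30 < 2 ^ (8 * (k + p) + 30) := Nat.lt_two_pow_self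
    rw [ha, maxSteps, baseSteps]
    omega
  have hclog : Nat.clog 2 n ≤ a := by
    rw [ha, maxSteps]
    have := Nat.le_mul_of_pos_left (Nat.clog 2 n) hp
    omega
  have ha2 : a + 1 ≤ 2 ^ a := Nat.lt_two_pow_self
  have hn6 : n ≤ n ^ 6 := Nat.le_self_pow (by norm_num) n
  have hd : deleteCost n ≤ 200000 * 64 * n ^ 6 := by
    refine h2.trans ?_
    calc 200000 * (n + 1) ^ 6 ≤ 200000 * (2 * n) ^ 6 := by gcongr; omega
      _ = 200000 * 64 * n ^ 6 := by ring
  have hbase : (2 * (n + 2)) ^ (6 * a) ≤ (6 * n) ^ (6 * a) := Nat.pow_le_pow_left (by omega) _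
  set A := 2 ^ a
  set X := (6 * n) ^ (6 * a)
  set m := n ^ 6
  have hX : 1 ≤ X := Nat.pow_pos (by omega)
  clear_value X
  have hA : 1 ≤ A := by omega
  have hm : 1 ≤ m := by omega
  clear_value A m
  have hprod : (a + 1) * deleteCost n ≤ A * (12800000 * m) := Nat.mul_le_mul ha2 (by omega)
  have hmA : m ≤ m * A := Nat.le_mul_of_pos_right _ hA
  have hAm : A ≤ m * A := Nat.le_mul_of_pos_left _ hm
  have hcost : (a + 1) * deleteCost n + 100 + 2 * compareCost n ≤ 20000000 * (m * A) := by
    have e : A * (12800000 * m) = 12800000 * (m * A) := by ring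
    rw [compareCost]
    omega
  have hsmall : 40 * (8 * (k + p) + 31) + 60 * (Nat.clog 2 n + 1) + 40 * (n + 1) + 500 ≤
      800 * (m * A) := by omega
  have hsX : 800 * (m * A) ≤ X * (800 * (m * A)) := Nat.le_mul_of_pos_left _ hX
  calc totalCost k p n ≤ X * (20000000 * (m * A)) + X * (800 * (m * A)) := by
        have := h1.trans (Nat.mul_le_mul hbase hcost)
        rw [totalCost, ← ha]
        linarith
    _ = 20000800 * (m * A * X) := by ring
    _ ≤ 10 ^ 9 * (m * A * X) := Nat.mul_le_mul_right _ (by norm_num)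
    _ = 10 ^ 9 * m * A * X := by ring

theorem clog_le_two_mul_log (n : ℕ) : (Nat.clog 2 n : ℝ) ≤ 2 * Real.log n + 1 := by
  have hL : 0 ≤ Real.log n := Real.log_natCast_nonneg n
  rcases hc : Nat.clog 2 n with _ | c
  · push_cast; linarith
  · have h : 2 ^ c < n := Nat.pow_lt_of_lt_clog (by omega)
    have h' : ((2 : ℝ) ^ c) ≤ n := by exact_mod_cast h.le
    have := Real.log_le_log (by positivity) h'
    rw [Real.log_pow] at this
    have h2 := Real.log_two_gt_d9
    push_cast
    nlinarith [(Nat.cast_nonneg c : (0 : ℝ) ≤ c)]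

/-- The constant factor in the bound for the running time. -/
noncomputable def timeFactor (k p : ℕ) : ℝ :=
  10 ^ 9 * Real.exp (2000 * p + 13 * (3 * p + baseSteps k p) + 9 * (3 * p + baseSteps k p) ^ 2)

/-- The number of deletions is at most `6 * p * log n + B`, where `B` depends on `k` and `p` only.
The terms of the exponent that are linear in `log n` are absorbed by `p * (log n) ^ 2` and by the
constant factor. -/
theorem totalCost_le_rpow (k p n : ℕ) (hp : 1 ≤ p) (hn : 1 ≤ n) :
    (totalCost k p n : ℝ) ≤
      timeFactor k p * (n : ℝ) ^ (38 * ((k : ℝ) + (p : ℝ) * Real.log n)) := by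
  have hn0 : (0 : ℝ) < n := by exact_mod_cast hn
  have hp' : (1 : ℝ) ≤ p := by exact_mod_cast hp
  have hk' : (0 : ℝ) ≤ k := Nat.cast_nonneg k
  have h1 : (totalCost k p n : ℝ) ≤
      10 ^ 9 * n ^ 6 * 2 ^ maxSteps k p n * (6 * n) ^ (6 * maxSteps k p n) := by
    exact_mod_cast totalCost_le k p n hp hn
  have hclog := clog_le_two_mul_log n
  have hL : 0 ≤ Real.log n := Real.log_natCast_nonneg n
  set L := Real.log n with hLdef
  set a := maxSteps k p n with ha
  set B : ℝ := 3 * p + baseSteps k p with hB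
  have hB0 : 0 ≤ B := by positivity
  have haB : (a : ℝ) ≤ 6 * p * L + B := by
    rw [ha, maxSteps, hB]
    push_cast
    nlinarith
  have ha0 : (0 : ℝ) ≤ a := Nat.cast_nonneg a
  have hexp : ((n : ℝ) ^ 6 * 2 ^ a * (6 * n) ^ (6 * a)) ≤
      Real.exp (6 * L + 13 * a + 6 * a * L) := by
    rw [← Real.log_le_iff_le_exp (by positivity), Real.log_mul (by positivity) (by positivity),
      Real.log_mul (by positivity) (by positivity), Real.log_pow, Real.log_pow, Real.log_pow,
      Real.log_mul (by norm_num) hn0.ne', ← hLdef]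
    have h2 : Real.log 2 ≤ 1 := by linarith [Real.log_two_lt_d9]
    have h6 : Real.log 6 ≤ 2 := by
      rw [Real.log_le_iff_le_exp (by norm_num), show (2 : ℝ) = 1 + 1 by norm_num, Real.exp_add]
      nlinarith [Real.exp_one_gt_d9]
    push_cast
    nlinarith [mul_le_mul_of_nonneg_left h2 ha0, mul_le_mul_of_nonneg_left h6 ha0]
  have key : 6 * L + 13 * a + 6 * a * L ≤
      2000 * p + 13 * B + 9 * B ^ 2 + L * (38 * (k + p * L)) := by
    have e1 : 6 * a * L ≤ 6 * (6 * p * L + B) * L := by gcongr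
    have e2 : 6 * B * L ≤ 9 * B ^ 2 + L ^ 2 := by nlinarith [sq_nonneg (3 * B - L)]
    have e3 : L ^ 2 ≤ p * L ^ 2 := le_mul_of_one_le_left (sq_nonneg L) hp'
    have e4 : 6 * L ≤ 6 * (p * L) := by nlinarith
    have e5 : 84 * (p * L) ≤ p * L ^ 2 + 1764 * p := by
      nlinarith [mul_nonneg (zero_le_one.trans hp') (sq_nonneg (L - 42))]
    nlinarith [mul_nonneg hk' hL]
  calc (totalCost k p n : ℝ) ≤ 10 ^ 9 * ((n : ℝ) ^ 6 * 2 ^ a * (6 * n) ^ (6 * a)) := by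
        rw [← mul_assoc, ← mul_assoc]; exact h1
    _ ≤ 10 ^ 9 * Real.exp (2000 * p + 13 * B + 9 * B ^ 2 + L * (38 * (k + p * L))) := by
        gcongr
        exact hexp.trans (Real.exp_le_exp.mpr key)
    _ = timeFactor k p * (n : ℝ) ^ (38 * ((k : ℝ) + (p : ℝ) * L)) := by
        rw [timeFactor, Real.rpow_def_of_pos hn0, ← hLdef, ← hB, Real.exp_add, mul_assoc]

/-- The program finds an independent set of the size that is asked for. -/
theorem exists_runs_prog (k p : ℕ) (hp : 1 ≤ p) (hn : 1 ≤ n) (hG : iocp G ≤ k) :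
    ∃ S : Finset (Fin n), G.IsIndepSet (S : Set (Fin n)) ∧
      Runs prog [encodeInput k p G] (prog.getD 0 (.lit 0)) (encodeSet S) (totalCost k p n) ∧
      (1 - (k : ℝ) / (p : ℝ)) * (G.indepNum : ℝ) ≤ (S.card : ℝ) := by
  classical
  have : Nonempty (Fin n) := ⟨⟨0, hn⟩⟩
  obtain ⟨S, h1, h2, h3⟩ := runs_main (G := G) k p
  refine ⟨S, h1, h2, ?_⟩
  have hpack : ¬ OddPack G Finset.univ (k + 1) := fun h => by
    have := (iocp_isGreatest G).2 h.hasInducedOddCyclePacking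
    omega
  obtain ⟨I, hI⟩ := G.exists_isNIndepSet_indepNum
  obtain ⟨W, hW, hbip, hloss⟩ := exists_reach_bip (lg := Nat.clog 2 n) hp
    (by rw [Fintype.card_fin]; exact Nat.le_pow_clog one_lt_two n) hpack hI.isIndepSet
    (fun S hS => by rw [hI.card_eq]; exact hS.card_le_indepNum)
  have hle : 3 * p * (Nat.clog 2 n + 1) + 3 * k + numSteps k p ≤ maxSteps k p n := by
    have := numSteps_le k p
    rw [maxSteps, Nat.mul_succ, Nat.mul_assoc]
    omega
  obtain ⟨l, hl, hy, rfl⟩ := exists_applyOps_of_reach (hW.of_le hle)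
  have hS := h3 l hl hy hbip (I ∩ applyOps G l Finset.univ) Finset.inter_subset_right
    (hI.isIndepSet.mono (by simp))
  rw [hI.card_eq] at hloss
  have hp0 : (0 : ℝ) < p := by exact_mod_cast hp
  have h4 : (p : ℝ) * G.indepNum ≤ p * S.card + k * G.indepNum := by
    exact_mod_cast hloss.trans (Nat.add_le_add_right (Nat.mul_le_mul_left p hS) _)
  rw [sub_mul, one_mul, div_mul_eq_mul_div, sub_le_iff_le_add, ← mul_le_mul_iff_right₀ hp0,
    mul_add, mul_div_cancel₀ _ hp0.ne']
  exact h4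

end RandProg

theorem mainTheorem3 :
    ∃ (P : RandProg.Program) (C : ℝ) (K : ℕ → ℕ → ℝ),
      ∀ (k p : ℕ), 1 ≤ p → ∀ (n : ℕ), 1 ≤ n → ∀ G : SimpleGraph (Fin n), iocp G ≤ k →
        ∃ D : PMF (Finset (Fin n)),
          P.HaltsWithin (RandProg.encodeInput k p G)
            (K k p * (n : ℝ) ^ (C * ((k : ℝ) + (p : ℝ) * Real.log n)))
            (D.map RandProg.encodeSet) ∧
          (∀ S ∈ D.support, G.IsIndepSet (S : Set (Fin n))) ∧
          1 / 2 ≤ D.toOuterMeasure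
            {S | (1 - (k : ℝ) / (p : ℝ)) * (G.indepNum : ℝ) ≤ (S.card : ℝ)} := by
  refine ⟨RandProg.prog, 38, RandProg.timeFactor, fun k p hp n hn G hG => ?_⟩
  obtain ⟨S, hS, hrun, hcard⟩ := RandProg.exists_runs_prog k p hp hn hG
  -- The program does not flip coins, so that its output is a fixed set.
  refine ⟨PMF.pure S, ?_, ?_, ?_⟩
  · rw [PMF.pure_map]
    exact hrun.haltsWithin (RandProg.totalCost_le_rpow k p n hp hn)
  · intro T hT
    rw [PMF.support_pure, Set.mem_singleton_iff] at hT
    exact hT ▸ hS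
  · rw [PMF.toOuterMeasure_pure_apply, if_pos (by exact hcard)]
    exact ENNReal.half_le_self
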